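/- Let $\gamma>0$. Let $A\in\mathbb R^{J\times N}$, $y\in\mathbb R^J$, and let $\Gamma\in\mathbb R^{J\times J}$, $\Gamma_0\in\mathbb R^{N\times N}$ be symmetric positive definite. Put $$B=(A^T\Gamma^{-1}A+\Gamma_0^{-1})^{-1},\quad c=A^T\Gamma^{-1}y,\quad \Phi(q)=\tfrac12\langle y-Aq,\Gamma^{-1}(y-Aq)\rangle+\tfrac12\langle q,\Gamma_0^{-1}q\rangle ,$$ so that $\pi\propto e^{-\Phi}$ is the posterior of the linear Bayesian inverse problem $y=Aq+\eta$, $\eta\sim N(0,\Gamma)$, $q\sim N(0,\Gamma_0)$. Consider the mean-field stochastic dynamics $$\dot q=p,\qquad \dot p=-\mathcal C_q(\rho)(B^{-1}q-c)-\gamma p+\sqrt{2\gamma\,\mathcal C_q(\rho)}\,\dot W,$$ where $\rho=\rho_t$ is the law of $(q_t,p_t)\in\mathbb R^N\times\mathbb R^N$, with mean $(m_q,m_p)$ and covariance $\begin{pmatrix}C_q&C_{q,p}\\ C_{q,p}^T&C_p\end{pmatrix}$, $\mathcal C_q(\rho)=C_q$, and $W$ is a standard $N$-dimensional Brownian motion.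 1. For every solution with locally (in time) bounded second moments, the mean and covariance of the law satisfy on $[0,\infty)$ $$\begin{aligned}\dot m_q&=m_p,\\ \dot m_p&=-C_q(B^{-1}m_q-c)-\gamma m_p,\\ \dot C_q&=C_{q,p}+C_{q,p}^T,\\ \dot C_p&=-C_qB^{-1}C_{q,p}-(C_qB^{-1}C_{q,p})^T-2\gamma C_p+2\gamma C_q,\\ \dot C_{q,p}&=-\gamma C_{q,p}-C_qB^{-1}C_q+C_p.\end{aligned}\qquad(*)$$ 2. The unique steady state of $(*)$ with positive-definite covariance is $m_q=Bc$, $m_p=0$, $C_{q,p}=0$, $C_q=C_p=B$. These are the mean and covariance of the Gibbs measure with density proportional to $\exp(-\frac12\langle p,B^{-1}p\rangle-\Phi(q))$; this measure is Gaussian, and its marginal on $q$ is the posterior $\pi$, which is Gaussian. 3. The other steady states of $(*)$ (with symmetric covariance) are exactly the states different from the one in 2 of the form $m_q=B(c+m)$, $m_p=0$, $C_{q,p}=0$, $C_q=C_p=B^{1/2}XB^{1/2}$ with $X\ne I$ an orthogonal projection matrix ($X=X^T=X^2$) and $C_qm=0$. They have positive semidefinite, singular covariance, and are unstable: the linearization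 of $(*)$ at such a state, on the space of states with symmetric covariance, has an eigenvalue with positive real part, and the state is not Lyapunov stable under perturbations within the set of all means and positive semidefinite covariances. 4. The steady state in 2 is hyperbolic and linearly stable: all eigenvalues of the linearization of $(*)$ there, on the space of states with symmetric covariance, have negative real part. Its basin of attraction in the set of all mean vectors and positive-definite covariances is relatively open in that set and contains the steady state. 5. Solutions of $(*)$ that start in this basin converge to the steady state at a speed independent of $B$ and $c$, in the following sense. There is a rate $\kappa>0$ depending only on $\gamma$ such that each of them has distance at most $K'e^{-\kappa t}$ from it for all $t\ge0$, with some constant $K'$ depending on the solution. Moreover, in the coordinates $$x_1=B^{1/2}(B^{-1}m_q-c),\ x_2=B^{-1/2}m_p,\ X=B^{-1/2}C_qB^{-1/2},\ Y=B^{-1/2}C_pB^{-1/2},\ Z=B^{-1/2}C_{q,p}B^{-1/2},$$ in which the steady state is $(0,0,I,I,0)$, the distance from it is at most $Ke^{-\kappa t}$, where $K$ depends only on $\gamma$, $N$ and the initial value in these coordinates, not on $A,\Gamma,\Gamma_0,y,J$; and for two inverse problems with the same $N$, any two solutions of $(*)$ on $[0,\infty)$ (one for each problem) with the same initial value in these coordinates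 coincide in these coordinates for all times $t\ge0$. -/

import Mathlib

open MeasureTheory ProbabilityTheory Filter Topology Set
open scoped NNReal ENNReal Matrix MatrixOrder

-- Matrices carry the entrywise sup norm; all norms on these finite-dimensional spaces are
-- equivalent, so nothing below depends on this choice.
attribute [local instance] Matrix.normedAddCommGroup Matrix.normedSpace

noncomputable section

namespace EnsembleLangevin

/-! ### Linear Bayesian inverse problems -/

/-- The data of the inverse problem `y = A q + η`, with prior `q ∼ N(0, Γ₀)` and independent
noise `η ∼ N(0, Γ)`, where `Γ` and `Γ₀` are symmetric positive definite. -/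
structure LinearInverseProblem (N J : ℕ) where
  A : Matrix (Fin J) (Fin N) ℝ
  Γ : Matrix (Fin J) (Fin J) ℝ
  Γ₀ : Matrix (Fin N) (Fin N) ℝ
  y : Fin J → ℝ
  posDef_Γ : Γ.PosDef
  posDef_Γ₀ : Γ₀.PosDef

namespace LinearInverseProblem

variable {N J : ℕ} (P : LinearInverseProblem N J)

/-- The posterior covariance `B = (Aᵀ Γ⁻¹ A + Γ₀⁻¹)⁻¹`. -/
def B : Matrix (Fin N) (Fin N) ℝ := (P.Aᵀ * P.Γ⁻¹ * P.A + P.Γ₀⁻¹)⁻¹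

/-- The vector `c = Aᵀ Γ⁻¹ y`. -/
def c : Fin N → ℝ := P.Aᵀ *ᵥ (P.Γ⁻¹ *ᵥ P.y)

/-- The potential `Φ(q) = ½ ‖y - A q‖²_Γ + ½ ‖q‖²_{Γ₀}`, where `‖v‖²_C = ⟨v, C⁻¹ v⟩`. -/
def potential (q : Fin N → ℝ) : ℝ :=
  1 / 2 * ((P.y - P.A *ᵥ q) ⬝ᵥ (P.Γ⁻¹ *ᵥ (P.y - P.A *ᵥ q))) + 1 / 2 * (q ⬝ᵥ (P.Γ₀⁻¹ *ᵥ q))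

/-- The Hamiltonian `H(q, p) = ½ ⟨p, M⁻¹ p⟩ + Φ(q)` with mass matrix `M`. -/
def hamiltonian (M : Matrix (Fin N) (Fin N) ℝ) (z : (Fin N → ℝ) × (Fin N → ℝ)) : ℝ :=
  1 / 2 * (z.2 ⬝ᵥ (M⁻¹ *ᵥ z.2)) + P.potential z.1

end LinearInverseProblem

/-- The measure with density proportional to `exp (-V)` with respect to Lebesgue measure,
normalized to total mass one. -/
def normalizedExpNeg {E : Type*} [MeasureSpace E] (V : E → ℝ) : Measure E :=
  (∫⁻ x, ENNReal.ofReal (Real.exp (-V x)))⁻¹ •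
    volume.withDensity (fun x => ENNReal.ofReal (Real.exp (-V x)))

/-- The posterior distribution `π ∝ exp (-Φ)`, solving the Bayesian inverse problem. -/
def LinearInverseProblem.posterior {N J : ℕ} (P : LinearInverseProblem N J) :
    Measure (Fin N → ℝ) :=
  normalizedExpNeg P.potential

/-- The Gibbs measure `Π ∝ exp (-H)` on phase space, with mass matrix `M`. -/
def LinearInverseProblem.gibbs {N J : ℕ} (P : LinearInverseProblem N J)
    (M : Matrix (Fin N) (Fin N) ℝ) : Measure ((Fin N → ℝ) × (Fin N → ℝ)) :=
  normalizedExpNeg (P.hamiltonian M)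

/-! ### Means and covariances -/

/-- A tuple `(m_q, m_p, C_q, C_p, C_{q,p})`: the blocks of a mean vector in `ℝ^{2N}` and of a
`2N × 2N` covariance matrix. -/
abbrev MomentState (N : ℕ) : Type :=
  (Fin N → ℝ) × (Fin N → ℝ) × Matrix (Fin N) (Fin N) ℝ × Matrix (Fin N) (Fin N) ℝ ×
    Matrix (Fin N) (Fin N) ℝ

namespace MomentState

variable {N : ℕ}

abbrev mq (x : MomentState N) : Fin N → ℝ := x.1
abbrev mp (x : MomentState N) : Fin N → ℝ := x.2.1
abbrev Cq (x : MomentState N) : Matrix (Fin N) (Fin N) ℝ := x.2.2.1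
abbrev Cp (x : MomentState N) : Matrix (Fin N) (Fin N) ℝ := x.2.2.2.1
abbrev Cqp (x : MomentState N) : Matrix (Fin N) (Fin N) ℝ := x.2.2.2.2

/-- The full covariance matrix with blocks `C_q, C_{q,p}, C_{q,p}ᵀ, C_p`. -/
def cov (x : MomentState N) : Matrix (Fin N ⊕ Fin N) (Fin N ⊕ Fin N) ℝ :=
  Matrix.fromBlocks x.Cq x.Cqp x.Cqpᵀ x.Cp

end MomentState

/-- The mean and covariance of a law `ρ` on phase space `ℝ^N × ℝ^N ∋ (q, p)`. -/
def moments {N : ℕ} (ρ : Measure ((Fin N → ℝ) × (Fin N → ℝ))) : MomentState N :=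
  (fun i => ∫ z, z.1 i ∂ρ,
   fun i => ∫ z, z.2 i ∂ρ,
   Matrix.of fun i j => cov[fun z => z.1 i, fun z => z.1 j; ρ],
   Matrix.of fun i j => cov[fun z => z.2 i, fun z => z.2 j; ρ],
   Matrix.of fun i j => cov[fun z => z.1 i, fun z => z.2 j; ρ])

/-! ### The mean-field stochastic dynamics -/

/-- `I` is the Itô integral `∫₀ᵗ σ(s) dW_s` of the deterministic continuous matrix function `σ`
against the vector Brownian motion `W`: the `L²` limit, as the mesh `1 / n` tends to zero, of the
integrals up to time `t` of the step functions equal to `σ(k / n)` on `[k / n, (k + 1) / n)`. -/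
def IsItoIntegral {N : ℕ} {Ω : Type*} [MeasurableSpace Ω] (μ : Measure Ω)
    (W : Fin N → ℝ≥0 → Ω → ℝ) (σ : ℝ≥0 → Matrix (Fin N) (Fin N) ℝ) (t : ℝ≥0)
    (I : Ω → Fin N → ℝ) : Prop :=
  ∀ i : Fin N, Tendsto (fun n : ℕ => eLpNorm (fun ω =>
      (∑ k ∈ Finset.range ⌈t * n⌉₊, ∑ j : Fin N, σ ((k : ℝ≥0) / n) i j *
        (W j (min (((k + 1 : ℕ) : ℝ≥0) / n) t) ω - W j (min ((k : ℝ≥0) / n) t) ω)) - I ω i)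
      2 μ) atTop (𝓝 0)

/-- The law `ρ_t` of `(q_t, p_t)`. -/
def law {N : ℕ} {Ω : Type*} [MeasurableSpace Ω] (μ : Measure Ω)
    (q p : ℝ≥0 → Ω → Fin N → ℝ) (t : ℝ≥0) : Measure ((Fin N → ℝ) × (Fin N → ℝ)) :=
  μ.map (fun ω => (q t ω, p t ω))

/-- `(q, p)` is a solution, with locally bounded second moments, of the mean-field
(McKean-Vlasov) stochastic differential equation
`dq = p dt`, `dp = (-C_q(ρ) (B⁻¹ q - c) - γ p) dt + √(2 γ C_q(ρ)) dW`, `ρ_t = Law(q_t, p_t)`,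
driven by a standard `N`-dimensional Brownian motion `W` relative to the filtration `ℱ`. -/
structure IsMeanFieldSolution {N : ℕ} {Ω : Type*} [mΩ : MeasurableSpace Ω] (μ : Measure Ω)
    (γ : ℝ) (B : Matrix (Fin N) (Fin N) ℝ) (c : Fin N → ℝ) (ℱ : Filtration ℝ≥0 mΩ)
    (W : Fin N → ℝ≥0 → Ω → ℝ) (q p : ℝ≥0 → Ω → Fin N → ℝ) : Prop where
  /-- each component of `W` is a standard Brownian motion -/
  brownian : ∀ i, IsBrownianReal (W i) μ
  /-- the components of `W` are independent -/
  brownian_indep : iIndepFun (fun i ω t => W i t ω) μ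
  /-- `W` is adapted, and its increments are independent of the past -/
  brownian_adapted : ∀ i t, Measurable[ℱ t] (W i t)
  brownian_increments : ∀ s t, s ≤ t →
    Indep (MeasurableSpace.comap (fun ω i => W i t ω - W i s ω) inferInstance) (ℱ s) μ
  /-- `(q, p)` is adapted with continuous paths -/
  q_adapted : ∀ t, Measurable[ℱ t] (q t)
  p_adapted : ∀ t, Measurable[ℱ t] (p t)
  q_continuous : ∀ᵐ ω ∂μ, Continuous (fun t => q t ω)
  p_continuous : ∀ᵐ ω ∂μ, Continuous (fun t => p t ω)
  /-- second moments are finite, locally uniformly in time -/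
  q_memLp : ∀ t i, MemLp (fun ω => q t ω i) 2 μ
  p_memLp : ∀ t i, MemLp (fun ω => p t ω i) 2 μ
  moment_bound : ∀ T : ℝ≥0, ∃ R : ℝ, ∀ t ≤ T, ∀ i,
    ∫ ω, (q t ω i) ^ 2 ∂μ ≤ R ∧ ∫ ω, (p t ω i) ^ 2 ∂μ ≤ R
  /-- `q_t = q_0 + ∫₀ᵗ p_s ds` -/
  position_eq : ∀ t : ℝ≥0, ∀ᵐ ω ∂μ,
    q t ω = q 0 ω + ∫ s in (0 : ℝ)..t, p s.toNNReal ω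
  /-- `p_t - p_0 + ∫₀ᵗ (C_q(ρ_s) (B⁻¹ q_s - c) + γ p_s) ds = ∫₀ᵗ √(2 γ C_q(ρ_s)) dW_s` -/
  momentum_eq : ∀ t : ℝ≥0,
    IsItoIntegral μ W (fun s => CFC.sqrt ((2 * γ) • (moments (law μ q p s)).Cq)) t
      (fun ω => p t ω - p 0 ω + ∫ s in (0 : ℝ)..t,
        ((moments (law μ q p s.toNNReal)).Cq *ᵥ (B⁻¹ *ᵥ q s.toNNReal ω - c)
          + γ • p s.toNNReal ω))

/-! ### The ordinary differential equations for mean and covariance -/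

/-- The right-hand side of the system of ordinary differential equations for
`(m_q, m_p, C_q, C_p, C_{q,p})`. -/
def momentField {N : ℕ} (γ : ℝ) (B : Matrix (Fin N) (Fin N) ℝ) (c : Fin N → ℝ)
    (x : MomentState N) : MomentState N :=
  (x.mp,
   -(x.Cq *ᵥ (B⁻¹ *ᵥ x.mq - c)) - γ • x.mp,
   x.Cqp + x.Cqpᵀ,
   -(x.Cq * B⁻¹ * x.Cqp) - (x.Cq * B⁻¹ * x.Cqp)ᵀ - (2 * γ) • x.Cp + (2 * γ) • x.Cq,
   -(γ • x.Cqp) - x.Cq * B⁻¹ * x.Cq + x.Cp)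

/-- The nondegenerate equilibrium `m_q = B c, m_p = 0, C_q = C_p = B, C_{q,p} = 0`. -/
def equilibrium {N : ℕ} (B : Matrix (Fin N) (Fin N) ℝ) (c : Fin N → ℝ) : MomentState N :=
  (B *ᵥ c, 0, B, B, 0)

/-- The linear space of tuples whose covariance matrix is symmetric, that is, with symmetric blocks
`C_q` and `C_p`: the phase space of the system (the set of means and positive definite covariances is an open subset of it). -/
def symmetricStates (N : ℕ) : Submodule ℝ (MomentState N) where
  carrier := {x | x.Cq.IsSymm ∧ x.Cp.IsSymm}
  add_mem' hx hy := ⟨hx.1.add hy.1, hx.2.add hy.2⟩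
  zero_mem' := ⟨Matrix.isSymm_zero, Matrix.isSymm_zero⟩
  smul_mem' a _ hx := ⟨hx.1.smul a, hx.2.smul a⟩

/-- The set of all means and positive semidefinite covariances. -/
def covarianceStates (N : ℕ) : Set (MomentState N) := {x | x.cov.PosSemidef}

/-- The set of all means and positive definite covariances. -/
def nondegenerateStates (N : ℕ) : Set (MomentState N) := {x | x.cov.PosDef}

/-! ### Stability notions -/

section Stability

variable {E : Type*} [NormedAddCommGroup E] [NormedSpace ℝ E]

/-- `z` is an eigenvalue of the complexification of the real operator `L` on the invariant
subspace `S`: there is a complex eigenvector `u + i v ≠ 0` with `u, v ∈ S`. -/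
def IsComplexEigenvalueOn (L : E →L[ℝ] E) (S : Submodule ℝ E) (z : ℂ) : Prop :=
  ∃ u ∈ S, ∃ v ∈ S, (u ≠ 0 ∨ v ≠ 0) ∧
    L u = z.re • u - z.im • v ∧ L v = z.im • u + z.re • v

/-- No eigenvalue of the linearization of `F` at `x` on the phase space `S` is purely
imaginary. -/
def IsHyperbolicAt (F : E → E) (S : Submodule ℝ E) (x : E) : Prop :=
  ∀ z : ℂ, IsComplexEigenvalueOn (fderiv ℝ F x) S z → z.re ≠ 0

/-- All eigenvalues of the linearization of `F` at `x` on `S` have negative real part. -/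
def IsLinearlyStableAt (F : E → E) (S : Submodule ℝ E) (x : E) : Prop :=
  ∀ z : ℂ, IsComplexEigenvalueOn (fderiv ℝ F x) S z → z.re < 0

/-- Some eigenvalue of the linearization of `F` at `x` on `S` has positive real part. -/
def IsLinearlyUnstableAt (F : E → E) (S : Submodule ℝ E) (x : E) : Prop :=
  ∃ z : ℂ, IsComplexEigenvalueOn (fderiv ℝ F x) S z ∧ 0 < z.re

/-- Lyapunov stability of `x` for `ż = F(z)`, for initial values in `D`. -/
def IsLyapunovStableAt (F : E → E) (D : Set E) (x : E) : Prop :=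
  ∀ ε > 0, ∃ δ > 0, ∀ (T : ℝ) (z : ℝ → E), IsIntegralCurveOn z (fun _ => F) (Icc 0 T) →
    z 0 ∈ D → ‖z 0 - x‖ < δ → ∀ t ∈ Icc 0 T, ‖z t - x‖ < ε

/-- The basin of attraction of `x` in `D`: the initial values in `D` from which a solution exists
for all times and converges to `x`. -/
def basin (F : E → E) (D : Set E) (x : E) : Set E :=
  {x₀ ∈ D | ∃ z : ℝ → E, z 0 = x₀ ∧ IsIntegralCurveOn z (fun _ => F) (Ici 0) ∧
    Tendsto z atTop (𝓝 x)}

end Stability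

/-- The affine-invariant coordinates `x₁ = B^{1/2} (B⁻¹ m_q - c)`, `x₂ = B^{-1/2} m_p`,
`X = B^{-1/2} C_q B^{-1/2}`, `Y = B^{-1/2} C_p B^{-1/2}`, `Z = B^{-1/2} C_{q,p} B^{-1/2}`, in which
the nondegenerate equilibrium is `(0, 0, 1, 1, 0)`. -/
def normalizedCoords {N : ℕ} (B : Matrix (Fin N) (Fin N) ℝ) (c : Fin N → ℝ)
    (x : MomentState N) : MomentState N :=
  (CFC.sqrt B *ᵥ (B⁻¹ *ᵥ x.mq - c),
   (CFC.sqrt B)⁻¹ *ᵥ x.mp,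
   (CFC.sqrt B)⁻¹ * x.Cq * (CFC.sqrt B)⁻¹,
   (CFC.sqrt B)⁻¹ * x.Cp * (CFC.sqrt B)⁻¹,
   (CFC.sqrt B)⁻¹ * x.Cqp * (CFC.sqrt B)⁻¹)

end EnsembleLangevin

end

open EnsembleLangevin

namespace EnsembleLangevin

/-! ### Autonomous ordinary differential equations -/

section ODE

variable {E : Type*} [NormedAddCommGroup E] [NormedSpace ℝ E]

/-! The moment equations close because the drift is affine in `(q, p)` and its coefficients, like
the diffusion, involve the law only through `C_q`. They are derived in `L²(μ)`: the processes become
curves in a Hilbert space, the constant `1` becomes a unit vector `e`, and means and covariances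
become inner products. The momentum is a differentiable curve plus a noise `M` whose increments
after time `t` are orthogonal to everything known at time `t` and have Gram matrix `2γ C_q(t)(r - t)
+ o(r - t)`, by the Itô isometry. A product rule for such curves (`HasNoisyRightDeriv.inner`) gives
the right derivatives of all moments. These are continuous, hence genuine derivatives, and no Itô
formula is needed.

Everything else concerns the ODE system. Conjugation by `B^{1/2}` reduces it to `B = 1`, `c = 0`
(`transport_momentField`), so the dynamical statements have to be understood for a single normalized
system; this is also why rates and prefactors do not see the inverse problem. At a steady state
`C_{q,p}` is both skew and symmetric, hence zero, and what remains says that the normalized `C_q` is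
an orthogonal projection `X`.

At `X = 1` the linearization on symmetric states decouples into small damped scalar systems. The
natural energy dissipates only part of the variables; a small cross term, as in hypocoercivity,
turns it into a strict quadratic Lyapunov function with a rate depending on `γ` only
(`lyapunovForm_decay`). It controls the spectrum, makes the basin open, and gives exponential
convergence.

At `X ≠ 1`, perturbations along a unit vector of `ker X` obey a closed five-dimensional system
(`momentField_add_rankOneLift`). Its linearization has an eigenvalue `l > 0`. For nonlinear
instability, a left eigenvector for `l` defines a functional that is positive on positive definite
`2 × 2` covariances and must grow exponentially as long as the solution stays in a small ball
(`rankOne_not_bounded`).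

The Gibbs measure and the posterior are identified by completing the square
(`potential_equilibrium_add`), which exhibits them as affine images of standard Gaussian measures.
-/

lemma hasDerivWithinAt_Ici_of_curve {F : E → E} {z : ℝ → E}
    (hz : IsIntegralCurveOn z (fun _ => F) (Ici 0)) {t : ℝ} (ht : 0 ≤ t) :
    HasDerivWithinAt z (F (z t)) (Ici t) t :=
  (hz t ht).mono (Ici_subset_Ici.2 ht)

lemma continuousOn_of_curve {F : E → E} {z : ℝ → E} {s : Set ℝ}
    (hz : IsIntegralCurveOn z (fun _ => F) s) : ContinuousOn z s :=
  fun t ht => (hz t ht).continuousWithinAt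

/-- A `C¹` vector field agrees on any ball with a bounded, globally Lipschitz one. -/
lemma exists_lipschitz_cutoff [FiniteDimensional ℝ E] {F : E → E} (hF : ContDiff ℝ 1 F) (R : ℝ) :
    ∃ (G : E → E) (K C : ℝ≥0), LipschitzWith K G ∧ (∀ x, ‖G x‖ ≤ C) ∧ ∀ x, ‖x‖ < R → G x = F x := by
  -- A bump function needs a positive inner radius, while `R` is an arbitrary real; hence `max R 1`.
  let f : ContDiffBump (0 : E) := ⟨max R 1, max R 1 + 1, by positivity, by linarith⟩
  have hc : HasCompactSupport (fun x => f x • F x) := f.hasCompactSupport.smul_right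
  have hd : ContDiff ℝ 1 (fun x => f x • F x) := f.contDiff.smul hF
  obtain ⟨K, hK⟩ := hd.lipschitzWith_of_hasCompactSupport hc one_ne_zero
  obtain ⟨C, hC⟩ := hc.exists_bound_of_continuous hd.continuous
  refine ⟨_, K, C.toNNReal, hK, fun x => (hC x).trans (Real.le_coe_toNNReal C), fun x hx => ?_⟩
  have : f x = 1 := f.one_of_mem_closedBall (by
    simp only [Metric.mem_closedBall, dist_zero_right]
    exact hx.le.trans (le_max_left _ _))
  simp [this]

/-- Two solutions of `ż = G(z)` with `G` Lipschitz, started together, coincide. -/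
lemma curve_unique_of_lipschitz {G : E → E} {K : ℝ≥0} (hK : LipschitzWith K G) {z w : ℝ → E}
    {T : ℝ} (hz : IsIntegralCurveOn z (fun _ => G) (Icc 0 T))
    (hw : IsIntegralCurveOn w (fun _ => G) (Icc 0 T)) (h0 : z 0 = w 0) :
    ∀ t ∈ Icc 0 T, z t = w t := by
  have aux : ∀ {u : ℝ → E}, IsIntegralCurveOn u (fun _ => G) (Icc 0 T) → ∀ t ∈ Ico 0 T,
      HasDerivWithinAt u (G (u t)) (Ici t) t := fun hu t ht =>
    (hu t ⟨ht.1, ht.2.le⟩).mono_of_mem_nhdsWithin (mem_of_superset (Icc_mem_nhdsGE ht.2)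
      (Icc_subset_Icc ht.1 le_rfl))
  have := dist_le_of_trajectories_ODE (v := fun _ => G) (δ := 0) (fun _ => hK)
    (continuousOn_of_curve hz) (aux hz) (continuousOn_of_curve hw) (aux hw) (by simp [h0])
  intro t ht
  simpa using this t ht

/-- A bounded, globally Lipschitz vector field has global forward solutions. -/
lemma exists_curve_of_lipschitz [CompleteSpace E] {G : E → E} {K C : ℝ≥0} (hK : LipschitzWith K G)
    (hC : ∀ x, ‖G x‖ ≤ C) (x : E) :
    ∃ z : ℝ → E, z 0 = x ∧ IsIntegralCurveOn z (fun _ => G) (Ici 0) := by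
  have hT (T : ℝ≥0) : ∃ z : ℝ → E, z 0 = x ∧ IsIntegralCurveOn z (fun _ => G) (Icc 0 T) := by
    -- A field bounded by `C` cannot leave the ball of radius `C * T` within time `T`, so
    -- Picard-Lindelöf applies on intervals of any length.
    have : IsPicardLindelof (fun _ => G) (tmin := 0) (tmax := T) ⟨0, by simp⟩ x (C * T) 0 C K :=
      IsPicardLindelof.of_time_independent (fun x _ => hC x) hK.lipschitzOnWith (by simp)
    exact this.exists_eq_forall_mem_Icc_hasDerivWithinAt₀
  choose z hz0 hz using hT
  have hagree : ∀ (S T : ℝ≥0) (t : ℝ), 0 ≤ t → t ≤ S → t ≤ T → z S t = z T t := by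
    intro S T t h0 hS hT
    refine curve_unique_of_lipschitz hK (T := t) (fun s hs => ?_) (fun s hs => ?_)
      ((hz0 S).trans (hz0 T).symm) t ⟨h0, le_rfl⟩
    · exact (hz S s ⟨hs.1, hs.2.trans hS⟩).mono (Icc_subset_Icc le_rfl hS)
    · exact (hz T s ⟨hs.1, hs.2.trans hT⟩).mono (Icc_subset_Icc le_rfl hT)
  -- The global curve is glued diagonally. Near `t` it agrees with the single solution on `[0, t +
  -- 2]`, which supplies the derivative.
  refine ⟨fun t => z (t.toNNReal + 1) t, by simpa using hz0 _, fun t ht => ?_⟩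
  have ht' : (0 : ℝ) ≤ t := ht
  set T : ℝ≥0 := t.toNNReal + 2 with hTdef
  have hTt : (T : ℝ) = t + 2 := by simp [hTdef, Real.coe_toNNReal t ht']
  have h1 : HasDerivWithinAt (z T) (G (z T t)) (Icc 0 T) t := hz T t ⟨ht', by rw [hTt]; linarith⟩
  have h2 : HasDerivWithinAt (z T) (G (z T t)) (Ici 0) t := by
    refine h1.mono_of_mem_nhdsWithin ?_
    have : Iio (T : ℝ) ∈ 𝓝 t := Iio_mem_nhds (by rw [hTt]; linarith)
    filter_upwards [self_mem_nhdsWithin, mem_nhdsWithin_of_mem_nhds this] with s hs hs'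
    exact ⟨hs, le_of_lt hs'⟩
  have heq : ∀ s : ℝ, 0 ≤ s → s < t + 1 → z (s.toNNReal + 1) s = z T s := fun s hs hs' =>
    hagree _ _ s hs (by simp [Real.coe_toNNReal s hs]) (by rw [hTt]; linarith)
  have h3 : z (t.toNNReal + 1) t = z T t := heq t ht' (by linarith)
  simp only [h3]
  refine h2.congr_of_eventuallyEq ?_ h3
  filter_upwards [self_mem_nhdsWithin,
    mem_nhdsWithin_of_mem_nhds (Iio_mem_nhds (lt_add_one t))] with s hs hs'
  exact heq s hs hs'

lemma exists_norm_bound_of_curve {F : E → E} {z : ℝ → E}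
    (hz : IsIntegralCurveOn z (fun _ => F) (Ici 0)) (T : ℝ) :
    ∃ R, ∀ t ∈ Icc 0 T, ‖z t‖ < R := by
  obtain ⟨R, hR⟩ := isCompact_Icc.exists_bound_of_continuousOn
    ((continuousOn_of_curve hz).mono (Icc_subset_Ici_self : Icc 0 T ⊆ Ici 0))
  exact ⟨R + 1, fun t ht => (hR t ht).trans_lt (lt_add_one R)⟩

/-- Two forward solutions of `ż = F(z)` with `F` of class `C¹`, started together, coincide. -/
lemma curve_unique [FiniteDimensional ℝ E] {F : E → E} (hF : ContDiff ℝ 1 F) {z w : ℝ → E}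
    (hz : IsIntegralCurveOn z (fun _ => F) (Ici 0)) (hw : IsIntegralCurveOn w (fun _ => F) (Ici 0))
    (h0 : z 0 = w 0) : ∀ t ≥ 0, z t = w t := by
  intro T hT
  obtain ⟨R, hR⟩ := exists_norm_bound_of_curve hz T
  obtain ⟨S, hS⟩ := exists_norm_bound_of_curve hw T
  obtain ⟨G, K, C, hK, -, hGF⟩ := exists_lipschitz_cutoff hF (max R S)
  refine curve_unique_of_lipschitz hK (fun t ht => ?_) (fun t ht => ?_) h0 T ⟨hT, le_rfl⟩
  · beta_reduce
    rw [hGF _ ((hR t ht).trans_le (le_max_left _ _))]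
    exact (hz t ht.1).mono Icc_subset_Ici_self
  · beta_reduce
    rw [hGF _ ((hS t ht).trans_le (le_max_right _ _))]
    exact (hw t ht.1).mono Icc_subset_Ici_self

/-- A solution of `ż = F(z)` started in a ball either reaches the boundary of the ball or exists for
all times. -/
lemma escape_or_global [FiniteDimensional ℝ E] {F : E → E} (hF : ContDiff ℝ 1 F) {x x₀ : E}
    {ε : ℝ} (h0 : ‖x₀ - x‖ < ε) :
    (∃ (T : ℝ) (z : ℝ → E), 0 ≤ T ∧ IsIntegralCurveOn z (fun _ => F) (Icc 0 T) ∧ z 0 = x₀ ∧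
      ‖z T - x‖ = ε) ∨
    ∃ z : ℝ → E, z 0 = x₀ ∧ IsIntegralCurveOn z (fun _ => F) (Ici 0) ∧
      ∀ t ≥ 0, ‖z t - x‖ < ε := by
  have : CompleteSpace E := FiniteDimensional.complete ℝ E
  -- The radius is such that `G = F` on the closed `ε`-ball around `x`, including the exit point.
  obtain ⟨G, K, C, hK, hC, hGF⟩ := exists_lipschitz_cutoff hF (‖x‖ + ε + 1)
  obtain ⟨z, hz0, hz⟩ := exists_curve_of_lipschitz hK hC x₀
  have hGF' : ∀ t, ‖z t - x‖ ≤ ε → G (z t) = F (z t) := fun t ht => hGF _ (by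
    have := norm_add_le (z t - x) x
    rw [sub_add_cancel] at this
    linarith)
  have hcont : ContinuousOn (fun t => ‖z t - x‖) (Ici 0) :=
    ((continuousOn_of_curve hz).sub continuousOn_const).norm
  by_cases hall : ∀ t ≥ 0, ‖z t - x‖ < ε
  · refine Or.inr ⟨z, hz0, fun t ht => ?_, hall⟩
    beta_reduce
    rw [← hGF' t (hall t ht).le]
    exact hz t ht
  · push Not at hall
    obtain ⟨t₁, ht₁, hle⟩ := hall
    have hivt : ∀ t ≥ 0, ε ≤ ‖z t - x‖ → ∃ s ∈ Icc 0 t, ‖z s - x‖ = ε := fun t ht hle =>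
      intermediate_value_Icc ht (hcont.mono Icc_subset_Ici_self) ⟨by rw [hz0]; exact h0.le, hle⟩
    -- `S` is the set of hitting times of the sphere. Its infimum is the first one, and by the
    -- intermediate value theorem the curve stays in the closed ball until then.
    let S : Set ℝ := Icc 0 t₁ ∩ (fun t => ‖z t - x‖) ⁻¹' {ε}
    have hScl : IsClosed S :=
      (hcont.mono Icc_subset_Ici_self).preimage_isClosed_of_isClosed isClosed_Icc isClosed_singleton
    have hSne : S.Nonempty := by
      obtain ⟨s, hs, hs'⟩ := hivt t₁ ht₁ hle
      exact ⟨s, hs, hs'⟩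
    have hSbdd : BddBelow S := ⟨0, fun s hs => hs.1.1⟩
    have hT := hScl.csInf_mem hSne hSbdd
    have hbefore : ∀ t ∈ Icc 0 (sInf S), ‖z t - x‖ ≤ ε := by
      intro t ht
      by_contra! hlt
      obtain ⟨s, hs, hs'⟩ := hivt t ht.1 hlt.le
      have h1 : sInf S ≤ s := csInf_le hSbdd ⟨⟨hs.1, hs.2.trans (ht.2.trans hT.1.2)⟩, hs'⟩
      have h2 : s = t := le_antisymm hs.2 (ht.2.trans h1)
      rw [h2] at hs'
      exact hlt.ne' hs'
    refine Or.inl ⟨sInf S, z, hT.1.1, fun t ht => ?_, hz0, hT.2⟩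
    beta_reduce
    rw [← hGF' t (hbefore t ht)]
    exact (hz t ht.1).mono Icc_subset_Ici_self

/-! ### Quadratic Lyapunov functions -/

variable {β : E →L[ℝ] E →L[ℝ] ℝ} {F : E → E} {L : E →L[ℝ] E} {e : E} {κ : ℝ}

/-- The constant is the minimum of the form on the compact unit sphere; the sphere is empty when `E`
is trivial, which needs a separate case. -/
lemma exists_coercive [FiniteDimensional ℝ E] (hpos : ∀ x ≠ 0, 0 < β x x) :
    ∃ c > 0, ∀ x, c * ‖x‖ ^ 2 ≤ β x x := by
  have : ProperSpace E := FiniteDimensional.proper ℝ E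
  have hcont : Continuous fun x => β x x := by fun_prop
  rcases (Metric.sphere (0 : E) 1).eq_empty_or_nonempty with hem | hne
  · refine ⟨1, one_pos, fun x => ?_⟩
    by_cases hx : x = 0
    · simp [hx]
    · exfalso
      have : ‖x‖⁻¹ • x ∈ Metric.sphere (0 : E) 1 := by
        simp [norm_smul, inv_mul_cancel₀ (norm_ne_zero_iff.2 hx)]
      simp [hem] at this
  · obtain ⟨m, hm, hmin⟩ := (isCompact_sphere (0 : E) 1).exists_isMinOn hne hcont.continuousOn
    have hm0 : m ≠ 0 := by
      rintro rfl
      simp at hm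
    refine ⟨β m m, hpos m hm0, fun x => ?_⟩
    by_cases hx : x = 0
    · simp [hx]
    have hn := norm_ne_zero_iff.2 hx
    have h1 := hmin (show ‖x‖⁻¹ • x ∈ Metric.sphere (0 : E) 1 by
      simp [norm_smul, inv_mul_cancel₀ hn])
    simp only [mem_ofPred_eq, map_smul, _root_.smul_apply, smul_eq_mul] at h1
    calc β m m * ‖x‖ ^ 2 ≤ (‖x‖⁻¹ * (‖x‖⁻¹ * β x x)) * ‖x‖ ^ 2 := by gcongr
      _ = β x x := by field_simp

/-- A quadratic Lyapunov function of the linearization is a local Lyapunov function of the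
nonlinear system. -/
lemma exists_local_lyapunov [FiniteDimensional ℝ E] (hpos : ∀ x ≠ 0, 0 < β x x)
    (hFe : F e = 0) (hFL : HasFDerivAt F L e) (hκ : 0 < κ)
    (hL : ∀ x, β x (L x) ≤ -κ * β x x) :
    ∃ r > 0, ∀ x, β (x - e) (x - e) < r → β (x - e) (F x) ≤ -(κ / 2) * β (x - e) (x - e) := by
  obtain ⟨c, hc, hcoer⟩ := exists_coercive hpos
  -- With this slope the remainder contributes at most half of the linear decay `κ c ‖x - e‖²`; the
  -- `+ 1` avoids division by zero.
  have hη : 0 < κ * c / (2 * (‖β‖ + 1)) := by positivity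
  have hlo := (hasFDerivAt_iff_isLittleO.1 hFL).def hη
  obtain ⟨δ, hδ, hball⟩ := Metric.eventually_nhds_iff.1 hlo
  -- By coercivity, the sublevel set at height `c * δ ^ 2` lies in the `δ`-ball where the remainder
  -- estimate holds.
  refine ⟨c * δ ^ 2, by positivity, fun x hx => ?_⟩
  have h1 : ‖x - e‖ < δ := by
    have := (hcoer (x - e)).trans_lt hx
    exact lt_of_pow_lt_pow_left₀ 2 hδ.le (lt_of_mul_lt_mul_left this hc.le)
  have h2 := hball (show dist x e < δ by rwa [dist_eq_norm])
  rw [hFe, sub_zero] at h2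
  have h3 : β (x - e) (F x) = β (x - e) (L (x - e)) + β (x - e) (F x - L (x - e)) := by
    rw [← map_add]; congr 1; abel
  have h4 : β (x - e) (F x - L (x - e)) ≤ κ / 2 * β (x - e) (x - e) := by
    calc β (x - e) (F x - L (x - e)) ≤ ‖β (x - e) (F x - L (x - e))‖ := le_abs_self _
      _ ≤ ‖β‖ * ‖x - e‖ * ‖F x - L (x - e)‖ := β.le_opNorm₂ _ _
      _ ≤ (‖β‖ + 1) * ‖x - e‖ * (κ * c / (2 * (‖β‖ + 1)) * ‖x - e‖) := by gcongr; linarith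
      _ = κ / 2 * (c * ‖x - e‖ ^ 2) := by field_simp
      _ ≤ _ := by gcongr; exact hcoer _
  linarith [hL (x - e)]

/-- A curve starting in a sublevel set of a strict quadratic Lyapunov function is trapped there and
decays exponentially. -/
lemma lyapunov_decay (hsymm : ∀ x y, β x y = β y x) {G : E → E} {r : ℝ} (hκ : 0 < κ)
    (hG : ∀ x, β (x - e) (x - e) < r → β (x - e) (G x) ≤ -(κ / 2) * β (x - e) (x - e))
    {z : ℝ → E} {a b : ℝ} (hc : ContinuousOn z (Icc a b))
    (hz : ∀ t ∈ Ico a b, HasDerivWithinAt z (G (z t)) (Ici t) t) {ρ : ℝ} (hρ : 0 < ρ) (hρr : ρ < r)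
    (ha : β (z a - e) (z a - e) ≤ ρ) :
    ∀ t ∈ Icc a b, β (z t - e) (z t - e) ≤ ρ * Real.exp (-(κ / 2) * (t - a)) := by
  have hderiv : ∀ t ∈ Ico a b, HasDerivWithinAt (fun t => β (z t - e) (z t - e))
      (2 * β (z t - e) (G (z t))) (Ici t) t := by
    intro t ht
    have h1 := (hz t ht).sub_const e
    have h2 := (β.hasFDerivAt.comp_hasDerivWithinAt t h1).clm_apply h1
    refine h2.congr_deriv ?_
    simp only [Function.comp_apply]
    rw [hsymm (G (z t))]; ring
  -- The barrier decays at rate `κ / 2`, while the form decays at rate at least `κ` wherever it is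
  -- below `r`. The strict inequality of slopes is needed only where the two meet, and there the
  -- common value is at most `ρ < r`.
  refine image_le_of_deriv_right_lt_deriv_boundary
    (B' := fun t => ρ * (Real.exp (-(κ / 2) * (t - a)) * (-(κ / 2)))) ?_ hderiv (by simpa using ha)
    (fun t => ?_) (fun t ht heq => ?_)
  · have := hc.sub (continuousOn_const (c := e))
    exact (β.continuous.comp_continuousOn this).clm_apply this
  · have := ((hasDerivAt_id t).sub_const a).const_mul (-(κ / 2))
    simpa using (this.exp).const_mul ρ
  · have hE : Real.exp (-(κ / 2) * (t - a)) ≤ 1 :=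
      Real.exp_le_one_iff.2 (by nlinarith [ht.1])
    have hpos := Real.exp_pos (-(κ / 2) * (t - a))
    have hlt : β (z t - e) (z t - e) < r := by rw [heq]; nlinarith
    have := hG _ hlt
    rw [heq] at this
    nlinarith [mul_pos hκ (mul_pos hρ hpos)]

/-- Near an equilibrium with a strict quadratic Lyapunov function, convergence is exponential. -/
theorem exponential_convergence [FiniteDimensional ℝ E] (hsymm : ∀ x y, β x y = β y x)
    (hpos : ∀ x ≠ 0, 0 < β x x) (hFe : F e = 0) (hFL : HasFDerivAt F L e) (hκ : 0 < κ)
    (hL : ∀ x, β x (L x) ≤ -κ * β x x) {z : ℝ → E}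
    (hz : IsIntegralCurveOn z (fun _ => F) (Ici 0)) (hlim : Tendsto z atTop (𝓝 e)) :
    ∃ K, ∀ t ≥ 0, ‖z t - e‖ ≤ K * Real.exp (-(κ / 4) * t) := by
  obtain ⟨c, hc, hcoer⟩ := exists_coercive hpos
  obtain ⟨r, hr, hloc⟩ := exists_local_lyapunov hpos hFe hFL hκ hL
  have hV : Tendsto (fun t => β (z t - e) (z t - e)) atTop (𝓝 0) := by
    have hcont : Continuous fun x => β (x - e) (x - e) := by fun_prop
    simpa [Function.comp_def] using (hcont.tendsto e).comp hlim
  obtain ⟨T, hT⟩ := eventually_atTop.1 ((hV.eventually_le_const (by positivity : (0:ℝ) < r / 2)).and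
    (eventually_ge_atTop 0))
  have hT0 : 0 ≤ T := (hT T le_rfl).2
  have hzc := continuousOn_of_curve hz
  obtain ⟨K₀, hK₀⟩ := isCompact_Icc.exists_bound_of_continuousOn (s := Icc 0 T)
    (f := fun t => Real.exp (κ / 4 * t) • (z t - e))
    (ContinuousOn.smul (by fun_prop) ((hzc.mono Icc_subset_Ici_self).sub continuousOn_const))
  -- The form is quadratic, so its rate `κ / 2` gives `κ / 4` for the norm. `K₁` solves `c ‖z t -
  -- e‖² ≤ (r / 2) exp(-(κ / 2)(t - T))` for the prefactor after time `T`; `K₀` covers the compact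
  -- interval before.
  set K₁ := Real.sqrt (r / 2 / c * Real.exp (κ / 2 * T))
  refine ⟨max K₀ K₁, fun t ht => ?_⟩
  have hexp : Real.exp (κ / 4 * t) * Real.exp (-(κ / 4) * t) = 1 := by
    rw [← Real.exp_add]; simp
  suffices h : Real.exp (κ / 4 * t) * ‖z t - e‖ ≤ max K₀ K₁ by
    calc ‖z t - e‖ = (Real.exp (κ / 4 * t) * ‖z t - e‖) * Real.exp (-(κ / 4) * t) := by
          rw [mul_right_comm, hexp, one_mul]
      _ ≤ _ := by gcongr
  rcases le_total t T with htT | htT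
  · have := hK₀ t ⟨ht, htT⟩
    rw [norm_smul, Real.norm_of_nonneg (Real.exp_pos _).le] at this
    exact this.trans (le_max_left _ _)
  · refine le_trans ?_ (le_max_right _ _)
    have h1 := lyapunov_decay hsymm hκ hloc (a := T) (b := t)
      (hzc.mono fun s hs => hT0.trans hs.1)
      (fun s hs => hasDerivWithinAt_Ici_of_curve hz (hT0.trans hs.1))
      (by positivity) (half_lt_self hr) (hT T le_rfl).1 t ⟨htT, le_rfl⟩
    have h2 := (hcoer (z t - e)).trans h1
    apply Real.le_sqrt_of_sq_le
    have h3 : Real.exp (κ / 4 * t) ^ 2 * Real.exp (-(κ / 2) * (t - T)) = Real.exp (κ / 2 * T) := by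
      rw [← Real.exp_nat_mul, ← Real.exp_add]; congr 1; push_cast; ring
    calc (Real.exp (κ / 4 * t) * ‖z t - e‖) ^ 2
        = Real.exp (κ / 4 * t) ^ 2 * (c * ‖z t - e‖ ^ 2) / c := by field_simp
      _ ≤ Real.exp (κ / 4 * t) ^ 2 * (r / 2 * Real.exp (-(κ / 2) * (t - T))) / c := by gcongr
      _ = r / 2 / c * Real.exp (κ / 2 * T) := by rw [← h3]; ring

/-- The basin of attraction of an equilibrium with a strict quadratic Lyapunov function is open. -/
theorem isOpen_basin [FiniteDimensional ℝ E] (hF : ContDiff ℝ 1 F) (hsymm : ∀ x y, β x y = β y x)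
    (hpos : ∀ x ≠ 0, 0 < β x x) (hFe : F e = 0) (hFL : HasFDerivAt F L e) (hκ : 0 < κ)
    (hL : ∀ x, β x (L x) ≤ -κ * β x x) : IsOpen (basin F univ e) := by
  have : CompleteSpace E := FiniteDimensional.complete ℝ E
  obtain ⟨c, hc, hcoer⟩ := exists_coercive hpos
  obtain ⟨r, hr, hloc⟩ := exists_local_lyapunov hpos hFe hFL hκ hL
  have hcont : Continuous fun x => β (x - e) (x - e) := by fun_prop
  rw [Metric.isOpen_iff]
  rintro x₀ ⟨-, z, hz0, hz, hlim⟩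
  have hV : Tendsto (fun t => β (z t - e) (z t - e)) atTop (𝓝 0) := by
    simpa [Function.comp_def] using (hcont.tendsto e).comp hlim
  obtain ⟨T, hT⟩ := eventually_atTop.1 ((hV.eventually_lt_const (by positivity : (0:ℝ) < r / 2)).and
    (eventually_ge_atTop 0))
  have hT0 : 0 ≤ T := (hT T le_rfl).2
  obtain ⟨d, hd, hnear⟩ := Metric.isOpen_iff.1 (isOpen_lt hcont (continuous_const (y := r / 2)))
    (z T) (hT T le_rfl).1
  obtain ⟨R, hR⟩ := exists_norm_bound_of_curve hz T
  -- The cutoff must be invisible on the unit neighborhood of the reference trajectory up to time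
  -- `T`, and on the whole sublevel set below `r`, where the perturbed trajectory lives afterwards.
  set R' := max (R + 1) (‖e‖ + Real.sqrt (r / c) + 1)
  obtain ⟨G, K, C, hK, hC, hGF⟩ := exists_lipschitz_cutoff hF R'
  have hlocG : ∀ x, β (x - e) (x - e) < r → G x = F x := by
    intro x hx
    apply hGF
    have h1 : ‖x - e‖ ≤ Real.sqrt (r / c) := by
      apply Real.le_sqrt_of_sq_le
      rw [le_div_iff₀ hc, mul_comm]
      exact (hcoer _).trans hx.le
    have h2 := norm_add_le (x - e) e
    rw [sub_add_cancel] at h2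
    exact lt_of_lt_of_le (by linarith) (le_max_right _ _)
  -- Grönwall enlarges the initial distance by at most `exp (K * T)`. Staying within `1` keeps the
  -- curve where `G = F`; being within `d` at time `T` puts it in the trapping sublevel set.
  refine ⟨min d 1 * Real.exp (-(K * T)), by positivity, fun y hy => ⟨mem_univ _, ?_⟩⟩
  obtain ⟨w, hw0, hw⟩ := exists_curve_of_lipschitz hK hC y
  have hwc := continuousOn_of_curve hw
  have hzc := continuousOn_of_curve hz
  have hdist : ∀ t ∈ Icc 0 T, dist (w t) (z t) < min d 1 := by
    intro t ht
    have := dist_le_of_trajectories_ODE (v := fun _ => G) (a := 0) (b := T) (fun _ => hK)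
      (hwc.mono Icc_subset_Ici_self) (fun t ht => hasDerivWithinAt_Ici_of_curve hw ht.1)
      (hzc.mono Icc_subset_Ici_self) (fun t ht => by
        rw [hGF (z t) ((hR t ⟨ht.1, ht.2.le⟩).trans ((lt_add_one R).trans_le (le_max_left _ _)))]
        exact hasDerivWithinAt_Ici_of_curve hz ht.1) (δ := dist y x₀) (by rw [hw0, hz0]) t ht
    refine this.trans_lt ?_
    rw [Metric.mem_ball] at hy
    calc dist y x₀ * Real.exp (K * (t - 0)) ≤ dist y x₀ * Real.exp (K * T) := by
          have : (0:ℝ) ≤ K := K.2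
          gcongr; linarith [ht.2]
      _ < min d 1 * Real.exp (-(K * T)) * Real.exp (K * T) := by gcongr
      _ = min d 1 := by rw [mul_assoc, ← Real.exp_add]; simp
  have hVT : β (w T - e) (w T - e) ≤ r / 2 := (hnear (Metric.mem_ball.2
    ((hdist T ⟨hT0, le_rfl⟩).trans_le (min_le_left _ _)))).le
  have hdecay : ∀ t ≥ T, β (w t - e) (w t - e) ≤ r / 2 * Real.exp (-(κ / 2) * (t - T)) :=
    fun t ht => lyapunov_decay hsymm hκ (fun x hx => by rw [hlocG x hx]; exact hloc x hx)
      (hwc.mono fun s hs => hT0.trans hs.1)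
      (fun s hs => hasDerivWithinAt_Ici_of_curve hw (hT0.trans hs.1))
      (by positivity) (half_lt_self hr) hVT t ⟨ht, le_rfl⟩
  refine ⟨w, hw0, fun t ht => ?_, ?_⟩
  · have hGt : G (w t) = F (w t) := by
      rcases le_total t T with htT | htT
      · apply hGF
        have h1 := hdist t ⟨ht, htT⟩
        rw [dist_eq_norm] at h1
        have h2 := norm_add_le (w t - z t) (z t)
        rw [sub_add_cancel] at h2
        have h3 := hR t ⟨ht, htT⟩
        have h4 := h1.trans_le (min_le_right _ _)
        exact lt_of_lt_of_le (by linarith) (le_max_left _ _)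
      · apply hlocG
        have : Real.exp (-(κ / 2) * (t - T)) ≤ 1 := Real.exp_le_one_iff.2 (by nlinarith)
        nlinarith [hdecay t htT]
    beta_reduce
    rw [← hGt]
    exact hw t ht
  · have hexp : Tendsto (fun t => r / 2 / c * Real.exp (-(κ / 2) * (t - T))) atTop (𝓝 0) := by
      have : Tendsto (fun t : ℝ => (κ / 2) * (t - T)) atTop atTop :=
        (tendsto_atTop_add_const_right _ (-T) tendsto_id).const_mul_atTop (by positivity)
      simpa using (Real.tendsto_exp_neg_atTop_nhds_zero.comp this).const_mul (r / 2 / c)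
    have hsq : Tendsto (fun t => ‖w t - e‖ ^ 2) atTop (𝓝 0) := by
      refine tendsto_of_tendsto_of_tendsto_of_le_of_le' tendsto_const_nhds hexp
        (Eventually.of_forall fun t => by positivity) ?_
      filter_upwards [eventually_ge_atTop T] with t ht
      have := (hcoer (w t - e)).trans (hdecay t ht)
      rw [div_mul_eq_mul_div, le_div_iff₀ hc]
      linarith
    rw [tendsto_iff_norm_sub_tendsto_zero]
    simpa using hsq.sqrt

end ODE

end EnsembleLangevin

namespace EnsembleLangevin

/-! ### The affine-invariant coordinates -/

section Semiconjugacy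

variable {E E' : Type*} [NormedAddCommGroup E] [NormedSpace ℝ E] [NormedAddCommGroup E']
  [NormedSpace ℝ E']

/-- Continuous linear maps between normed spaces, with the topologies given by the norms. -/
abbrev NormedMap (E E' : Type*) [NormedAddCommGroup E] [NormedSpace ℝ E] [NormedAddCommGroup E']
    [NormedSpace ℝ E'] := E →L[ℝ] E'

/-- The chain rule for an affine semiconjugacy. It serves both the passage to affine-invariant
coordinates and the embedding of the rank-one system at a degenerate steady state. -/
lemma curve_map_affine {F : E → E} {G : E' → E'} (T : E →L[ℝ] E') {b : E'}
    (hT : ∀ y, T (F y) = G (b + T y)) {z : ℝ → E} {s : Set ℝ}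
    (hz : IsIntegralCurveOn z (fun _ => F) s) :
    IsIntegralCurveOn (fun t => b + T (z t)) (fun _ => G) s := by
  intro t ht
  have h := (T.hasFDerivAt.comp_hasDerivWithinAt t (hz t ht)).const_add b
  exact h.congr_deriv (hT _)

lemma fderiv_map_affine {F : E → E} {G : E' → E'} (T : E →L[ℝ] E') {b : E'}
    (hT : ∀ y, T (F y) = G (b + T y)) {x : E} (hF : DifferentiableAt ℝ F x)
    (hG : DifferentiableAt ℝ G (b + T x)) (h : E) :
    T (fderiv ℝ F x h) = fderiv ℝ G (b + T x) (T h) := by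
  have h1 : HasFDerivAt (fun y => T (F y)) (T.comp (fderiv ℝ F x)) x :=
    T.hasFDerivAt.comp x hF.hasFDerivAt
  have h2 : HasFDerivAt (fun y => b + T y) T x := T.hasFDerivAt.const_add b
  have h3 : HasFDerivAt (fun y => G (b + T y)) _ x := hG.hasFDerivAt.comp x h2
  rw [funext hT] at h1
  exact DFunLike.congr_fun (h1.unique h3) h

lemma IsComplexEigenvalueOn.map_affine {F : E → E} {G : E' → E'} (T : E →L[ℝ] E') {b : E'}
    (hT : ∀ y, T (F y) = G (b + T y)) {x : E} (hF : DifferentiableAt ℝ F x)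
    (hG : DifferentiableAt ℝ G (b + T x)) (hinj : Function.Injective T) {S : Submodule ℝ E}
    {S' : Submodule ℝ E'} (hS : ∀ u ∈ S, T u ∈ S') {z : ℂ}
    (hz : IsComplexEigenvalueOn (fderiv ℝ F x) S z) :
    IsComplexEigenvalueOn (fderiv ℝ G (b + T x)) S' z := by
  obtain ⟨u, hu, v, hv, hne, h1, h2⟩ := hz
  refine ⟨T u, hS u hu, T v, hS v hv, ?_, ?_, ?_⟩
  · simpa only [ne_eq, map_eq_zero_iff _ hinj] using hne
  · rw [← fderiv_map_affine T hT hF hG, h1, map_sub, map_smul, map_smul]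
  · rw [← fderiv_map_affine T hT hF hG, h2, map_add, map_smul, map_smul]

/-- The moment field is quadratic along every line, so its linearization can be read off as the
coefficient of `t`, without differentiating matrix products. -/
lemma fderiv_apply_of_quadratic {F : E → E} {x h D Q : E} (hF : DifferentiableAt ℝ F x)
    (hq : ∀ t : ℝ, F (x + t • h) = F x + t • D + t ^ 2 • Q) : fderiv ℝ F x h = D := by
  have h1 : HasDerivAt (fun t : ℝ => F (x + t • h)) (fderiv ℝ F x h) 0 := by
    have hl : HasDerivAt (fun t : ℝ => x + t • h) h 0 := by
      simpa using ((hasDerivAt_id (0 : ℝ)).smul_const h).const_add x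
    have hF' : HasFDerivAt F (fderiv ℝ F x) (x + (0 : ℝ) • h) := by simpa using hF.hasFDerivAt
    exact hF'.comp_hasDerivAt 0 hl
  have h2 : HasDerivAt (fun t : ℝ => F (x + t • h)) D 0 := by
    simp_rw [hq]
    have := (((hasDerivAt_id (0 : ℝ)).smul_const D).const_add (F x)).add
      (((hasDerivAt_id (0 : ℝ)).pow 2).smul_const Q)
    refine this.congr_deriv ?_
    simp
  exact h1.unique h2

end Semiconjugacy

section Coordinates

attribute [local simp] MomentState.mq MomentState.mp MomentState.Cq MomentState.Cp MomentState.Cqp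

variable {M N : ℕ}

namespace LinearInverseProblem

lemma posDef_B {J : ℕ} (P : LinearInverseProblem N J) : P.B.PosDef := by
  have h1 : (P.Aᵀ * P.Γ⁻¹ * P.A).PosSemidef := by
    simpa using P.posDef_Γ.inv.posSemidef.conjTranspose_mul_mul_same P.A
  exact (P.posDef_Γ₀.inv.posSemidef_add h1).inv

end LinearInverseProblem

section Sqrt

variable {B : Matrix (Fin N) (Fin N) ℝ}

lemma sqrt_mul_self (hB : B.PosDef) : CFC.sqrt B * CFC.sqrt B = B :=
  CFC.sqrt_mul_sqrt_self B hB.posSemidef.nonneg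

lemma posSemidef_sqrt (B : Matrix (Fin N) (Fin N) ℝ) : (CFC.sqrt B).PosSemidef :=
  Matrix.nonneg_iff_posSemidef.1 (CFC.sqrt_nonneg B)

lemma isSymm_sqrt (B : Matrix (Fin N) (Fin N) ℝ) : (CFC.sqrt B)ᵀ = CFC.sqrt B := by
  simpa using (posSemidef_sqrt B).isHermitian.eq

lemma isUnit_sqrt (hB : B.PosDef) : IsUnit (CFC.sqrt B) := by
  have := hB.isUnit
  rw [← sqrt_mul_self hB] at this
  exact isUnit_of_mul_isUnit_left this

lemma sqrt_mul_inv (hB : B.PosDef) : CFC.sqrt B * (CFC.sqrt B)⁻¹ = 1 :=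
  Matrix.mul_nonsing_inv _ ((Matrix.isUnit_iff_isUnit_det _).1 (isUnit_sqrt hB))

lemma inv_mul_sqrt (hB : B.PosDef) : (CFC.sqrt B)⁻¹ * CFC.sqrt B = 1 :=
  Matrix.nonsing_inv_mul _ ((Matrix.isUnit_iff_isUnit_det _).1 (isUnit_sqrt hB))

lemma isSymm_sqrt_inv (B : Matrix (Fin N) (Fin N) ℝ) : ((CFC.sqrt B)⁻¹)ᵀ = (CFC.sqrt B)⁻¹ := by
  rw [Matrix.transpose_nonsing_inv, isSymm_sqrt]

lemma inv_eq_sqrt_inv (hB : B.PosDef) : B⁻¹ = (CFC.sqrt B)⁻¹ * (CFC.sqrt B)⁻¹ := by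
  conv_lhs => rw [← sqrt_mul_self hB, Matrix.mul_inv_rev]

end Sqrt

/-- The action of a linear map on the blocks of means and covariances. -/
noncomputable def transport (R : Matrix (Fin M) (Fin N) ℝ) : NormedMap (MomentState N) (MomentState M) :=
  LinearMap.toContinuousLinearMap
    { toFun := fun x => (R *ᵥ x.mq, R *ᵥ x.mp, R * x.Cq * Rᵀ, R * x.Cp * Rᵀ, R * x.Cqp * Rᵀ)
      map_add' := fun x y => by
        simp [Matrix.mulVec_add, Matrix.mul_add, Matrix.add_mul]
      map_smul' := fun a x => by
        simp [Matrix.mulVec_smul] }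

lemma transport_apply (R : Matrix (Fin M) (Fin N) ℝ) (x : MomentState N) :
    transport R x = (R *ᵥ x.mq, R *ᵥ x.mp, R * x.Cq * Rᵀ, R * x.Cp * Rᵀ, R * x.Cqp * Rᵀ) := rfl

lemma transport_mul {K : ℕ} (R : Matrix (Fin M) (Fin N) ℝ) (Q : Matrix (Fin N) (Fin K) ℝ)
    (x : MomentState K) : transport R (transport Q x) = transport (R * Q) x := by
  simp [transport_apply, Matrix.mul_assoc, Matrix.transpose_mul]

lemma transport_one (x : MomentState N) : transport (1 : Matrix (Fin N) (Fin N) ℝ) x = x := by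
  simp [transport_apply]

lemma transport_mem_symmetricStates (R : Matrix (Fin M) (Fin N) ℝ) {x : MomentState N}
    (hx : x ∈ symmetricStates N) : transport R x ∈ symmetricStates M := by
  obtain ⟨h1, h2⟩ := hx
  rw [MomentState.Cq, Matrix.IsSymm] at h1
  rw [MomentState.Cp, Matrix.IsSymm] at h2
  exact ⟨by simp [Matrix.IsSymm, transport_apply, Matrix.mul_assoc, h1],
    by simp [Matrix.IsSymm, transport_apply, Matrix.mul_assoc, h2]⟩

variable {B : Matrix (Fin N) (Fin N) ℝ} {c : Fin N → ℝ} {γ : ℝ}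

lemma transport_sqrt_inv (hB : B.PosDef) (x : MomentState N) :
    transport (CFC.sqrt B) (transport (CFC.sqrt B)⁻¹ x) = x := by
  rw [transport_mul, sqrt_mul_inv hB, transport_one]

lemma transport_inv_sqrt (hB : B.PosDef) (x : MomentState N) :
    transport (CFC.sqrt B)⁻¹ (transport (CFC.sqrt B) x) = x := by
  rw [transport_mul, inv_mul_sqrt hB, transport_one]

/-- Since `B^{1/2} B⁻¹ = B^{-1/2}` and `B^{-1/2} B = B^{1/2}`, the first coordinate is `B^{-1/2}
(m_q - B c)`. Hence the coordinates are a translation followed by the action of one matrix on all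
blocks, and everything about affine maps applies. -/
lemma normalizedCoords_eq (hB : B.PosDef) (x : MomentState N) :
    normalizedCoords B c x = transport (CFC.sqrt B)⁻¹ (x - (B *ᵥ c, 0, 0, 0, 0)) := by
  have h1 : CFC.sqrt B * B⁻¹ = (CFC.sqrt B)⁻¹ := by
    rw [inv_eq_sqrt_inv hB, ← Matrix.mul_assoc, sqrt_mul_inv hB, Matrix.one_mul]
  have h2 : (CFC.sqrt B)⁻¹ * B = CFC.sqrt B := by
    nth_rw 2 [← sqrt_mul_self hB]
    rw [← Matrix.mul_assoc, inv_mul_sqrt hB, Matrix.one_mul]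
  simp [normalizedCoords, transport_apply, isSymm_sqrt_inv, Matrix.mulVec_sub,
    Matrix.mulVec_mulVec, h1, h2]

lemma normalizedCoords_eq' (hB : B.PosDef) (x : MomentState N) :
    normalizedCoords B c x =
      -transport (CFC.sqrt B)⁻¹ (B *ᵥ c, 0, 0, 0, 0) + transport (CFC.sqrt B)⁻¹ x := by
  rw [normalizedCoords_eq hB, map_sub]
  abel

/-- The inverse of the affine-invariant coordinates. -/
lemma eq_transport_normalizedCoords (hB : B.PosDef) (x : MomentState N) :
    x = (B *ᵥ c, 0, 0, 0, 0) + transport (CFC.sqrt B) (normalizedCoords B c x) := by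
  rw [normalizedCoords_eq hB, transport_sqrt_inv hB, add_sub_cancel]

lemma normalizedCoords_add (hB : B.PosDef) (x h : MomentState N) :
    normalizedCoords B c (x + h) = normalizedCoords B c x + transport (CFC.sqrt B)⁻¹ h := by
  rw [normalizedCoords_eq hB, normalizedCoords_eq hB, ← map_add]
  congr 1; abel

lemma normalizedCoords_equilibrium (hB : B.PosDef) :
    normalizedCoords B c (equilibrium B c) = (0, 0, 1, 1, 0) := by
  have h : (CFC.sqrt B)⁻¹ * B * (CFC.sqrt B)⁻¹ = 1 := by
    nth_rw 2 [← sqrt_mul_self hB]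
    rw [← Matrix.mul_assoc, inv_mul_sqrt hB, Matrix.one_mul, sqrt_mul_inv hB]
  simp [normalizedCoords_eq hB, equilibrium, transport_apply, isSymm_sqrt_inv, h]

lemma normalizedCoords_mem_symmetricStates (hB : B.PosDef) {x : MomentState N}
    (hx : x ∈ symmetricStates N) : normalizedCoords B c x ∈ symmetricStates N := by
  rw [normalizedCoords_eq hB]
  refine transport_mem_symmetricStates _ (Submodule.sub_mem _ hx ?_)
  exact ⟨Matrix.isSymm_zero, Matrix.isSymm_zero⟩

lemma continuous_normalizedCoords (hB : B.PosDef) : Continuous (normalizedCoords B c) := by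
  rw [funext (normalizedCoords_eq (c := c) hB)]
  fun_prop

/-- In the affine-invariant coordinates, the vector field does not depend on `B` and `c`. -/
lemma transport_momentField (hB : B.PosDef) (x : MomentState N) :
    transport (CFC.sqrt B)⁻¹ (momentField γ B c x) = momentField γ 1 0 (normalizedCoords B c x) := by
  set S := CFC.sqrt B with hS
  have h1 : S⁻¹ * S = 1 := inv_mul_sqrt hB
  have hi : B⁻¹ = S⁻¹ * S⁻¹ := inv_eq_sqrt_inv hB
  have ht : (S⁻¹)ᵀ = S⁻¹ := isSymm_sqrt_inv B
  have hq : ∀ v, S⁻¹ *ᵥ (S *ᵥ v) = v := fun v => by rw [Matrix.mulVec_mulVec, h1, Matrix.one_mulVec]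
  refine Prod.ext ?_ (Prod.ext ?_ (Prod.ext ?_ (Prod.ext ?_ ?_)))
  · rfl
  · simp [transport_apply, momentField, normalizedCoords, ← hS, Matrix.mulVec_sub,
      Matrix.mulVec_smul, ← Matrix.mulVec_mulVec, hq]
  · simp [transport_apply, momentField, normalizedCoords, ← hS, Matrix.mul_add, Matrix.add_mul,
      Matrix.transpose_mul, ht, Matrix.mul_assoc]
  · simp [transport_apply, momentField, normalizedCoords, ← hS, hi, Matrix.mul_add, Matrix.add_mul,
      Matrix.mul_sub, Matrix.sub_mul, Matrix.transpose_mul, ht, Matrix.mul_assoc]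
  · simp [transport_apply, momentField, normalizedCoords, ← hS, hi, Matrix.mul_add, Matrix.add_mul,
      Matrix.mul_sub, Matrix.sub_mul, Matrix.transpose_mul, ht, Matrix.mul_assoc]

lemma momentField_eq_transport (hB : B.PosDef) (x : MomentState N) :
    momentField γ B c x = transport (CFC.sqrt B) (momentField γ 1 0 (normalizedCoords B c x)) := by
  rw [← transport_momentField hB, transport_sqrt_inv hB]

lemma momentField_eq_zero_iff (hB : B.PosDef) (x : MomentState N) :
    momentField γ B c x = 0 ↔ momentField γ 1 0 (normalizedCoords B c x) = 0 := by
  constructor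
  · intro h
    rw [← transport_momentField hB, h, map_zero]
  · intro h
    rw [momentField_eq_transport hB, h, map_zero]

/-- The affine-invariant coordinates map solutions to solutions of the normalized system. -/
lemma curve_normalizedCoords (hB : B.PosDef) {z : ℝ → MomentState N} {s : Set ℝ}
    (hz : IsIntegralCurveOn z (fun _ => momentField γ B c) s) :
    IsIntegralCurveOn (fun t => normalizedCoords B c (z t)) (fun _ => momentField γ 1 0) s := by
  rw [funext fun t => normalizedCoords_eq' (c := c) hB (z t)]
  exact curve_map_affine _ (fun y => by rw [transport_momentField hB, normalizedCoords_eq' hB]) hz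

lemma curve_of_normalized (hB : B.PosDef) {w : ℝ → MomentState N} {s : Set ℝ}
    (hw : IsIntegralCurveOn w (fun _ => momentField γ 1 0) s) :
    IsIntegralCurveOn (fun t => (B *ᵥ c, 0, 0, 0, 0) + transport (CFC.sqrt B) (w t))
      (fun _ => momentField γ B c) s :=
  curve_map_affine _ (fun y => by
    rw [momentField_eq_transport hB, normalizedCoords_eq hB, add_sub_cancel_left,
      transport_inv_sqrt hB]) hw

/-! ### Regularity of the vector field -/

lemma contDiff_matrix_mul {E : Type*} [NormedAddCommGroup E] [NormedSpace ℝ E]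
    {f g : E → Matrix (Fin N) (Fin N) ℝ} (hf : ContDiff ℝ 1 f) (hg : ContDiff ℝ 1 g) :
    ContDiff ℝ 1 (fun x => f x * g x) := by
  refine contDiff_pi.2 fun i => contDiff_pi.2 fun j => ?_
  simp only [Matrix.mul_apply]
  have hf' : ∀ i j, ContDiff ℝ 1 (fun x => f x i j) := fun i j =>
    contDiff_pi.1 (contDiff_pi.1 hf i) j
  have hg' : ∀ i j, ContDiff ℝ 1 (fun x => g x i j) := fun i j =>
    contDiff_pi.1 (contDiff_pi.1 hg i) j
  fun_prop

lemma contDiff_matrix_mulVec {E : Type*} [NormedAddCommGroup E] [NormedSpace ℝ E]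
    {f : E → Matrix (Fin N) (Fin N) ℝ} {g : E → Fin N → ℝ} (hf : ContDiff ℝ 1 f)
    (hg : ContDiff ℝ 1 g) : ContDiff ℝ 1 (fun x => f x *ᵥ g x) := by
  refine contDiff_pi.2 fun i => ?_
  simp only [Matrix.mulVec, dotProduct]
  have hf' : ∀ i j, ContDiff ℝ 1 (fun x => f x i j) := fun i j =>
    contDiff_pi.1 (contDiff_pi.1 hf i) j
  have hg' : ∀ i, ContDiff ℝ 1 (fun x => g x i) := fun i => contDiff_pi.1 hg i
  fun_prop

lemma contDiff_matrix_transpose {E : Type*} [NormedAddCommGroup E] [NormedSpace ℝ E]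
    {f : E → Matrix (Fin N) (Fin N) ℝ} (hf : ContDiff ℝ 1 f) : ContDiff ℝ 1 (fun x => (f x)ᵀ) :=
  contDiff_pi.2 fun i => contDiff_pi.2 fun j => contDiff_pi.1 (contDiff_pi.1 hf j) i

lemma contDiff_momentField (γ : ℝ) (B : Matrix (Fin N) (Fin N) ℝ) (c : Fin N → ℝ) :
    ContDiff ℝ 1 (momentField γ B c) := by
  have hq : ContDiff ℝ 1 (fun x : MomentState N => x.mq) := contDiff_fst
  have hp : ContDiff ℝ 1 (fun x : MomentState N => x.mp) := contDiff_fst.comp contDiff_snd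
  have hC : ContDiff ℝ 1 (fun x : MomentState N => x.Cq) :=
    contDiff_fst.comp (contDiff_snd.comp contDiff_snd)
  have hD : ContDiff ℝ 1 (fun x : MomentState N => x.Cp) :=
    contDiff_fst.comp (contDiff_snd.comp (contDiff_snd.comp contDiff_snd))
  have hZ : ContDiff ℝ 1 (fun x : MomentState N => x.Cqp) :=
    contDiff_snd.comp (contDiff_snd.comp (contDiff_snd.comp contDiff_snd))
  have hBc := contDiff_const (𝕜 := ℝ) (E := MomentState N) (n := 1) (c := B⁻¹)
  have hprod := contDiff_matrix_mul (contDiff_matrix_mul hC hBc) hZ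
  refine hp.prodMk (ContDiff.prodMk ?_ (ContDiff.prodMk ?_ (ContDiff.prodMk ?_ ?_)))
  · exact ((contDiff_matrix_mulVec hC ((contDiff_matrix_mulVec hBc hq).sub contDiff_const)).neg).sub
      (hp.const_smul γ)
  · exact hZ.add (contDiff_matrix_transpose hZ)
  · exact ((hprod.neg.sub (contDiff_matrix_transpose hprod)).sub (hD.const_smul _)).add
      (hC.const_smul _)
  · exact ((hZ.const_smul γ).neg.sub (contDiff_matrix_mul (contDiff_matrix_mul hC hBc) hC)).add hD

lemma differentiable_momentField (γ : ℝ) (B : Matrix (Fin N) (Fin N) ℝ) (c : Fin N → ℝ) :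
    Differentiable ℝ (momentField γ B c) :=
  (contDiff_momentField γ B c).differentiable one_ne_zero

/-- Eigenvalues of the linearization are unchanged under the passage to affine-invariant
coordinates. -/
lemma isComplexEigenvalueOn_normalized (hB : B.PosDef) {F G : MomentState N → MomentState N}
    (hF : F = momentField γ B c) (hG : G = momentField γ 1 0) {x x' : MomentState N}
    (hx : x' = normalizedCoords B c x) {z : ℂ}
    (hz : IsComplexEigenvalueOn (fderiv ℝ F x) (symmetricStates N) z) :
    IsComplexEigenvalueOn (fderiv ℝ G x') (symmetricStates N) z := by
  subst hF hG hx
  have h := IsComplexEigenvalueOn.map_affine (transport (CFC.sqrt B)⁻¹) (G := momentField γ 1 0)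
    (b := -transport (CFC.sqrt B)⁻¹ (B *ᵥ c, 0, 0, 0, 0))
    (fun y => by rw [transport_momentField hB, normalizedCoords_eq' hB])
    (differentiable_momentField γ B c x) (differentiable_momentField γ 1 0 _)
    (fun x y h => by rw [← transport_sqrt_inv hB x, h, transport_sqrt_inv hB])
    (fun u hu => transport_mem_symmetricStates _ hu) hz
  rw [normalizedCoords_eq' hB]
  exact h

/-! ### Steady states -/

/-- The steady states of the normalized system. -/
lemma normalized_steady_iff (hγ : 0 < γ) {x : MomentState N} (hx : x ∈ symmetricStates N) :
    momentField γ 1 0 x = 0 ↔ x.Cq * x.Cq = x.Cq ∧ x.Cq *ᵥ x.mq = 0 ∧ x.mp = 0 ∧ x.Cp = x.Cq ∧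
      x.Cqp = 0 := by
  obtain ⟨m, p, X, Y, Z⟩ := x
  obtain ⟨hX, hY⟩ : X.IsSymm ∧ Y.IsSymm := hx
  simp only [momentField, MomentState.mq, MomentState.mp, MomentState.Cq, MomentState.Cp,
    MomentState.Cqp, Prod.ext_iff, Prod.fst_zero, Prod.snd_zero, inv_one, Matrix.mul_one,
    Matrix.one_mulVec, sub_zero]
  constructor
  · rintro ⟨rfl, h2, h3, h4, h5⟩
    -- Stationarity of `C_q` makes `Z` skew, that of `C_{q,p}` makes it symmetric; so `Z = 0`. The
    -- equation for `C_p` then gives `Y = X`, and the one for `C_{q,p}` gives `X * X = X`.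
    have hZ1 : Zᵀ = -Z := (neg_eq_of_add_eq_zero_right h3).symm
    have hZ2 : γ • Z = Y - X * X := by
      rw [sub_add_eq_add_sub, sub_eq_zero] at h5
      rw [← h5]; abel
    have hZ3 : γ • Z = -(γ • Z) := by
      have h : (γ • Z)ᵀ = γ • Z := by
        rw [hZ2, Matrix.transpose_sub, Matrix.transpose_mul, hX.eq, hY.eq]
      rw [← smul_neg, ← hZ1, ← Matrix.transpose_smul, h]
    have hZ : Z = 0 := by
      have : (2 * γ) • Z = 0 := by
        rw [two_mul, add_smul]
        nth_rw 1 [hZ3]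
        simp
      exact (smul_eq_zero.1 this).resolve_left (by positivity)
    subst hZ
    have hYX : Y = X := by
      have : (2 * γ) • (X - Y) = 0 := by
        rw [smul_sub, ← h4]; simp; abel
      exact (sub_eq_zero.1 ((smul_eq_zero.1 this).resolve_left (by positivity))).symm
    subst hYX
    refine ⟨?_, by simpa using h2, rfl, rfl, rfl⟩
    exact (sub_eq_zero.1 (by rw [← hZ2]; simp)).symm
  · rintro ⟨h1, h2, rfl, rfl, rfl⟩
    simp [h1, h2]

lemma sqrt_mul_conj (hB : B.PosDef) (X : Matrix (Fin N) (Fin N) ℝ) :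
    CFC.sqrt B * ((CFC.sqrt B)⁻¹ * X * (CFC.sqrt B)⁻¹) * CFC.sqrt B = X := by
  rw [Matrix.mul_assoc, Matrix.mul_assoc, inv_mul_sqrt hB, Matrix.mul_one, ← Matrix.mul_assoc,
    sqrt_mul_inv hB, Matrix.one_mul]

lemma conj_mul_sqrt (hB : B.PosDef) (X : Matrix (Fin N) (Fin N) ℝ) :
    (CFC.sqrt B)⁻¹ * (CFC.sqrt B * X * CFC.sqrt B) * (CFC.sqrt B)⁻¹ = X := by
  rw [Matrix.mul_assoc, Matrix.mul_assoc, sqrt_mul_inv hB, Matrix.mul_one, ← Matrix.mul_assoc,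
    inv_mul_sqrt hB, Matrix.one_mul]

/-- The steady states in terms of an orthogonal projection. -/
lemma steady_iff (hγ : 0 < γ) (hB : B.PosDef) {x : MomentState N} (hx : x ∈ symmetricStates N) :
    momentField γ B c x = 0 ↔ ∃ (X : Matrix (Fin N) (Fin N) ℝ) (m : Fin N → ℝ),
      X * X = X ∧ X.IsSymm ∧ x.Cq *ᵥ m = 0 ∧
        x = (B *ᵥ (c + m), 0, CFC.sqrt B * X * CFC.sqrt B, CFC.sqrt B * X * CFC.sqrt B, 0) := by
  rw [momentField_eq_zero_iff hB,
    normalized_steady_iff hγ (normalizedCoords_mem_symmetricStates hB hx)]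
  set S := CFC.sqrt B with hS
  have hinj : Function.Injective (fun v => S *ᵥ v) := fun u v h => by
    have := congrArg (fun w => S⁻¹ *ᵥ w) h
    simpa [Matrix.mulVec_mulVec, hS, inv_mul_sqrt hB] using this
  have hinj' : Function.Injective (fun v => S⁻¹ *ᵥ v) := fun u v h => by
    have := congrArg (fun w => S *ᵥ w) h
    simpa [Matrix.mulVec_mulVec, hS, sqrt_mul_inv hB] using this
  have hBi : B * B⁻¹ = 1 := Matrix.mul_nonsing_inv _ ((Matrix.isUnit_iff_isUnit_det _).1 hB.isUnit)
  have hBi' : B⁻¹ * B = 1 := Matrix.nonsing_inv_mul _ ((Matrix.isUnit_iff_isUnit_det _).1 hB.isUnit)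
  constructor
  · rintro ⟨h1, h2, h3, h4, h5⟩
    simp only [normalizedCoords, ← hS, MomentState.Cq, MomentState.Cp, MomentState.Cqp,
      MomentState.mq, MomentState.mp] at h1 h2 h3 h4 h5
    -- The projection is the normalized `C_q`, and `m` is the residual `B⁻¹ m_q - c`, whose image
    -- under `C_q` is the stationary force.
    refine ⟨S⁻¹ * x.Cq * S⁻¹, B⁻¹ *ᵥ x.mq - c, h1, ?_, ?_, ?_⟩
    · simp [Matrix.IsSymm, Matrix.transpose_mul, hS, isSymm_sqrt_inv, hx.1.eq, Matrix.mul_assoc]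
    · rw [Matrix.mulVec_mulVec, Matrix.mul_assoc, Matrix.mul_assoc, hS, inv_mul_sqrt hB,
        Matrix.mul_one, ← Matrix.mulVec_mulVec] at h2
      exact hinj' (by simpa using h2)
    · rw [hS, sqrt_mul_conj hB]
      refine Prod.ext ?_ (Prod.ext ?_ (Prod.ext ?_ (Prod.ext ?_ ?_)))
      · simp [Matrix.mulVec_mulVec, hBi]
      · exact hinj' (by simpa using h3)
      · rfl
      · have := congrArg (fun M => S * M * S) h4
        simpa only [hS, sqrt_mul_conj hB] using this
      · have := congrArg (fun M => S * M * S) h5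
        simpa only [hS, sqrt_mul_conj hB, Matrix.mul_zero, Matrix.zero_mul] using this
  · rintro ⟨X, m, h1, -, h3, rfl⟩
    simp only [normalizedCoords, ← hS, MomentState.Cq, MomentState.Cp, MomentState.Cqp,
      MomentState.mq, MomentState.mp] at h3 ⊢
    refine ⟨?_, ?_, by simp, trivial, by simp⟩
    · rw [hS, conj_mul_sqrt hB, h1]
    · rw [hS, conj_mul_sqrt hB, Matrix.mulVec_mulVec _ B⁻¹, hBi', Matrix.one_mulVec,
        add_sub_cancel_left]
      apply hinj
      simpa [Matrix.mulVec_mulVec, Matrix.mul_assoc] using h3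

/-- The lower left block has the form `0ᵀ` because this is what `MomentState.cov` unfolds to when
`C_{q,p} = 0`. -/
lemma posDef_block_diag {M : Matrix (Fin N) (Fin N) ℝ} (hM : M.PosDef) :
    (Matrix.fromBlocks M 0 (0 : Matrix (Fin N) (Fin N) ℝ)ᵀ M).PosDef := by
  refine Matrix.PosDef.of_dotProduct_mulVec_pos ?_ fun v hv => ?_
  · have := hM.isHermitian.eq
    simp only [Matrix.conjTranspose_eq_transpose_of_trivial] at this
    simp [Matrix.IsHermitian, Matrix.fromBlocks_transpose, this]
  · have key : star v ⬝ᵥ (Matrix.fromBlocks M 0 (0 : Matrix (Fin N) (Fin N) ℝ)ᵀ M *ᵥ v) =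
        (v ∘ Sum.inl) ⬝ᵥ (M *ᵥ (v ∘ Sum.inl)) + (v ∘ Sum.inr) ⬝ᵥ (M *ᵥ (v ∘ Sum.inr)) := by
      simp [Matrix.fromBlocks_mulVec, dotProduct]
    rw [key]
    have h1 := fun u => hM.posSemidef.dotProduct_mulVec_nonneg u
    simp only [star_trivial] at h1
    by_cases hl : v ∘ Sum.inl = 0
    · have hr : v ∘ Sum.inr ≠ 0 := fun hr => hv (by
        funext i
        rcases i with i | i
        · exact congrFun hl i
        · exact congrFun hr i)
      have := hM.dotProduct_mulVec_pos hr
      simp only [star_trivial] at this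
      linarith [h1 (v ∘ Sum.inl)]
    · have := hM.dotProduct_mulVec_pos hl
      simp only [star_trivial] at this
      linarith [h1 (v ∘ Sum.inr)]

lemma posSemidef_block_diag {M : Matrix (Fin N) (Fin N) ℝ} (hM : M.PosSemidef) :
    (Matrix.fromBlocks M 0 (0 : Matrix (Fin N) (Fin N) ℝ)ᵀ M).PosSemidef := by
  refine Matrix.PosSemidef.of_dotProduct_mulVec_nonneg ?_ fun v => ?_
  · have := hM.isHermitian.eq
    simp only [Matrix.conjTranspose_eq_transpose_of_trivial] at this
    simp [Matrix.IsHermitian, Matrix.fromBlocks_transpose, this]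
  · have key : star v ⬝ᵥ (Matrix.fromBlocks M 0 (0 : Matrix (Fin N) (Fin N) ℝ)ᵀ M *ᵥ v) =
        (v ∘ Sum.inl) ⬝ᵥ (M *ᵥ (v ∘ Sum.inl)) + (v ∘ Sum.inr) ⬝ᵥ (M *ᵥ (v ∘ Sum.inr)) := by
      simp [Matrix.fromBlocks_mulVec, dotProduct]
    rw [key]
    have h1 := fun u => hM.dotProduct_mulVec_nonneg u
    simp only [star_trivial] at h1
    exact add_nonneg (h1 _) (h1 _)

lemma symmetric_of_covarianceStates {x : MomentState N} (hx : x ∈ covarianceStates N) :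
    x ∈ symmetricStates N := by
  have h := (Matrix.PosSemidef.isHermitian hx).eq
  simp only [MomentState.cov, Matrix.fromBlocks_conjTranspose, Matrix.fromBlocks_inj] at h
  exact ⟨by simpa [Matrix.IsSymm] using h.1, by simpa [Matrix.IsSymm] using h.2.2.2⟩

lemma symmetric_of_nondegenerateStates {x : MomentState N} (hx : x ∈ nondegenerateStates N) :
    x ∈ symmetricStates N :=
  symmetric_of_covarianceStates (Matrix.PosDef.posSemidef hx)

lemma equilibrium_mem_nondegenerateStates (hB : B.PosDef) :
    equilibrium B c ∈ nondegenerateStates N :=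
  posDef_block_diag hB

lemma posDef_Cq_of_nondegenerate {x : MomentState N} (hx : x ∈ nondegenerateStates N) :
    x.Cq.PosDef := by
  have : x.Cq = x.cov.submatrix Sum.inl Sum.inl := by ext; rfl
  rw [this]
  exact Matrix.PosDef.submatrix hx Sum.inl_injective

lemma equilibrium_eq (hB : B.PosDef) :
    equilibrium B c = (B *ᵥ (c + 0), 0, CFC.sqrt B * 1 * CFC.sqrt B, CFC.sqrt B * 1 * CFC.sqrt B, 0)
      := by
  simp [equilibrium, sqrt_mul_self hB]

/-- Positive definiteness of the covariance makes `C_q`, hence `X`, invertible. An invertible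
idempotent is the identity, and an invertible `C_q` annihilates only `m = 0`. -/
lemma steady_nondegenerate_iff (hγ : 0 < γ) (hB : B.PosDef) {x : MomentState N}
    (hx : x ∈ nondegenerateStates N) : momentField γ B c x = 0 ↔ x = equilibrium B c := by
  rw [steady_iff hγ hB (symmetric_of_nondegenerateStates hx)]
  constructor
  · rintro ⟨X, m, hX, -, hm, rfl⟩
    have hunit := (posDef_Cq_of_nondegenerate hx).isUnit
    have hXu : IsUnit X := by
      rw [← conj_mul_sqrt hB X]
      have hi : IsUnit (CFC.sqrt B)⁻¹ := by
        rw [Matrix.isUnit_nonsing_inv_iff]; exact isUnit_sqrt hB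
      exact (hi.mul hunit).mul hi
    have hX1 : X = 1 := hXu.mul_left_cancel (by rw [hX, Matrix.mul_one])
    have hm0 : m = 0 := by
      have := Matrix.mulVec_injective_iff_isUnit.2 hunit
      exact this (by simpa using hm)
    rw [hX1, hm0, equilibrium_eq hB]
  · rintro rfl
    refine ⟨1, 0, by simp, Matrix.isSymm_one, by simp, equilibrium_eq hB⟩

/-- If `X = 1`, then `C_q = B` is invertible, so `m = 0` and the state is the excluded equilibrium.
Thus excluding the equilibrium forces `X ≠ 1`. -/
lemma steady_degenerate_iff (hγ : 0 < γ) (hB : B.PosDef) {x : MomentState N}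
    (hx : x ∈ symmetricStates N) (hne : x ≠ equilibrium B c) :
    momentField γ B c x = 0 ↔ ∃ (X : Matrix (Fin N) (Fin N) ℝ) (m : Fin N → ℝ),
      X * X = X ∧ X.IsSymm ∧ X ≠ 1 ∧ x.Cq *ᵥ m = 0 ∧
        x = (B *ᵥ (c + m), 0, CFC.sqrt B * X * CFC.sqrt B, CFC.sqrt B * X * CFC.sqrt B, 0) := by
  rw [steady_iff hγ hB hx]
  constructor
  · rintro ⟨X, m, hX, hXs, hm, hxeq⟩
    refine ⟨X, m, hX, hXs, ?_, hm, hxeq⟩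
    rintro rfl
    apply hne
    have hCq : x.Cq = B := by rw [hxeq]; simp [sqrt_mul_self hB]
    rw [hCq] at hm
    have hm0 : m = 0 := Matrix.mulVec_injective_iff_isUnit.2 hB.isUnit (by simpa using hm)
    rw [hxeq, hm0, equilibrium_eq hB]
  · rintro ⟨X, m, hX, hXs, -, hm, hxeq⟩
    exact ⟨X, m, hX, hXs, hm, hxeq⟩

end Coordinates

end EnsembleLangevin

namespace EnsembleLangevin

/-! ### Restriction to invariant subspaces -/

section InvariantSubspace

variable {E : Type*} [NormedAddCommGroup E] [NormedSpace ℝ E] {F : E → E}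
  {S : Submodule ℝ E} {P : E →L[ℝ] S}

/-- The linearization of the restriction to an invariant subspace. -/
lemma hasFDerivAt_restrict (hF : ContDiff ℝ 1 F) (e : S) :
    HasFDerivAt (fun x : S => P (F x)) (P.comp ((fderiv ℝ F e).comp S.subtypeL)) e :=
  P.hasFDerivAt.comp e
    ((hF.differentiable one_ne_zero (e : E)).hasFDerivAt.comp e S.subtypeL.hasFDerivAt)

/-- The decay of the Lyapunov form is available only on symmetric states, so the ODE theory has to
be applied to the restricted field `P ∘ F` on `S`. On `S` the projection changes nothing, so by
uniqueness of derivatives the two linearizations agree along `S`. -/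
lemma fderiv_mem_of_invariant (hF : ContDiff ℝ 1 F) (hS : ∀ x ∈ S, F x ∈ S)
    (hP : ∀ x : S, P x = x) {e h : E} (he : e ∈ S) (hh : h ∈ S) :
    (P (fderiv ℝ F e h) : E) = fderiv ℝ F e h := by
  have h1 : HasFDerivAt (fun x : S => F x) ((fderiv ℝ F e).comp S.subtypeL) ⟨e, he⟩ :=
    (hF.differentiable one_ne_zero e).hasFDerivAt.comp (⟨e, he⟩ : S) S.subtypeL.hasFDerivAt
  have h2 : HasFDerivAt (fun x : S => ((P (F x) : S) : E))
      (S.subtypeL.comp (P.comp ((fderiv ℝ F e).comp S.subtypeL))) ⟨e, he⟩ :=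
    S.subtypeL.hasFDerivAt.comp (⟨e, he⟩ : S) (hasFDerivAt_restrict hF ⟨e, he⟩)
  have h3 : (fun x : S => ((P (F x) : S) : E)) = fun x : S => F x :=
    funext fun x => congrArg Subtype.val (hP ⟨F x, hS x x.2⟩)
  rw [h3] at h2
  exact DFunLike.congr_fun (h2.unique h1) ⟨h, hh⟩

variable [FiniteDimensional ℝ E]

/-- Solutions started in an invariant subspace stay there. -/
lemma curve_mem_of_invariant (hF : ContDiff ℝ 1 F) (hS : ∀ x ∈ S, F x ∈ S)
    (hP : ∀ x : S, P x = x) {z : ℝ → E} (hz : IsIntegralCurveOn z (fun _ => F) (Ici 0))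
    (h0 : z 0 ∈ S) : ∀ t ≥ 0, z t ∈ S := by
  intro T hT
  -- `Q` measures the distance from `S`. Since `z - Q z` lies in `S`, where `Q ∘ F` vanishes, a
  -- Lipschitz bound gives `‖(Q z)'‖ ≤ K ‖Q z‖`, and Grönwall keeps `Q z` at zero.
  let Q : E →L[ℝ] E := ContinuousLinearMap.id ℝ E - S.subtypeL.comp P
  have hQ : ∀ x ∈ S, Q x = 0 := fun x hx => by
    have := congrArg (Subtype.val) (hP ⟨x, hx⟩)
    simp only [Q, sub_apply, ContinuousLinearMap.id_apply, ContinuousLinearMap.comp_apply,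
      Submodule.subtypeL_apply, sub_eq_zero]
    exact this.symm
  have hQz : ∀ x, x - Q x ∈ S := fun x => by simp [Q]
  have hmem : ∀ x, Q x = 0 → x ∈ S := fun x hx => by simpa [hx] using hQz x
  have hR : ContDiff ℝ 1 (fun x => Q (F x)) := Q.contDiff.comp hF
  obtain ⟨R₁, hR₁⟩ := exists_norm_bound_of_curve hz T
  have hzc := (continuousOn_of_curve hz).mono (Icc_subset_Ici_self : Icc 0 T ⊆ Ici 0)
  obtain ⟨R₂, hR₂⟩ := isCompact_Icc.exists_bound_of_continuousOn (s := Icc 0 T)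
    (f := fun t => z t - Q (z t)) (hzc.sub (Q.continuous.comp_continuousOn hzc))
  -- The radius covers the trajectory and also its projection to `S`, since the Lipschitz bound
  -- compares the two.
  obtain ⟨G, K, C, hK, -, hG⟩ := exists_lipschitz_cutoff hR (max R₁ (R₂ + 1))
  refine hmem _ (eq_zero_of_abs_deriv_le_mul_abs_self_of_eq_zero_right (K := K) (a := 0) (b := T)
    (f := fun t => Q (z t)) (f' := fun t => Q (F (z t))) (Q.continuous.comp_continuousOn hzc)
    (fun t ht => Q.hasFDerivAt.comp_hasDerivWithinAt t (hasDerivWithinAt_Ici_of_curve hz ht.1))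
    (hQ _ h0) (fun t ht => ?_) T ⟨hT, le_rfl⟩)
  have htT : t ∈ Icc 0 T := ⟨ht.1, ht.2.le⟩
  have h1 : G (z t) = Q (F (z t)) := hG _ ((hR₁ t htT).trans_le (le_max_left _ _))
  have h2 : G (z t - Q (z t)) = 0 := by
    rw [hG _ (lt_of_le_of_lt (hR₂ t htT) ((lt_add_one _).trans_le (le_max_right _ _)))]
    exact hQ _ (hS _ (hQz _))
  have := hK.dist_le_mul (z t) (z t - Q (z t))
  rw [h1, h2, dist_zero_right, dist_eq_norm, sub_sub_cancel] at this
  exact this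

lemma curve_restrict (hF : ContDiff ℝ 1 F) (hS : ∀ x ∈ S, F x ∈ S)
    (hP : ∀ x : S, P x = x) {z : ℝ → E} (hz : IsIntegralCurveOn z (fun _ => F) (Ici 0))
    (h0 : z 0 ∈ S) : IsIntegralCurveOn (fun t => P (z t)) (fun _ x => P (F x)) (Ici 0) := by
  intro t ht
  have h := P.hasFDerivAt.comp_hasDerivWithinAt t (hz t ht)
  refine h.congr_deriv ?_
  have := hP ⟨z t, curve_mem_of_invariant hF hS hP hz h0 t ht⟩
  change P (z t) = _ at this
  simp only [this]

variable {β : E →ₗ[ℝ] E →ₗ[ℝ] ℝ} {e : E} {κ : ℝ}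

/-- The restriction of a bilinear form to a subspace. -/
noncomputable def restrictForm (β : E →ₗ[ℝ] E →ₗ[ℝ] ℝ) (S : Submodule ℝ E) : S →L[ℝ] S →L[ℝ] ℝ :=
  (β.domRestrict₁₂ S S).toContinuousBilinearMap

lemma restrictForm_apply (x y : S) : restrictForm β S x y = β x y := rfl

lemma restrictForm_decay (hF : ContDiff ℝ 1 F) (hS : ∀ x ∈ S, F x ∈ S) (hP : ∀ x : S, P x = x)
    (he : e ∈ S) (hL : ∀ x ∈ S, β x (fderiv ℝ F e x) ≤ -κ * β x x) (x : S) :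
    restrictForm β S x (P.comp ((fderiv ℝ F e).comp S.subtypeL) x) ≤
      -κ * restrictForm β S x x := by
  rw [restrictForm_apply, restrictForm_apply]
  simp only [ContinuousLinearMap.comp_apply, Submodule.subtypeL_apply]
  rw [fderiv_mem_of_invariant hF hS hP he x.2]
  exact hL x x.2

theorem exponential_convergence_of_invariant (hF : ContDiff ℝ 1 F) (hS : ∀ x ∈ S, F x ∈ S)
    (hP : ∀ x : S, P x = x) (he : e ∈ S) (hFe : F e = 0) (hsymm : ∀ x y, β x y = β y x)
    (hpos : ∀ x ∈ S, x ≠ 0 → 0 < β x x) (hκ : 0 < κ)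
    (hL : ∀ x ∈ S, β x (fderiv ℝ F e x) ≤ -κ * β x x) {z : ℝ → E}
    (hz : IsIntegralCurveOn z (fun _ => F) (Ici 0)) (h0 : z 0 ∈ S) (hlim : Tendsto z atTop (𝓝 e)) :
    ∃ K, ∀ t ≥ 0, ‖z t - e‖ ≤ K * Real.exp (-(κ / 4) * t) := by
  have hPe : P e = ⟨e, he⟩ := hP ⟨e, he⟩
  obtain ⟨K, hK⟩ := exponential_convergence (β := restrictForm β S) (e := (⟨e, he⟩ : S))
    (F := fun x : S => P (F x)) (fun x y => hsymm x y)
    (fun x hx => hpos x x.2 (by simpa using hx)) (by simp [hFe]) (hasFDerivAt_restrict hF ⟨e, he⟩)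
    hκ (restrictForm_decay hF hS hP he hL) (curve_restrict hF hS hP hz h0)
    (by rw [← hPe]; exact (P.continuous.tendsto e).comp hlim)
  refine ⟨K, fun t ht => ?_⟩
  have h1 := hP ⟨z t, curve_mem_of_invariant hF hS hP hz h0 t ht⟩
  change P (z t) = _ at h1
  have h2 := hK t ht
  rw [h1] at h2
  exact h2

/-- The basin is open relative to `S` only; pulling it back under the projection `P` gives an open
subset of `E` with the same trace on `S`. -/
theorem exists_open_basin_of_invariant (hF : ContDiff ℝ 1 F) (hS : ∀ x ∈ S, F x ∈ S)
    (hP : ∀ x : S, P x = x) (he : e ∈ S) (hFe : F e = 0) (hsymm : ∀ x y, β x y = β y x)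
    (hpos : ∀ x ∈ S, x ≠ 0 → 0 < β x x) (hκ : 0 < κ)
    (hL : ∀ x ∈ S, β x (fderiv ℝ F e x) ≤ -κ * β x x) :
    ∃ U : Set E, IsOpen U ∧ ∀ x ∈ S, x ∈ U ↔ ∃ z : ℝ → E, z 0 = x ∧
      IsIntegralCurveOn z (fun _ => F) (Ici 0) ∧ Tendsto z atTop (𝓝 e) := by
  have hPe : P e = ⟨e, he⟩ := hP ⟨e, he⟩
  have hopen := isOpen_basin (β := restrictForm β S) (e := (⟨e, he⟩ : S))
    (F := fun x : S => P (F x)) (P.contDiff.comp (hF.comp S.subtypeL.contDiff))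
    (fun x y => hsymm x y) (fun x hx => hpos x x.2 (by simpa using hx)) (by simp [hFe])
    (hasFDerivAt_restrict hF ⟨e, he⟩) hκ (restrictForm_decay hF hS hP he hL)
  refine ⟨P ⁻¹' _, hopen.preimage P.continuous, fun x hx => ?_⟩
  have hPx : P x = ⟨x, hx⟩ := hP ⟨x, hx⟩
  constructor
  · rintro ⟨-, w, hw0, hw, hlim⟩
    refine ⟨fun t => w t, by simp [hw0, hPx], fun t ht => ?_, ?_⟩
    · have h := S.subtypeL.hasFDerivAt.comp_hasDerivWithinAt t (hw t ht)
      refine h.congr_deriv ?_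
      exact congrArg Subtype.val (hP ⟨F (w t), hS _ (w t).2⟩)
    · exact (S.subtypeL.continuous.tendsto _).comp hlim
  · rintro ⟨z, hz0, hz, hlim⟩
    refine ⟨mem_univ _, fun t => P (z t), by simp [hz0],
      curve_restrict hF hS hP hz (by rwa [hz0]), ?_⟩
    rw [← hPe]
    exact (P.continuous.tendsto e).comp hlim

end InvariantSubspace

/-! ### A quadratic Lyapunov function for the normalized system -/

section Lyapunov

variable {N : ℕ} {γ : ℝ}

attribute [local simp] MomentState.mq MomentState.mp MomentState.Cq MomentState.Cp MomentState.Cqp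

/-- The weight of the mixed terms in the Lyapunov function. -/
noncomputable def mixing (γ : ℝ) : ℝ := γ / (1 + γ ^ 2)

lemma mixing_pos (hγ : 0 < γ) : 0 < mixing γ := by unfold mixing; positivity

/-- The weight `ε = γ / (1 + γ²)` meets three demands for every `γ > 0`: `ε ≤ 1 / 2` keeps the form
positive definite, `ε (2 + γ²) ≤ 2γ` lets the damping absorb the error of the cross term, and `ε ≤
γ` makes `ε` a lower bound, up to constants, for the resulting rates. -/
lemma mixing_le (hγ : 0 < γ) : mixing γ ≤ γ := by
  unfold mixing
  rw [div_le_iff₀ (by positivity)]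
  nlinarith [pow_pos hγ 3]

lemma mixing_le_half : mixing γ ≤ 1 / 2 := by
  unfold mixing
  rw [div_le_iff₀ (by positivity)]
  nlinarith [sq_nonneg (γ - 1)]

lemma mixing_mul_le (hγ : 0 < γ) : mixing γ * (2 + γ ^ 2) ≤ 2 * γ := by
  unfold mixing
  rw [div_mul_eq_mul_div, div_le_iff₀ (by positivity)]
  nlinarith [pow_pos hγ 3]

section Scalar

variable {ε : ℝ}

lemma mean_form_lower (hε0 : 0 < ε) (hε : ε ≤ 1 / 2) (a b : ℝ) :
    1 / 2 * (a ^ 2 + b ^ 2) ≤ a * a + b * b + ε / 2 * (a * b + b * a) := by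
  nlinarith [sq_nonneg (a + b), mul_nonneg hε0.le (sq_nonneg (a + b)), sq_nonneg a, sq_nonneg b,
    mul_nonneg (sub_nonneg.2 hε) (add_nonneg (sq_nonneg a) (sq_nonneg b))]

/-- For `a' = b`, `b' = -a - γ b` the energy dissipates only `γ b²`. The cross term adds `-(ε / 2)
a²` at the cost of `ε b² / 2` and a product `γ a b`, which is absorbed by completing the square `(a
+ γ b)²`. -/
lemma mean_form_decay (hε0 : 0 < ε) (hεγ : ε ≤ γ) (hε : ε ≤ 1 / 2)
    (h2 : ε * (2 + γ ^ 2) ≤ 2 * γ) (a b : ℝ) :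
    a * b + b * (-a - γ * b) + ε / 2 * (a * (-a - γ * b) + b * b) ≤
      -(ε / 12) * (a * a + b * b + ε / 2 * (a * b + b * a)) := by
  have h3 : a * b + b * (-a - γ * b) + ε / 2 * (a * (-a - γ * b) + b * b) ≤
      -(γ / 2) * b ^ 2 - ε / 4 * a ^ 2 := by
    nlinarith [mul_nonneg hε0.le (sq_nonneg (a + γ * b)),
      mul_nonneg (sub_nonneg.2 h2) (sq_nonneg b)]
  have h4 : a * a + b * b + ε / 2 * (a * b + b * a) ≤ 2 * (a ^ 2 + b ^ 2) := by
    nlinarith [mul_nonneg hε0.le (sq_nonneg (a - b)), 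
      mul_nonneg (sub_nonneg.2 hε) (add_nonneg (sq_nonneg a) (sq_nonneg b)), sq_nonneg a,
      sq_nonneg b]
  nlinarith [mul_le_mul_of_nonneg_left h4 (by positivity : 0 ≤ ε / 12),
    mul_nonneg (sub_nonneg.2 hεγ) (sq_nonneg b), mul_nonneg hε0.le (sq_nonneg a),
    mul_nonneg hε0.le (sq_nonneg b)]

lemma cov_form_lower (hε0 : 0 < ε) (hε : ε ≤ 1 / 2) (x w s r : ℝ) :
    1 / 2 * (x ^ 2 + w ^ 2 + s ^ 2 + r ^ 2) ≤
      2 * (x * x) + w * w + 4 * (s * s) + ε / 2 * (x * s + s * x) + r * r := by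
  nlinarith [mul_nonneg hε0.le (sq_nonneg (x + s)), sq_nonneg x, sq_nonneg s, sq_nonneg w,
    sq_nonneg r, mul_nonneg (sub_nonneg.2 hε) (add_nonneg (sq_nonneg x) (sq_nonneg s))]

/-- Here `x` is an entry of `C_q`, `w` of `C_q - C_p`, and `s`, `r` are entries of the symmetric and
skew parts of `C_{q,p}`. The weights `2, 1, 4` are those for which the products `x s` and `w s`
cancel, leaving `-2γ w² - 4γ s² - γ r²`; dissipation in `x` comes from the cross term with `s`
alone. -/
lemma cov_form_decay (hε0 : 0 < ε) (hεγ : ε ≤ γ) (hε : ε ≤ 1 / 2)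
    (h2 : ε * (2 + γ ^ 2) ≤ 2 * γ) (x w s r : ℝ) :
    2 * (x * (2 * s)) + w * (4 * s - 2 * γ * w) + 4 * (s * (-γ * s - x - w))
        + ε / 2 * (x * (-γ * s - x - w) + s * (2 * s)) + r * (-γ * r) ≤
      -(ε / 12) *
        (2 * (x * x) + w * w + 4 * (s * s) + ε / 2 * (x * s + s * x) + r * r) := by
  have h3 : 2 * (x * (2 * s)) + w * (4 * s - 2 * γ * w) + 4 * (s * (-γ * s - x - w))
        + ε / 2 * (x * (-γ * s - x - w) + s * (2 * s)) + r * (-γ * r) ≤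
      -(3 / 2 * γ) * w ^ 2 - 3 * γ * s ^ 2 - ε / 4 * x ^ 2 - γ * r ^ 2 := by
    nlinarith [mul_nonneg hε0.le (sq_nonneg (x / 2 + γ * s)),
      mul_nonneg hε0.le (sq_nonneg (x / 2 + w)), mul_nonneg (sub_nonneg.2 h2) (sq_nonneg s),
      mul_nonneg (sub_nonneg.2 hεγ) (sq_nonneg w)]
  have h4 : 2 * (x * x) + w * w + 4 * (s * s) + ε / 2 * (x * s + s * x) + r * r ≤
      3 * x ^ 2 + w ^ 2 + 5 * s ^ 2 + r ^ 2 := by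
    nlinarith [mul_nonneg hε0.le (sq_nonneg (x - s)), sq_nonneg x, sq_nonneg s,
      mul_nonneg (sub_nonneg.2 hε) (add_nonneg (sq_nonneg x) (sq_nonneg s))]
  nlinarith [mul_le_mul_of_nonneg_left h4 (by positivity : 0 ≤ ε / 12),
    mul_nonneg (sub_nonneg.2 hεγ) (sq_nonneg w), mul_nonneg (sub_nonneg.2 hεγ) (sq_nonneg s),
    mul_nonneg (sub_nonneg.2 hεγ) (sq_nonneg r), mul_nonneg hε0.le (sq_nonneg w),
    mul_nonneg hε0.le (sq_nonneg s), mul_nonneg hε0.le (sq_nonneg r)]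

end Scalar

/-- The equilibrium of the normalized system. -/
def normalizedEquilibrium (N : ℕ) : MomentState N := (0, 0, 1, 1, 0)

/-- The linearization of the normalized system at its nondegenerate equilibrium. -/
def normalizedLinearization (γ : ℝ) (h : MomentState N) : MomentState N :=
  (h.mp, -h.mq - γ • h.mp, h.Cqp + h.Cqpᵀ,
    -h.Cqp - h.Cqpᵀ - (2 * γ) • h.Cp + (2 * γ) • h.Cq, -(γ • h.Cqp) - (2 : ℝ) • h.Cq + h.Cp)

lemma momentField_expansion (γ : ℝ) (h : MomentState N) (t : ℝ) :
    momentField γ 1 0 (normalizedEquilibrium N + t • h) =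
      momentField γ 1 0 (normalizedEquilibrium N) + t • normalizedLinearization γ h +
        t ^ 2 • ((0, -(h.Cq *ᵥ h.mq), 0, -(h.Cq * h.Cqp) - (h.Cq * h.Cqp)ᵀ, -(h.Cq * h.Cq)) :
          MomentState N) := by
  obtain ⟨a, b, X, Y, Z⟩ := h
  refine Prod.ext ?_ (Prod.ext ?_ (Prod.ext ?_ (Prod.ext ?_ ?_))) <;>
  simp [momentField, normalizedEquilibrium, normalizedLinearization, Matrix.add_mulVec,
    Matrix.add_mul, Matrix.mul_add, Matrix.smul_mulVec, Matrix.mulVec_smul, smul_smul, pow_two,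
    Matrix.transpose_mul] <;> module

lemma fderiv_momentField_equilibrium (γ : ℝ) (h : MomentState N) :
    (fderiv ℝ (momentField γ 1 0) (normalizedEquilibrium N) : NormedMap _ _) h =
      normalizedLinearization γ h :=
  fderiv_apply_of_quadratic (differentiable_momentField γ 1 0 _) (momentField_expansion γ h)

/-- The bilinear form of the Lyapunov function. -/
noncomputable def lyapunovForm (N : ℕ) (ε : ℝ) : MomentState N →ₗ[ℝ] MomentState N →ₗ[ℝ] ℝ :=
  LinearMap.mk₂ ℝ
    (fun h k => ∑ i, (h.mq i * k.mq i + h.mp i * k.mp i +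
        ε / 2 * (h.mq i * k.mp i + h.mp i * k.mq i)) +
      ∑ i, ∑ j, (2 * (h.Cq i j * k.Cq i j) + (h.Cq i j - h.Cp i j) * (k.Cq i j - k.Cp i j) +
        4 * ((h.Cqp i j + h.Cqp j i) / 2 * ((k.Cqp i j + k.Cqp j i) / 2)) +
        ε / 2 * (h.Cq i j * ((k.Cqp i j + k.Cqp j i) / 2) +
          (h.Cqp i j + h.Cqp j i) / 2 * k.Cq i j) +
        (h.Cqp i j - h.Cqp j i) / 2 * ((k.Cqp i j - k.Cqp j i) / 2)))
    (fun h h' k => by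
      refine Eq.trans ?_ (add_add_add_comm _ _ _ _)
      refine Eq.trans ?_ (congrArg₂ (· + ·) Finset.sum_add_distrib Finset.sum_add_distrib)
      refine congrArg₂ (· + ·) ?_ ?_
      · exact Finset.sum_congr rfl fun i _ => by simp; ring
      · refine Finset.sum_congr rfl fun i _ => ?_
        rw [← Finset.sum_add_distrib]
        exact Finset.sum_congr rfl fun j _ => by simp; ring)
    (fun a h k => by
      simp only [smul_eq_mul, mul_add, Finset.mul_sum]
      congr 1
      · exact Finset.sum_congr rfl fun i _ => by simp; ring
      · exact Finset.sum_congr rfl fun i _ => Finset.sum_congr rfl fun j _ => by simp; ring)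
    (fun h k k' => by
      refine Eq.trans ?_ (add_add_add_comm _ _ _ _)
      refine Eq.trans ?_ (congrArg₂ (· + ·) Finset.sum_add_distrib Finset.sum_add_distrib)
      refine congrArg₂ (· + ·) ?_ ?_
      · exact Finset.sum_congr rfl fun i _ => by simp; ring
      · refine Finset.sum_congr rfl fun i _ => ?_
        rw [← Finset.sum_add_distrib]
        exact Finset.sum_congr rfl fun j _ => by simp; ring)
    (fun a h k => by
      simp only [smul_eq_mul, mul_add, Finset.mul_sum]
      congr 1
      · exact Finset.sum_congr rfl fun i _ => by simp; ring
      · exact Finset.sum_congr rfl fun i _ => Finset.sum_congr rfl fun j _ => by simp; ring)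

lemma lyapunovForm_apply (ε : ℝ) (h k : MomentState N) :
    lyapunovForm N ε h k = ∑ i, (h.mq i * k.mq i + h.mp i * k.mp i +
        ε / 2 * (h.mq i * k.mp i + h.mp i * k.mq i)) +
      ∑ i, ∑ j, (2 * (h.Cq i j * k.Cq i j) + (h.Cq i j - h.Cp i j) * (k.Cq i j - k.Cp i j) +
        4 * ((h.Cqp i j + h.Cqp j i) / 2 * ((k.Cqp i j + k.Cqp j i) / 2)) +
        ε / 2 * (h.Cq i j * ((k.Cqp i j + k.Cqp j i) / 2) +
          (h.Cqp i j + h.Cqp j i) / 2 * k.Cq i j) +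
        (h.Cqp i j - h.Cqp j i) / 2 * ((k.Cqp i j - k.Cqp j i) / 2)) := rfl

lemma lyapunovForm_symm (ε : ℝ) (h k : MomentState N) :
    lyapunovForm N ε h k = lyapunovForm N ε k h := by
  simp only [lyapunovForm_apply]
  congr 1
  · exact Finset.sum_congr rfl fun i _ => by ring
  · exact Finset.sum_congr rfl fun i _ => Finset.sum_congr rfl fun j _ => by ring

/-- Entrywise the form dominates half a sum of squares. If it were not positive, all these squares
would vanish, and the combinations `C_q`, `C_q - C_p` and the two parts of `C_{q,p}` determine every
block. -/
lemma lyapunovForm_pos {ε : ℝ} (hε0 : 0 < ε) (hε : ε ≤ 1 / 2) {h : MomentState N} (hh : h ≠ 0) :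
    0 < lyapunovForm N ε h h := by
  have h1 : ∀ i, 0 ≤ 1 / 2 * (h.mq i ^ 2 + h.mp i ^ 2) := fun i => by positivity
  have h2 : ∀ i j, 0 ≤ 1 / 2 * (h.Cq i j ^ 2 + (h.Cq i j - h.Cp i j) ^ 2 +
      ((h.Cqp i j + h.Cqp j i) / 2) ^ 2 + ((h.Cqp i j - h.Cqp j i) / 2) ^ 2) :=
    fun i j => by positivity
  have h3 : ∑ i, 1 / 2 * (h.mq i ^ 2 + h.mp i ^ 2) + ∑ i, ∑ j, 1 / 2 * (h.Cq i j ^ 2 +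
      (h.Cq i j - h.Cp i j) ^ 2 + ((h.Cqp i j + h.Cqp j i) / 2) ^ 2 +
      ((h.Cqp i j - h.Cqp j i) / 2) ^ 2) ≤ lyapunovForm N ε h h := by
    rw [lyapunovForm_apply]
    refine add_le_add (Finset.sum_le_sum fun i _ => mean_form_lower hε0 hε _ _)
      (Finset.sum_le_sum fun i _ => Finset.sum_le_sum fun j _ => cov_form_lower hε0 hε _ _ _ _)
  have h4 := Finset.sum_nonneg fun i (_ : i ∈ Finset.univ) => h1 i
  have h5 : ∀ i, (0 : ℝ) ≤ _ := fun i => Finset.sum_nonneg fun j (_ : j ∈ Finset.univ) => h2 i j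
  have h6 := Finset.sum_nonneg fun i (_ : i ∈ Finset.univ) => h5 i
  by_contra hle
  have h7 := le_antisymm (by linarith) h4
  have h8 := le_antisymm (by linarith) h6
  rw [Finset.sum_eq_zero_iff_of_nonneg fun i _ => h1 i] at h7
  rw [Finset.sum_eq_zero_iff_of_nonneg fun i _ => h5 i] at h8
  have h9 : ∀ i j, _ := fun i j =>
    (Finset.sum_eq_zero_iff_of_nonneg fun j _ => h2 i j).1 (h8 i (Finset.mem_univ i)) j
      (Finset.mem_univ j)
  have hC : ∀ i j, h.Cq i j = 0 := fun i j => pow_eq_zero_iff two_ne_zero |>.1 (by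
    nlinarith [h9 i j, sq_nonneg (h.Cq i j), sq_nonneg (h.Cq i j - h.Cp i j),
      sq_nonneg ((h.Cqp i j + h.Cqp j i) / 2), sq_nonneg ((h.Cqp i j - h.Cqp j i) / 2)])
  have hD : ∀ i j, h.Cq i j - h.Cp i j = 0 := fun i j => pow_eq_zero_iff two_ne_zero |>.1 (by
    nlinarith [h9 i j, sq_nonneg (h.Cq i j), sq_nonneg (h.Cq i j - h.Cp i j),
      sq_nonneg ((h.Cqp i j + h.Cqp j i) / 2), sq_nonneg ((h.Cqp i j - h.Cqp j i) / 2)])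
  have hs : ∀ i j, (h.Cqp i j + h.Cqp j i) / 2 = 0 := fun i j =>
    pow_eq_zero_iff two_ne_zero |>.1 (by
      nlinarith [h9 i j, sq_nonneg (h.Cq i j), sq_nonneg (h.Cq i j - h.Cp i j),
        sq_nonneg ((h.Cqp i j + h.Cqp j i) / 2), sq_nonneg ((h.Cqp i j - h.Cqp j i) / 2)])
  have hr : ∀ i j, (h.Cqp i j - h.Cqp j i) / 2 = 0 := fun i j =>
    pow_eq_zero_iff two_ne_zero |>.1 (by
      nlinarith [h9 i j, sq_nonneg (h.Cq i j), sq_nonneg (h.Cq i j - h.Cp i j),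
        sq_nonneg ((h.Cqp i j + h.Cqp j i) / 2), sq_nonneg ((h.Cqp i j - h.Cqp j i) / 2)])
  apply hh
  refine Prod.ext ?_ (Prod.ext ?_ (Prod.ext ?_ (Prod.ext ?_ ?_)))
  · funext i
    refine pow_eq_zero_iff two_ne_zero |>.1 (?_ : h.mq i ^ 2 = 0)
    nlinarith [h7 i (Finset.mem_univ i), sq_nonneg (h.mq i), sq_nonneg (h.mp i)]
  · funext i
    refine pow_eq_zero_iff two_ne_zero |>.1 (?_ : h.mp i ^ 2 = 0)
    nlinarith [h7 i (Finset.mem_univ i), sq_nonneg (h.mq i), sq_nonneg (h.mp i)]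
  · ext i j
    exact hC i j
  · ext i j
    have := hC i j
    have := hD i j
    change h.Cp i j = 0
    linarith
  · ext i j
    have := hs i j
    have := hr i j
    change h.Cqp i j = 0
    linarith

/-- The decay rate of the Lyapunov function along the linearized flow. -/
noncomputable def decayRate (γ : ℝ) : ℝ := mixing γ / 12

lemma decayRate_pos (hγ : 0 < γ) : 0 < decayRate γ := by
  have := mixing_pos hγ
  unfold decayRate
  positivity

/-- Around the identity the linearization decouples: for symmetric `C_q` and `C_p`, each pair of
indices obeys the scalar system of `cov_form_decay`, and each index of the means that of
`mean_form_decay`. Symmetry is what lets the symmetric and skew parts of `C_{q,p}` separate. -/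
lemma lyapunovForm_decay (hγ : 0 < γ) {h : MomentState N} (hh : h ∈ symmetricStates N) :
    lyapunovForm N (mixing γ) h (normalizedLinearization γ h) ≤
      -decayRate γ * lyapunovForm N (mixing γ) h h := by
  have hX : ∀ i j, h.Cq j i = h.Cq i j := fun i j => hh.1.apply i j
  have hY : ∀ i j, h.Cp j i = h.Cp i j := fun i j => hh.2.apply i j
  rw [lyapunovForm_apply, lyapunovForm_apply, mul_add, Finset.mul_sum, Finset.mul_sum]
  refine add_le_add (Finset.sum_le_sum fun i _ => ?_) (Finset.sum_le_sum fun i _ => ?_)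
  · have := mean_form_decay (mixing_pos hγ) (mixing_le hγ) mixing_le_half (mixing_mul_le hγ)
      (h.mq i) (h.mp i)
    simpa [normalizedLinearization, decayRate] using this
  · rw [Finset.mul_sum]
    refine Finset.sum_le_sum fun j _ => ?_
    have := cov_form_decay (mixing_pos hγ) (mixing_le hγ) mixing_le_half (mixing_mul_le hγ)
      (h.Cq i j) (h.Cq i j - h.Cp i j) ((h.Cqp i j + h.Cqp j i) / 2) ((h.Cqp i j - h.Cqp j i) / 2)
    refine le_trans (le_of_eq ?_) this
    have e1 : (normalizedLinearization γ h).Cq i j = h.Cqp i j + h.Cqp j i := rfl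
    have e2 : (normalizedLinearization γ h).Cp i j =
      -h.Cqp i j - h.Cqp j i - 2 * γ * h.Cp i j + 2 * γ * h.Cq i j := rfl
    have e3 : ∀ i j, (normalizedLinearization γ h).Cqp i j =
      -(γ * h.Cqp i j) - 2 * h.Cq i j + h.Cp i j := fun _ _ => rfl
    rw [e1, e2, e3, e3, hX i j, hY i j]
    ring

/-- All eigenvalues of the linearization at the nondegenerate equilibrium have negative real
part. -/
lemma normalized_eigenvalue_neg (hγ : 0 < γ) {L : MomentState N → MomentState N}
    (hL : ∀ h, L h = normalizedLinearization γ h) {z : ℂ} {u v : MomentState N}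
    (hu : u ∈ symmetricStates N) (hv : v ∈ symmetricStates N) (hne : u ≠ 0 ∨ v ≠ 0)
    (h1 : L u = z.re • u - z.im • v) (h2 : L v = z.im • u + z.re • v) : z.re < 0 := by
  set b := lyapunovForm N (mixing γ)
  have hpos : ∀ x, x ≠ 0 → 0 < b x x := fun x => lyapunovForm_pos (mixing_pos hγ) mixing_le_half
  have hnn : ∀ x, 0 ≤ b x x := fun x => by
    by_cases hx : x = 0
    · simp [hx]
    · exact (hpos x hx).le
  have hsum : 0 < b u u + b v v := by
    rcases hne with h | h
    · exact add_pos_of_pos_of_nonneg (hpos u h) (hnn v)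
    · exact add_pos_of_nonneg_of_pos (hnn u) (hpos v h)
  -- Summing the estimates for the real and imaginary parts cancels the terms with `z.im`, by
  -- symmetry of the form, and leaves `z.re` times a positive number.
  have e1 := lyapunovForm_decay hγ hu
  have e2 := lyapunovForm_decay hγ hv
  rw [← hL, h1, map_sub, map_smul, map_smul, smul_eq_mul, smul_eq_mul] at e1
  rw [← hL, h2, map_add, map_smul, map_smul, smul_eq_mul, smul_eq_mul] at e2
  have e3 : b u v = b v u := lyapunovForm_symm _ _ _
  have hκ := decayRate_pos hγ
  by_contra! hre
  change z.re * b u u - z.im * b u v ≤ -decayRate γ * b u u at e1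
  change z.im * b v u + z.re * b v v ≤ -decayRate γ * b v v at e2
  rw [e3] at e1
  nlinarith [mul_pos hκ hsum, mul_nonneg hre hsum.le]

/-! ### The normalized system on states with symmetric covariance -/

/-- Symmetrization of the diagonal covariance blocks. -/
noncomputable def symmetrize (N : ℕ) : NormedMap (MomentState N) (symmetricStates N) :=
  LinearMap.toContinuousLinearMap
    { toFun := fun x => ⟨(x.mq, x.mp, (1 / 2 : ℝ) • (x.Cq + x.Cqᵀ), (1 / 2 : ℝ) • (x.Cp + x.Cpᵀ),
        x.Cqp), by
          constructor <;> simp [Matrix.IsSymm, add_comm]⟩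
      map_add' := fun x y => by
        apply Subtype.ext
        simp
        constructor <;> abel
      map_smul' := fun a x => by
        apply Subtype.ext
        simp
        constructor <;> module }

lemma normalizedEquilibrium_mem : normalizedEquilibrium N ∈ symmetricStates N :=
  ⟨Matrix.isSymm_one, Matrix.isSymm_one⟩

lemma momentField_normalizedEquilibrium (γ : ℝ) :
    momentField γ 1 0 (normalizedEquilibrium N) = 0 := by
  simp [normalizedEquilibrium, momentField]

lemma symmetrize_of_mem {x : MomentState N} (hx : x ∈ symmetricStates N) :
    symmetrize N x = ⟨x, hx⟩ := by
  obtain ⟨a, b, X, Y, Z⟩ := x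
  obtain ⟨hX, hY⟩ : X.IsSymm ∧ Y.IsSymm := hx
  apply Subtype.ext
  change ((a, b, (1 / 2 : ℝ) • (X + Xᵀ), (1 / 2 : ℝ) • (Y + Yᵀ), Z) : MomentState N) = _
  rw [hX.eq, hY.eq, ← two_smul ℝ, ← two_smul ℝ, smul_smul, smul_smul]
  norm_num

lemma momentField_mem_symmetricStates {x : MomentState N} (hx : x ∈ symmetricStates N) :
    momentField γ 1 0 x ∈ symmetricStates N := by
  obtain ⟨a, b, X, Y, Z⟩ := x
  obtain ⟨hX, hY⟩ : X.IsSymm ∧ Y.IsSymm := hx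
  constructor
  · simp [Matrix.IsSymm, momentField, add_comm]
  · simp [Matrix.IsSymm, momentField, hX.eq, hY.eq]
    abel

theorem exists_open_basin_normalized (hγ : 0 < γ) :
    ∃ U : Set (MomentState N), IsOpen U ∧ ∀ x ∈ symmetricStates N, x ∈ U ↔
      ∃ z : ℝ → MomentState N, z 0 = x ∧ IsIntegralCurveOn z (fun _ => momentField γ 1 0) (Ici 0) ∧
        Tendsto z atTop (𝓝 (normalizedEquilibrium N)) :=
  exists_open_basin_of_invariant (P := symmetrize N) (contDiff_momentField γ 1 0)
    (fun _ => momentField_mem_symmetricStates) (fun x => symmetrize_of_mem x.2)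
    normalizedEquilibrium_mem (momentField_normalizedEquilibrium γ)
    (lyapunovForm_symm (mixing γ)) (fun _ _ => lyapunovForm_pos (mixing_pos hγ) mixing_le_half)
    (decayRate_pos hγ) (fun h hh => by
      rw [fderiv_momentField_equilibrium]
      exact lyapunovForm_decay hγ hh)

theorem exponential_convergence_normalized (hγ : 0 < γ) {z : ℝ → MomentState N}
    (hz : IsIntegralCurveOn z (fun _ => momentField γ 1 0) (Ici 0)) (h0 : z 0 ∈ symmetricStates N)
    (hlim : Tendsto z atTop (𝓝 (normalizedEquilibrium N))) :
    ∃ K, ∀ t ≥ 0, ‖z t - normalizedEquilibrium N‖ ≤ K * Real.exp (-(decayRate γ / 4) * t) :=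
  exponential_convergence_of_invariant (P := symmetrize N) (contDiff_momentField γ 1 0)
    (fun _ => momentField_mem_symmetricStates) (fun x => symmetrize_of_mem x.2)
    normalizedEquilibrium_mem (momentField_normalizedEquilibrium γ)
    (lyapunovForm_symm (mixing γ)) (fun _ _ => lyapunovForm_pos (mixing_pos hγ) mixing_le_half)
    (decayRate_pos hγ) (fun h hh => by
      rw [fderiv_momentField_equilibrium]
      exact lyapunovForm_decay hγ hh) hz h0 hlim

end Lyapunov

end EnsembleLangevin

namespace EnsembleLangevin

/-! ### Instability of the degenerate steady states -/

section Instability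

variable {N : ℕ} {γ : ℝ}

attribute [local simp] MomentState.mq MomentState.mp MomentState.Cq MomentState.Cp MomentState.Cqp

/-- A positive growth rate of rank-one perturbations in a degenerate direction. -/
lemma exists_growth_rate (hγ : 0 < γ) : ∃ l : ℝ, 0 < l ∧ l * (l + γ) * (l + 2 * γ) = 4 * γ := by
  -- The cubic is the characteristic equation of the linearized system `a' = 2c`, `b' = 2γ (a - b)`,
  -- `c' = b - γ c`. It takes a value above `4γ` at `2`.
  have hc : ContinuousOn (fun l : ℝ => l * (l + γ) * (l + 2 * γ)) (Icc 0 2) := by fun_prop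
  obtain ⟨l, hl, h⟩ := intermediate_value_Icc (by norm_num) hc
    (show 4 * γ ∈ Icc _ _ by constructor <;> nlinarith [pow_pos hγ 2])
  have h' : l * (l + γ) * (l + 2 * γ) = 4 * γ := h
  refine ⟨l, lt_of_le_of_ne hl.1 ?_, h'⟩
  rintro rfl
  linarith

/-- A differential inequality makes `g * exp (-k t)` monotone. It is used with negative `k` for the
determinant and with positive `k` for the growing functional. -/
lemma exp_growth {g g' : ℝ → ℝ} {k : ℝ} (hg : ∀ t ≥ 0, HasDerivWithinAt g (g' t) (Ici 0) t)
    (hk : ∀ t ≥ 0, k * g t ≤ g' t) : ∀ t ≥ 0, g 0 * Real.exp (k * t) ≤ g t := by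
  have hd : ∀ t ≥ 0, HasDerivWithinAt (fun t => g t * Real.exp (-k * t))
      (g' t * Real.exp (-k * t) + g t * (Real.exp (-k * t) * -k)) (Ici 0) t := fun t ht => by
    have := (((hasDerivAt_id t).const_mul (-k)).exp).hasDerivWithinAt (s := Ici 0)
    exact ((hg t ht).mul this).congr_deriv (by simp)
  have hmono : MonotoneOn (fun t => g t * Real.exp (-k * t)) (Ici 0) := by
    refine monotoneOn_of_hasDerivWithinAt_nonneg (convex_Ici 0)
      (fun t ht => (hd t ht).continuousWithinAt)
      (fun t ht => (hd t (interior_subset ht)).mono interior_subset) (fun t ht => ?_)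
    have := hk t (interior_subset ht)
    nlinarith [mul_nonneg (sub_nonneg.2 this) (Real.exp_pos (-k * t)).le]
  intro t ht
  have h := hmono (mem_Ici.2 le_rfl) (mem_Ici.2 ht) ht
  simp only [mul_zero, Real.exp_zero, mul_one] at h
  calc g 0 * Real.exp (k * t) ≤ g t * Real.exp (-k * t) * Real.exp (k * t) := by gcongr
    _ = g t := by rw [mul_assoc, ← Real.exp_add]; simp

/-- The dynamics of rank-one perturbations of a degenerate steady state: `w = (s, r, a, b, c)` stands
for the perturbation by `s v`, `r v` of the means and by `a v vᵀ`, `b v vᵀ`, `c v vᵀ` of the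
covariance blocks. -/
def rankOneField (γ ν : ℝ) (w : ℝ × ℝ × ℝ × ℝ × ℝ) : ℝ × ℝ × ℝ × ℝ × ℝ :=
  (w.2.1, -(w.2.2.1 * (ν + w.1)) - γ * w.2.1, 2 * w.2.2.2.2,
    -(2 * w.2.2.1 * w.2.2.2.2) - 2 * γ * w.2.2.2.1 + 2 * γ * w.2.2.1,
    -(γ * w.2.2.2.2) - w.2.2.1 ^ 2 + w.2.2.2.1)

lemma contDiff_rankOneField (γ ν : ℝ) : ContDiff ℝ 1 (rankOneField γ ν) := by
  unfold rankOneField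
  fun_prop

/-- Solutions of the rank-one system started at an isotropic positive perturbation do not stay in a
small ball. -/
lemma rankOne_not_bounded (hγ : 0 < γ) (ν : ℝ) : ∃ ε > 0, ∀ (w : ℝ → ℝ × ℝ × ℝ × ℝ × ℝ) (η : ℝ),
    0 < η → w 0 = (0, 0, η, η, 0) → IsIntegralCurveOn w (fun _ => rankOneField γ ν) (Ici 0) →
    ¬ ∀ t ≥ 0, ‖w t‖ < ε := by
  obtain ⟨l, hl, hleq⟩ := exists_growth_rate hγ
  -- The row vector `(α, 1, k)` is a left eigenvector for `l` of the linearized equations for `(a,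
  -- b, c)`.
  set k := l + 2 * γ with hk
  set α := 2 * γ / l with hα
  have hk0 : 0 < k := by positivity
  have hα0 : 0 < α := by positivity
  have hαl : l * α = 2 * γ := by rw [hα]; field_simp
  -- This inequality makes `α a + b + k c` at least `μ a` whenever `a, b > 0` and `c² < a b`, that
  -- is, for positive definite `2 × 2` covariances.
  have hμ : 0 < α - k ^ 2 / 4 := by
    have h1 : l * k ^ 2 * (l + γ) = 4 * γ * k := by rw [← hleq, hk]; ring
    have h2 : l * k ^ 2 < 8 * γ := by
      by_contra! hle
      have : 4 * γ * k ≥ 8 * γ * (l + γ) := by rw [← h1]; gcongr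
      nlinarith [mul_pos hγ hl]
    have h3 : 0 < l * (α - k ^ 2 / 4) := by rw [mul_sub, hαl]; linarith
    exact (mul_pos_iff_of_pos_left hl).1 h3
  set μ := α - k ^ 2 / 4 with hμdef
  -- In the ball of this radius the nonlinear terms `2 a c + k a²` cost at most `μ (l / 2) a`, half
  -- of the linear growth, so the functional grows at rate at least `l / 2`.
  refine ⟨μ * l / (2 * (2 + k)), by positivity, fun w η hη hw0 hw hbound => ?_⟩
  set ε := μ * l / (2 * (2 + k)) with hε
  have hε' : ε * (2 + k) = μ * (l / 2) := by rw [hε]; field_simp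
  set a : ℝ → ℝ := fun t => (w t).2.2.1 with ha
  set b : ℝ → ℝ := fun t => (w t).2.2.2.1 with hb
  set c : ℝ → ℝ := fun t => (w t).2.2.2.2 with hc
  have da : ∀ t ≥ 0, HasDerivWithinAt a (2 * c t) (Ici 0) t := fun t ht => by
    have h := hw t ht
    exact h.hasFDerivWithinAt.snd.snd.fst.hasDerivWithinAt.congr_deriv (by simp [rankOneField, hc])
  have db : ∀ t ≥ 0, HasDerivWithinAt b
      (-(2 * a t * c t) - 2 * γ * b t + 2 * γ * a t) (Ici 0) t := fun t ht => by
    have h := hw t ht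
    exact h.hasFDerivWithinAt.snd.snd.snd.fst.hasDerivWithinAt.congr_deriv
      (by simp [rankOneField, ha, hb, hc])
  have dc : ∀ t ≥ 0, HasDerivWithinAt c (-(γ * c t) - a t ^ 2 + b t) (Ici 0) t := fun t ht => by
    have h := hw t ht
    exact h.hasFDerivWithinAt.snd.snd.snd.snd.hasDerivWithinAt.congr_deriv
      (by simp [rankOneField, ha, hb, hc])
  have ha0 : a 0 = η := by simp [ha, hw0]
  have hb0 : b 0 = η := by simp [hb, hw0]
  have hc0 : c 0 = 0 := by simp [hc, hw0]
  -- The cubic terms cancel in the derivative of `a b - c²`, which equals `-2γ (a b - c²) + 2γ a²`;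
  -- so the determinant stays positive.
  have hdet : ∀ t ≥ 0, 0 < a t * b t - c t * c t := by
    intro t ht
    have := exp_growth (k := -(2 * γ)) (fun t ht => ((da t ht).mul (db t ht)).sub
      ((dc t ht).mul (dc t ht))) (fun t ht => by
        simp only [Pi.mul_apply, Pi.sub_apply]
        nlinarith [mul_nonneg hγ.le (sq_nonneg (a t))]) t ht
    refine lt_of_lt_of_le ?_ this
    simp only [Pi.mul_apply, Pi.sub_apply, ha0, hb0, hc0]
    have := Real.exp_pos (-(2 * γ) * t)
    nlinarith [mul_pos (mul_pos hη hη) this]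
  -- At a zero of `a` the determinant would be `-c² ≤ 0`.
  have hapos : ∀ t ≥ 0, 0 < a t := by
    intro t ht
    by_contra! hle
    have hcont : ContinuousOn a (Icc 0 t) := fun s hs =>
      ((da s hs.1).mono Icc_subset_Ici_self).continuousWithinAt
    obtain ⟨s, hs, hs0⟩ := intermediate_value_Icc' ht hcont
      (show (0 : ℝ) ∈ Icc (a t) (a 0) from ⟨hle, by rw [ha0]; exact hη.le⟩)
    have := hdet s hs.1
    rw [hs0] at this
    nlinarith [mul_self_nonneg (c s)]
  have hbpos : ∀ t ≥ 0, 0 < b t := fun t ht => by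
    have h1 := hdet t ht
    have h2 : 0 < a t * b t := by nlinarith [mul_self_nonneg (c t)]
    exact (mul_pos_iff_of_pos_left (hapos t ht)).1 h2
  have hcoer : ∀ t ≥ 0, μ * a t ≤ α * a t + b t + k * c t := by
    intro t ht
    have h1 : |k * c t| ≤ k ^ 2 / 4 * a t + b t := by
      have := hapos t ht
      have := hbpos t ht
      refine abs_le_of_sq_le_sq ?_ (by positivity)
      have := hdet t ht
      have h2 : (k ^ 2 / 4 * a t + b t) ^ 2 - (k * c t) ^ 2 = (k ^ 2 / 4 * a t - b t) ^ 2 +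
        k ^ 2 * (a t * b t - c t * c t) := by ring
      linarith [sq_nonneg (k ^ 2 / 4 * a t - b t), mul_pos (pow_pos hk0 2) this]
    rw [hμdef]
    linarith [neg_abs_le (k * c t)]
  have hnorm : ∀ t ≥ 0, |a t| < ε ∧ |b t| < ε ∧ |c t| < ε := by
    intro t ht
    have h := hbound t ht
    have h3 := (norm_snd_le (w t)).trans_lt h
    have h4 := (norm_snd_le (w t).2).trans_lt h3
    have h5 := (norm_snd_le (w t).2.2).trans_lt h4
    exact ⟨(norm_fst_le _).trans_lt h4, (norm_fst_le _).trans_lt h5, (norm_snd_le _).trans_lt h5⟩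
  have hgrow := exp_growth (k := l / 2) (g := fun t => α * a t + b t + k * c t)
    (fun t ht => (((da t ht).const_mul α).add (db t ht)).add ((dc t ht).const_mul k))
    (fun t ht => by
      have e1 : α * (2 * c t) + (-(2 * a t * c t) - 2 * γ * b t + 2 * γ * a t) +
          k * (-(γ * c t) - a t ^ 2 + b t) =
          l * (α * a t + b t + k * c t) - 2 * a t * c t - k * a t ^ 2 := by
        have h1 : l * k = 2 * α - k * γ := by
          have : l * (l * k) = l * (2 * α - k * γ) := by
            rw [mul_sub, show l * (2 * α) = 2 * (l * α) by ring, hαl]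
            rw [hk]; linarith
          exact mul_left_cancel₀ hl.ne' this
        have h2 : k - 2 * γ = l := by rw [hk]; ring
        linear_combination (-a t) * hαl - c t * h1 + b t * h2
      rw [e1]
      have h1 := hcoer t ht
      have h2 := hapos t ht
      have h3 := (abs_lt.1 (hnorm t ht).1).2
      have h4 := (abs_lt.1 (hnorm t ht).2.2).2
      have h5 : 2 * a t * c t + k * a t ^ 2 ≤ a t * (ε * (2 + k)) := by
        have e2 : a t * (ε * (2 + k)) - (2 * a t * c t + k * a t ^ 2) =
          2 * (a t * (ε - c t)) + a t * k * (ε - a t) := by ring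
        linarith [mul_pos h2 (sub_pos.2 h4), mul_pos (mul_pos h2 hk0) (sub_pos.2 h3)]
      rw [hε'] at h5
      have h6 := mul_le_mul_of_nonneg_right h1 (by positivity : 0 ≤ l / 2)
      linarith)
  have hlim : Tendsto (fun t => (α * η + η) * Real.exp (l / 2 * t)) atTop atTop :=
    (Real.tendsto_exp_atTop.comp (tendsto_id.const_mul_atTop (by positivity))).const_mul_atTop
      (by positivity)
  obtain ⟨t, ht0, ht⟩ := ((eventually_ge_atTop 0).and
    (hlim.eventually_ge_atTop ((α + 1 + k) * ε))).exists
  have h1 := hgrow t ht0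
  simp only [ha0, hb0, hc0, mul_zero, add_zero] at h1
  obtain ⟨h2, h3, h4⟩ := hnorm t ht0
  have h5 := (abs_lt.1 h2).2
  have h6 := (abs_lt.1 h3).2
  have h7 := (abs_lt.1 h4).2
  linarith [mul_lt_mul_of_pos_left h5 hα0, mul_lt_mul_of_pos_left h7 hk0]

/-- The perturbation of rank one in the direction `v`. -/
noncomputable def rankOneLift (v : Fin N → ℝ) : NormedMap (ℝ × ℝ × ℝ × ℝ × ℝ) (MomentState N) :=
  LinearMap.toContinuousLinearMap
    { toFun := fun w => (w.1 • v, w.2.1 • v, w.2.2.1 • Matrix.vecMulVec v v,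
        w.2.2.2.1 • Matrix.vecMulVec v v, w.2.2.2.2 • Matrix.vecMulVec v v)
      map_add' := fun x y => by simp [add_smul]
      map_smul' := fun a x => by simp [mul_smul] }

lemma rankOneLift_apply (v : Fin N → ℝ) (w : ℝ × ℝ × ℝ × ℝ × ℝ) :
    rankOneLift v w = (w.1 • v, w.2.1 • v, w.2.2.1 • Matrix.vecMulVec v v,
        w.2.2.2.1 • Matrix.vecMulVec v v, w.2.2.2.2 • Matrix.vecMulVec v v) := rfl

lemma rankOneLift_injective {v : Fin N → ℝ} (hv : v ≠ 0) : Function.Injective (rankOneLift v) := by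
  have hvv : Matrix.vecMulVec v v ≠ 0 := by
    simpa [Matrix.vecMulVec_eq_zero] using hv
  intro x y h
  simp only [rankOneLift_apply, Prod.mk.injEq] at h
  obtain ⟨h1, h2, h3, h4, h5⟩ := h
  have := smul_left_injective ℝ hv
  have := smul_left_injective ℝ hvv
  refine Prod.ext ?_ (Prod.ext ?_ (Prod.ext ?_ (Prod.ext ?_ ?_)))
  · exact smul_left_injective ℝ hv h1
  · exact smul_left_injective ℝ hv h2
  · exact smul_left_injective ℝ hvv h3
  · exact smul_left_injective ℝ hvv h4
  · exact smul_left_injective ℝ hvv h5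

lemma rankOneLift_mem_symmetricStates (v : Fin N → ℝ) (w : ℝ × ℝ × ℝ × ℝ × ℝ) :
    rankOneLift v w ∈ symmetricStates N := by
  constructor <;> simp [rankOneLift_apply, Matrix.IsSymm, Matrix.transpose_vecMulVec]

/-- Rank-one perturbations of a degenerate steady state form an invariant set. -/
lemma momentField_add_rankOneLift {x : MomentState N} (hx : x ∈ symmetricStates N)
    (hXX : x.Cq * x.Cq = x.Cq) (hXm : x.Cq *ᵥ x.mq = 0) (hp : x.mp = 0) (hY : x.Cp = x.Cq)
    (hZ : x.Cqp = 0) {v : Fin N → ℝ} (hXv : x.Cq *ᵥ v = 0) (hv : v ⬝ᵥ v = 1)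
    (w : ℝ × ℝ × ℝ × ℝ × ℝ) :
    momentField γ 1 0 (x + rankOneLift v w) =
      rankOneLift v (rankOneField γ (v ⬝ᵥ x.mq) w) := by
  obtain ⟨m, p, X, Y, Z⟩ := x
  obtain ⟨s, r, a, b, c⟩ := w
  obtain ⟨hX, -⟩ : X.IsSymm ∧ Y.IsSymm := hx
  simp only [MomentState.mq, MomentState.mp, MomentState.Cq, MomentState.Cp,
    MomentState.Cqp] at hXX hXm hp hY hZ hXv ⊢
  subst hp hY hZ
  -- As `v` is a unit vector in the kernel of the projection, `v vᵀ` is a projection orthogonal to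
  -- it; the mixed products vanish and the system closes.
  have hYv : Y * Matrix.vecMulVec v v = 0 := by simp [Matrix.mul_vecMulVec, hXv]
  have hvY : Matrix.vecMulVec v v * Y = 0 := by
    rw [Matrix.vecMulVec_mul, ← Matrix.mulVec_transpose, hX.eq, hXv, Matrix.vecMulVec_zero]
  have hvv : Matrix.vecMulVec v v * Matrix.vecMulVec v v = Matrix.vecMulVec v v := by
    rw [Matrix.vecMulVec_mul_vecMulVec, hv, one_smul]
  refine Prod.ext ?_ (Prod.ext ?_ (Prod.ext ?_ (Prod.ext ?_ ?_)))
  · simp [momentField, rankOneLift_apply, rankOneField]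
  · simp [momentField, rankOneLift_apply, rankOneField, Matrix.add_mulVec, Matrix.mulVec_add,
      Matrix.smul_mulVec, Matrix.mulVec_smul, Matrix.vecMulVec_mulVec, hXm, hXv, hv]
    module
  · simp [momentField, rankOneLift_apply, rankOneField, Matrix.transpose_vecMulVec, two_mul,
      add_smul]
  · simp [momentField, rankOneLift_apply, rankOneField, Matrix.transpose_vecMulVec, Matrix.add_mul,
      hYv, hvv]
    module
  · simp [momentField, rankOneLift_apply, rankOneField, Matrix.add_mul, Matrix.mul_add,
      hYv, hvY, hvv, hXX]
    module

/-- Normalizing `a = 2` forces `c = l` and `b = l (l + γ)`, and the cubic for `l` is the remaining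
equation. The components of the means solve `r = l s` and `(l + γ) r = -2ν`. The field is quadratic,
so the remainder is exactly `t ^ 2 • Q`. -/
lemma rankOne_eigenvector (hγ : 0 < γ) (ν : ℝ) :
    ∃ (l : ℝ) (w Q : ℝ × ℝ × ℝ × ℝ × ℝ), 0 < l ∧ w ≠ 0 ∧
      ∀ t : ℝ, rankOneField γ ν (t • w) = t • (l • w) + t ^ 2 • Q := by
  obtain ⟨l, hl, hleq⟩ := exists_growth_rate hγ
  refine ⟨l, (-(2 * ν) / (l * (l + γ)), -(2 * ν) / (l + γ), 2, l * (l + γ), l),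
    (0, -(2 * (-(2 * ν) / (l * (l + γ)))), 0, -(4 * l), -4), hl, by simp, fun t => ?_⟩
  have h1 : l + γ ≠ 0 := by positivity
  refine Prod.ext ?_ (Prod.ext ?_ (Prod.ext ?_ (Prod.ext ?_ ?_)))
  · change t * (-(2 * ν) / (l + γ)) = t * (l * (-(2 * ν) / (l * (l + γ)))) + t ^ 2 * 0
    field_simp
    ring
  · simp [rankOneField]
    field_simp
    ring
  · simp [rankOneField]
    ring
  · simp [rankOneField]
    linear_combination (-t) * hleq
  · simp [rankOneField]
    ring

end Instability

end EnsembleLangevin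

namespace EnsembleLangevin

/-! ### Transfer of the rank-one instability to the degenerate steady states -/

section DegenerateStates

section Abstract

variable {E E' : Type*} [NormedAddCommGroup E] [NormedSpace ℝ E] [NormedAddCommGroup E']
  [NormedSpace ℝ E']

lemma isLinearlyUnstableAt_of_quadratic {F : E → E} {S : Submodule ℝ E} {x h Q : E} {l : ℝ}
    (hF : Differentiable ℝ F) (hq : ∀ t : ℝ, F (x + t • h) = F x + t • (l • h) + t ^ 2 • Q)
    (hS : h ∈ S) (hh : h ≠ 0) (hl : 0 < l) : IsLinearlyUnstableAt F S x :=
  ⟨(l : ℂ), ⟨h, hS, 0, S.zero_mem, Or.inl hh,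
    by simpa using fderiv_apply_of_quadratic (hF x) hq, by simp⟩, by simpa using hl⟩

/-- A state is not Lyapunov stable if an unstable system is embedded in its neighborhood. -/
lemma not_isLyapunovStableAt_of_embedding [FiniteDimensional ℝ E'] {F : E → E} {f : E' → E'}
    (T : E' →L[ℝ] E) (hT : Function.Injective T) {x : E} (hTF : ∀ w, F (x + T w) = T (f w))
    (hf : ContDiff ℝ 1 f) {D : Set E} {A : Set E'} (hA : ∀ δ > 0, ∃ w ∈ A, ‖w‖ < δ)
    (hAD : ∀ w ∈ A, x + T w ∈ D) {ε : ℝ} (hε : 0 < ε)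
    (hesc : ∀ w : ℝ → E', w 0 ∈ A → IsIntegralCurveOn w (fun _ => f) (Ici 0) →
      ¬ ∀ t ≥ 0, ‖w t‖ < ε) : ¬ IsLyapunovStableAt F D x := by
  intro hstab
  -- An injective linear map on a finite-dimensional space is bounded below, so leaving the `ε`-ball
  -- downstairs means leaving the `ε / K`-ball upstairs.
  obtain ⟨K, hK, hKT⟩ := (T : E' →ₗ[ℝ] E).exists_antilipschitzWith (LinearMap.ker_eq_bot.2 hT)
  have hK' : (0 : ℝ) < K := hK
  have hlow : ∀ w, ‖w‖ ≤ K * ‖T w‖ := fun w => by simpa using hKT.le_mul_dist w 0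
  obtain ⟨δ, hδ, hst⟩ := hstab (ε / K) (by positivity)
  obtain ⟨w₀, hw₀A, hw₀⟩ := hA (min ε (δ / (‖T‖ + 1))) (by positivity)
  -- Global existence is not assumed: a solution either reaches the sphere, which violates
  -- stability, or stays in the ball for all times, which `hesc` excludes.
  rcases escape_or_global hf (x := 0) (x₀ := w₀) (ε := ε)
    (by simpa using hw₀.trans_le (min_le_left _ _)) with ⟨τ, w, hτ, hw, hw0, hwτ⟩ | ⟨w, hw0, hw, hb⟩
  · have hcurve : IsIntegralCurveOn (fun t => x + T (w t)) (fun _ => F) (Icc 0 τ) :=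
      curve_map_affine T (fun y => (hTF y).symm) hw
    have hnear : ‖x + T (w 0) - x‖ < δ := by
      rw [add_sub_cancel_left, hw0]
      have h1 : ‖w₀‖ < δ / (‖T‖ + 1) := hw₀.trans_le (min_le_right _ _)
      rw [lt_div_iff₀ (by positivity)] at h1
      have h2 := T.le_opNorm w₀
      nlinarith [norm_nonneg w₀]
    have := hst τ _ hcurve (by simpa only [hw0] using hAD w₀ hw₀A) hnear τ ⟨hτ, le_rfl⟩
    rw [add_sub_cancel_left, lt_div_iff₀ hK'] at this
    have h1 := hlow (w τ)
    rw [sub_zero] at hwτ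
    rw [hwτ] at h1
    linarith
  · exact hesc w (by rwa [hw0]) hw (by simpa using hb)

end Abstract

variable {N : ℕ} {γ : ℝ} {B : Matrix (Fin N) (Fin N) ℝ} {c : Fin N → ℝ}

attribute [local simp] MomentState.mq MomentState.mp MomentState.Cq MomentState.Cp MomentState.Cqp

/-- The range of `1 - X` lies in the kernel of `X` and is nontrivial; a vector in it is normalized
in the Euclidean sense. -/
lemma exists_unit_mem_ker {X : Matrix (Fin N) (Fin N) ℝ} (hX : X * X = X) (hX1 : X ≠ 1) :
    ∃ v, X *ᵥ v = 0 ∧ v ⬝ᵥ v = 1 := by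
  obtain ⟨u, hu⟩ : ∃ u, (1 - X) *ᵥ u ≠ 0 := by
    by_contra! h
    apply hX1
    have : (1 - X) = 0 := Matrix.mulVec_injective (funext fun u => by simpa using h u)
    exact (sub_eq_zero.1 this).symm
  set w := (1 - X) *ᵥ u
  have hw : X *ᵥ w = 0 := by simp [w, Matrix.mulVec_mulVec, Matrix.mul_sub, hX]
  have hpos : 0 < w ⬝ᵥ w := by
    have h1 : 0 ≤ w ⬝ᵥ w := Finset.sum_nonneg fun i _ => mul_self_nonneg _
    exact lt_of_le_of_ne h1 fun h => hu (dotProduct_self_eq_zero.1 h.symm)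
  refine ⟨(Real.sqrt (w ⬝ᵥ w))⁻¹ • w, by rw [Matrix.mulVec_smul, hw, smul_zero], ?_⟩
  rw [smul_dotProduct, dotProduct_smul, smul_smul, smul_eq_mul, ← mul_inv,
    Real.mul_self_sqrt hpos.le, inv_mul_cancel₀ hpos.ne']

lemma posSemidef_projection {X : Matrix (Fin N) (Fin N) ℝ} (hX : X * X = X) (hXs : X.IsSymm) :
    X.PosSemidef := by
  have := Matrix.posSemidef_conjTranspose_mul_self X
  rwa [Matrix.conjTranspose_eq_transpose_of_trivial, hXs.eq, hX] at this

lemma posSemidef_sqrt_conj {M : Matrix (Fin N) (Fin N) ℝ} (hM : M.PosSemidef) :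
    (CFC.sqrt B * M * CFC.sqrt B).PosSemidef := by
  have := hM.conjTranspose_mul_mul_same (CFC.sqrt B)
  rwa [Matrix.conjTranspose_eq_transpose_of_trivial, isSymm_sqrt] at this

/-- A unit vector `v` in the kernel of the normalized projection carries an embedded copy of the
rank-one system, whose unstable eigenvector and escaping trajectories are transported to the state.
Adding `η v vᵀ` with `η > 0` to both diagonal blocks, in normalized coordinates, keeps the
covariance positive semidefinite, so the escape starts from admissible states. -/
theorem degenerate_steady_states (hγ : 0 < γ) (hB : B.PosDef) {x : MomentState N}
    (hx : x ∈ symmetricStates N) (h0 : momentField γ B c x = 0) (hne : x ≠ equilibrium B c) :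
    x ∈ covarianceStates N ∧ x.cov.det = 0 ∧
      IsLinearlyUnstableAt (momentField γ B c) (symmetricStates N) x ∧
      ¬ IsLyapunovStableAt (momentField γ B c) (covarianceStates N) x := by
  obtain ⟨X, m, hX, hXs, hX1, hm, hxeq⟩ := (steady_degenerate_iff hγ hB hx hne).1 h0
  obtain ⟨v, hXv, hv⟩ := exists_unit_mem_ker hX hX1
  have hv0 : v ≠ 0 := by
    rintro rfl
    simp at hv
  obtain ⟨n1, n2, n3, n4, n5⟩ :=
    (normalized_steady_iff hγ (normalizedCoords_mem_symmetricStates hB hx)).1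
      ((momentField_eq_zero_iff hB x).1 h0)
  have hCq : (normalizedCoords B c x).Cq = X := by
    rw [hxeq]
    exact conj_mul_sqrt hB X
  have hcov : x.cov = Matrix.fromBlocks (CFC.sqrt B * X * CFC.sqrt B) 0
      (0 : Matrix (Fin N) (Fin N) ℝ)ᵀ (CFC.sqrt B * X * CFC.sqrt B) := by rw [hxeq]; rfl
  let T : NormedMap (ℝ × ℝ × ℝ × ℝ × ℝ) (MomentState N) :=
    (transport (CFC.sqrt B)).comp (rankOneLift v)
  have hTinj : Function.Injective T := by
    refine Function.Injective.comp (g := transport (CFC.sqrt B)) (fun y z h => ?_)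
      (rankOneLift_injective hv0)
    rw [← transport_inv_sqrt hB y, h, transport_inv_sqrt hB]
  set ν := v ⬝ᵥ (normalizedCoords B c x).mq
  have hTF : ∀ w, momentField γ B c (x + T w) = T (rankOneField γ ν w) := fun w => by
    change momentField γ B c (x + transport (CFC.sqrt B) (rankOneLift v w)) =
      transport (CFC.sqrt B) (rankOneLift v (rankOneField γ ν w))
    rw [momentField_eq_transport hB, normalizedCoords_add hB, transport_inv_sqrt hB,
      momentField_add_rankOneLift (normalizedCoords_mem_symmetricStates hB hx) n1 n2 n3 n4 n5
        (by rw [hCq, hXv]) hv]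
  refine ⟨?_, ?_, ?_, ?_⟩
  · change x.cov.PosSemidef
    rw [hcov]
    exact posSemidef_block_diag (posSemidef_sqrt_conj (posSemidef_projection hX hXs))
  · have hdet : X.det = 0 := Matrix.exists_mulVec_eq_zero_iff.1 ⟨v, hv0, hXv⟩
    rw [hcov, Matrix.transpose_zero, Matrix.det_fromBlocks_zero₂₁]
    simp [hdet]
  · obtain ⟨l, w, Q, hl, hw, hwQ⟩ := rankOne_eigenvector hγ ν
    refine isLinearlyUnstableAt_of_quadratic (h := T w) (Q := T Q) (l := l)
      (differentiable_momentField γ B c) (fun t => ?_)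
      (transport_mem_symmetricStates _ (rankOneLift_mem_symmetricStates v w))
      (by rwa [ne_eq, map_eq_zero_iff _ hTinj]) hl
    rw [← map_smul, hTF, hwQ, h0, zero_add, map_add, map_smul, map_smul, map_smul]
  · obtain ⟨ε, hε, hesc⟩ := rankOne_not_bounded hγ ν
    refine not_isLyapunovStableAt_of_embedding T hTinj hTF (contDiff_rankOneField γ ν)
      (A := {w | ∃ η > 0, w = (0, 0, η, η, 0)}) (fun δ hδ => ?_) ?_ hε
      (fun w hw hcurve => ?_)
    · exact ⟨_, ⟨δ / 2, by positivity, rfl⟩, by simp [abs_of_pos hδ, hδ]⟩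
    · rintro _ ⟨η, hη, rfl⟩
      have hM : (CFC.sqrt B * (X + η • Matrix.vecMulVec v v) * CFC.sqrt B).PosSemidef := by
        refine posSemidef_sqrt_conj ((posSemidef_projection hX hXs).add ?_)
        have := Matrix.posSemidef_vecMulVec_self_star v
        exact this.smul hη.le
      have : (x + T (0, 0, η, η, 0)).cov = Matrix.fromBlocks
          (CFC.sqrt B * (X + η • Matrix.vecMulVec v v) * CFC.sqrt B) 0
          (0 : Matrix (Fin N) (Fin N) ℝ)ᵀ
          (CFC.sqrt B * (X + η • Matrix.vecMulVec v v) * CFC.sqrt B) := by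
        have hT : T (0, 0, η, η, 0) = transport (CFC.sqrt B) (rankOneLift v (0, 0, η, η, 0)) := rfl
        rw [hT, hxeq]
        simp [MomentState.cov, transport_apply, rankOneLift_apply, isSymm_sqrt, Matrix.mul_add,
          Matrix.add_mul]
      change (x + T (0, 0, η, η, 0)).cov.PosSemidef
      rw [this]
      exact posSemidef_block_diag hM
    · obtain ⟨η, hη, hw0⟩ := hw
      exact hesc w η hη hw0 hcurve

end DegenerateStates

end EnsembleLangevin

namespace EnsembleLangevin

/-! ### Stability and basin of attraction of the nondegenerate equilibrium -/

section Convergence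

variable {N : ℕ} {γ : ℝ} {B : Matrix (Fin N) (Fin N) ℝ} {c : Fin N → ℝ}

theorem isLinearlyStableAt_equilibrium (hγ : 0 < γ) (hB : B.PosDef) :
    IsLinearlyStableAt (momentField γ B c) (symmetricStates N) (equilibrium B c) := by
  intro z hz
  obtain ⟨u, hu, v, hv, hne, h1, h2⟩ := isComplexEigenvalueOn_normalized hB rfl rfl
    (normalizedCoords_equilibrium hB).symm hz
  exact normalized_eigenvalue_neg hγ (fderiv_momentField_equilibrium γ) hu hv hne h1 h2

lemma tendsto_normalizedCoords (hB : B.PosDef) {z : ℝ → MomentState N}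
    (hz : Tendsto z atTop (𝓝 (equilibrium B c))) :
    Tendsto (fun t => normalizedCoords B c (z t)) atTop (𝓝 (normalizedEquilibrium N)) := by
  have h := ((continuous_normalizedCoords (c := c) hB).tendsto _).comp hz
  rwa [normalizedCoords_equilibrium hB] at h

lemma equilibrium_eq_transport (hB : B.PosDef) :
    equilibrium B c = (B *ᵥ c, 0, 0, 0, 0) + transport (CFC.sqrt B) (normalizedEquilibrium N) := by
  conv_lhs => rw [eq_transport_normalizedCoords hB (c := c) (equilibrium B c)]
  rw [normalizedCoords_equilibrium hB]
  rfl

theorem exists_isOpen_basin_equilibrium (hγ : 0 < γ) (hB : B.PosDef) :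
    ∃ U : Set (MomentState N), IsOpen U ∧
      basin (momentField γ B c) (nondegenerateStates N) (equilibrium B c) =
        U ∩ nondegenerateStates N := by
  obtain ⟨U, hU, hUb⟩ := exists_open_basin_normalized (N := N) hγ
  refine ⟨normalizedCoords B c ⁻¹' U, hU.preimage (continuous_normalizedCoords hB), ?_⟩
  ext x
  constructor
  · rintro ⟨hx, z, hz0, hz, hlim⟩
    refine ⟨(hUb _ (normalizedCoords_mem_symmetricStates hB
      (symmetric_of_nondegenerateStates hx))).2 ⟨fun t => normalizedCoords B c (z t), ?_,
        curve_normalizedCoords hB hz, tendsto_normalizedCoords hB hlim⟩, hx⟩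
    simp only [hz0]
  · rintro ⟨hxU, hx⟩
    obtain ⟨w, hw0, hw, hlim⟩ := (hUb _ (normalizedCoords_mem_symmetricStates hB
      (symmetric_of_nondegenerateStates hx))).1 hxU
    refine ⟨hx, _, ?_, curve_of_normalized hB hw, ?_⟩
    · simp only [hw0]
      exact (eq_transport_normalizedCoords hB x).symm
    · rw [equilibrium_eq_transport hB]
      exact (((transport (CFC.sqrt B)).continuous.tendsto _).comp hlim).const_add _

lemma equilibrium_mem_basin (hB : B.PosDef) :
    equilibrium B c ∈ basin (momentField γ B c) (nondegenerateStates N) (equilibrium B c) := by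
  refine ⟨equilibrium_mem_nondegenerateStates hB, fun _ => equilibrium B c, rfl, fun t _ => ?_,
    tendsto_const_nhds⟩
  have h : momentField γ B c (equilibrium B c) = 0 := by
    rw [momentField_eq_zero_iff hB, normalizedCoords_equilibrium hB]
    exact momentField_normalizedEquilibrium γ
  simp only [h]
  exact hasDerivWithinAt_const _ _ _

/-- The prefactor may depend on the initial value alone because the normalized trajectory does. If
no convergent trajectory starts at `y`, the claim is empty. -/
lemma exists_prefactor (hγ : 0 < γ) (y : MomentState N) :
    ∃ K : ℝ, ∀ w : ℝ → MomentState N, IsIntegralCurveOn w (fun _ => momentField γ 1 0) (Ici 0) →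
      w 0 = y → y ∈ symmetricStates N → Tendsto w atTop (𝓝 (normalizedEquilibrium N)) →
      ∀ t ≥ 0, ‖w t - normalizedEquilibrium N‖ ≤ K * Real.exp (-(decayRate γ / 4) * t) := by
  by_cases h : ∃ w : ℝ → MomentState N, IsIntegralCurveOn w (fun _ => momentField γ 1 0) (Ici 0) ∧
      w 0 = y ∧ y ∈ symmetricStates N ∧ Tendsto w atTop (𝓝 (normalizedEquilibrium N))
  · obtain ⟨w, hw, hw0, hy, hlim⟩ := h
    obtain ⟨K, hK⟩ := exponential_convergence_normalized hγ hw (by rwa [hw0]) hlim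
    refine ⟨K, fun w' hw' hw0' _ _ t ht => ?_⟩
    rw [curve_unique (contDiff_momentField γ 1 0) hw' hw (hw0'.trans hw0.symm) t ht]
    exact hK t ht
  · exact ⟨0, fun w hw hw0 hy hlim => (h ⟨w, hw, hw0, hy, hlim⟩).elim⟩

/-- In normalized coordinates all problems share one equation, which gives a common rate and
prefactor and the coincidence of trajectories. Only the return to the original coordinates costs the
operator norm of `transport (CFC.sqrt P.B)`, and it enters `K'` but not the rate. -/
theorem exists_uniform_rate (hγ : 0 < γ) : ∃ κ : ℝ, 0 < κ ∧ ∀ N : ℕ,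
      (∃ K : MomentState N → ℝ, ∀ (J : ℕ) (P : LinearInverseProblem N J)
        (z : ℝ → MomentState N),
        IsIntegralCurveOn z (fun _ => momentField γ P.B P.c) (Ici 0) →
        z 0 ∈ basin (momentField γ P.B P.c) (nondegenerateStates N) (equilibrium P.B P.c) →
        (∀ t ≥ 0, ‖normalizedCoords P.B P.c (z t) - (0, 0, 1, 1, 0)‖ ≤
          K (normalizedCoords P.B P.c (z 0)) * Real.exp (-κ * t)) ∧
        (∃ K' : ℝ, ∀ t ≥ 0, ‖z t - equilibrium P.B P.c‖ ≤ K' * Real.exp (-κ * t))) ∧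
      (∀ (J J' : ℕ) (P : LinearInverseProblem N J) (P' : LinearInverseProblem N J')
        (z z' : ℝ → MomentState N),
        IsIntegralCurveOn z (fun _ => momentField γ P.B P.c) (Ici 0) →
        IsIntegralCurveOn z' (fun _ => momentField γ P'.B P'.c) (Ici 0) →
        normalizedCoords P.B P.c (z 0) = normalizedCoords P'.B P'.c (z' 0) →
        ∀ t ≥ 0, normalizedCoords P.B P.c (z t) = normalizedCoords P'.B P'.c (z' t)) := by
  refine ⟨decayRate γ / 4, by have := decayRate_pos hγ; positivity, fun N => ⟨?_, ?_⟩⟩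
  · choose K hK using exists_prefactor (N := N) hγ
    refine ⟨K, fun J P z hz hbasin => ?_⟩
    have hB := P.posDef_B
    obtain ⟨hnd, z', hz0', hz', hlim'⟩ := hbasin
    -- The basin provides some convergent solution from the same point; uniqueness identifies it
    -- with `z`.
    have hlim : Tendsto z atTop (𝓝 (equilibrium P.B P.c)) := by
      refine hlim'.congr' ?_
      filter_upwards [eventually_ge_atTop 0] with t ht
      exact curve_unique (contDiff_momentField γ P.B P.c) hz' hz hz0' t ht
    have hbound := hK _ _ (curve_normalizedCoords hB hz) rfl
      (normalizedCoords_mem_symmetricStates hB (symmetric_of_nondegenerateStates hnd))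
      (tendsto_normalizedCoords hB hlim)
    refine ⟨hbound, ‖transport (CFC.sqrt P.B)‖ * K (normalizedCoords P.B P.c (z 0)),
      fun t ht => ?_⟩
    have h1 : z t - equilibrium P.B P.c = transport (CFC.sqrt P.B)
        (normalizedCoords P.B P.c (z t) - normalizedEquilibrium N) := by
      rw [map_sub, equilibrium_eq_transport hB]
      nth_rw 1 [eq_transport_normalizedCoords hB (c := P.c) (z t)]
      abel
    rw [h1, mul_assoc]
    exact ((transport (CFC.sqrt P.B)).le_opNorm _).trans
      (mul_le_mul_of_nonneg_left (hbound t ht) (norm_nonneg _))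
  · intro J J' P P' z z' hz hz' h0
    exact curve_unique (contDiff_momentField γ 1 0) (curve_normalizedCoords P.posDef_B hz)
      (curve_normalizedCoords P'.posDef_B hz') h0

end Convergence

end EnsembleLangevin
namespace EnsembleLangevin

/-! ### Normalized densities under shifts, changes of variables and products -/

section NormalizedDensity

variable {E F : Type*} [MeasureSpace E] [MeasureSpace F]

theorem normalizedExpNeg_of_isProbabilityMeasure (V : E → ℝ)
    [h : IsProbabilityMeasure
      (volume.withDensity fun x => ENNReal.ofReal (Real.exp (-V x)))] :
    normalizedExpNeg V = volume.withDensity fun x => ENNReal.ofReal (Real.exp (-V x)) := by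
  have h1 := h.measure_univ
  rw [withDensity_apply _ MeasurableSet.univ, Measure.restrict_univ] at h1
  rw [normalizedExpNeg, h1, inv_one, one_smul]

/-- The positive finite factor `exp (-a)` cancels against the normalization, even if the total mass
is zero or infinite. Hence normalizing constants never need to be computed. -/
theorem normalizedExpNeg_add_const (V : E → ℝ) (a : ℝ) :
    normalizedExpNeg (fun x => V x + a) = normalizedExpNeg V := by
  have h0 : ENNReal.ofReal (Real.exp (-a)) ≠ 0 := by simp [Real.exp_pos]
  have hV : (fun x => ENNReal.ofReal (Real.exp (-(V x + a)))) =
      ENNReal.ofReal (Real.exp (-a)) • fun x => ENNReal.ofReal (Real.exp (-V x)) := by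
    ext x
    rw [Pi.smul_apply, smul_eq_mul, ← ENNReal.ofReal_mul (Real.exp_pos _).le, ← Real.exp_add,
      neg_add_rev]
  have hI : ∫⁻ x, ENNReal.ofReal (Real.exp (-(V x + a))) =
      ENNReal.ofReal (Real.exp (-a)) * ∫⁻ x, ENNReal.ofReal (Real.exp (-V x)) := by
    rw [hV, ← lintegral_const_mul' _ _ ENNReal.ofReal_ne_top]
    rfl
  rw [normalizedExpNeg, normalizedExpNeg, hI, hV, withDensity_smul' _ _ ENNReal.ofReal_ne_top,
    ENNReal.mul_inv (Or.inl h0) (Or.inl ENNReal.ofReal_ne_top), smul_smul, mul_right_comm,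
    ENNReal.inv_mul_cancel h0 ENNReal.ofReal_ne_top, one_mul]

/-- The constant Jacobian `k` cancels in the same way. -/
theorem map_normalizedExpNeg_comp (e : E ≃ᵐ F) {k : ℝ≥0∞} (hk : k ≠ 0) (hk' : k ≠ ∞)
    (he : (volume : Measure E).map e = k • volume) (V : F → ℝ) :
    (normalizedExpNeg fun x => V (e x)).map e = normalizedExpNeg V := by
  have hI : ∫⁻ x, ENNReal.ofReal (Real.exp (-V (e x))) =
      k * ∫⁻ x, ENNReal.ofReal (Real.exp (-V x)) := by
    rw [← lintegral_map_equiv (fun x => ENNReal.ofReal (Real.exp (-V x))) e, he,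
      lintegral_smul_measure, smul_eq_mul]
  ext s hs
  rw [e.map_apply, normalizedExpNeg, normalizedExpNeg, Measure.smul_apply, Measure.smul_apply,
    withDensity_apply _ (e.measurable hs), withDensity_apply _ hs, hI,
    ← lintegral_map_equiv (fun x => ENNReal.ofReal (Real.exp (-V x))) e,
    ← e.restrict_map, he, Measure.restrict_smul, lintegral_smul_measure,
    ENNReal.mul_inv (Or.inl hk) (Or.inl hk')]
  simp only [smul_eq_mul]
  rw [mul_comm k⁻¹, mul_assoc, ← mul_assoc k⁻¹, ENNReal.inv_mul_cancel hk hk', one_mul]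

theorem normalizedExpNeg_add_prod [SFinite (volume : Measure E)] [SFinite (volume : Measure F)]
    {V : E → ℝ} {U : F → ℝ} (hV : Measurable V) (hU : Measurable U)
    [IsProbabilityMeasure (volume.withDensity fun x => ENNReal.ofReal (Real.exp (-V x)))]
    [IsProbabilityMeasure (volume.withDensity fun x => ENNReal.ofReal (Real.exp (-U x)))] :
    normalizedExpNeg (fun z : E × F => V z.1 + U z.2) =
      (normalizedExpNeg V).prod (normalizedExpNeg U) := by
  have h : (volume : Measure (E × F)).withDensity
        (fun z => ENNReal.ofReal (Real.exp (-(V z.1 + U z.2)))) =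
      (volume.withDensity fun x => ENNReal.ofReal (Real.exp (-V x))).prod
        (volume.withDensity fun x => ENNReal.ofReal (Real.exp (-U x))) := by
    rw [prod_withDensity (by fun_prop) (by fun_prop)]
    congr 1
    ext z
    rw [← ENNReal.ofReal_mul (Real.exp_pos _).le, ← Real.exp_add, neg_add]
  have : IsProbabilityMeasure ((volume : Measure (E × F)).withDensity
      (fun z => ENNReal.ofReal (Real.exp (-(V z.1 + U z.2))))) := by
    rw [h]; infer_instance
  rw [normalizedExpNeg_of_isProbabilityMeasure, normalizedExpNeg_of_isProbabilityMeasure V,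
    normalizedExpNeg_of_isProbabilityMeasure U, h]

end NormalizedDensity

theorem pi_withDensity_ofReal {ι : Type*} [Fintype ι] {f : ℝ → ℝ} (hf : Integrable f)
    (hf0 : ∀ x, 0 ≤ f x)
    [IsProbabilityMeasure ((volume : Measure ℝ).withDensity fun x => ENNReal.ofReal (f x))] :
    Measure.pi (fun _ : ι => (volume : Measure ℝ).withDensity fun x => ENNReal.ofReal (f x)) =
      (volume : Measure (ι → ℝ)).withDensity fun x => ENNReal.ofReal (∏ i, f (x i)) := by
  refine Measure.pi_eq fun s hs => ?_
  rw [withDensity_apply _ (MeasurableSet.univ_pi hs), volume_pi, Measure.restrict_pi_pi,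
    ← ofReal_integral_eq_lintegral_ofReal, integral_fintype_prod_eq_prod,
    ENNReal.ofReal_prod_of_nonneg]
  · refine Finset.prod_congr rfl fun i _ => ?_
    rw [withDensity_apply _ (hs i), ofReal_integral_eq_lintegral_ofReal hf.integrableOn
      (Eventually.of_forall hf0)]
  · exact fun i _ => integral_nonneg hf0
  · exact Integrable.fintype_prod (fun i => hf.integrableOn)
  · exact Eventually.of_forall fun x => Finset.prod_nonneg fun i _ => hf0 _

/-! ### The standard Gaussian measure on `ℝ^N` -/

section StandardGaussian

variable (N : ℕ)

/-- The standard Gaussian measure on `ℝ^N`. -/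
noncomputable abbrev stdGaussianPi : Measure (Fin N → ℝ) := Measure.pi fun _ => gaussianReal 0 1

/-- The potential of the standard Gaussian measure, normalized to total mass one. -/
noncomputable abbrev stdPotential (x : Fin N → ℝ) : ℝ :=
  1 / 2 * (x ⬝ᵥ x) + N * Real.log (√(2 * Real.pi))

theorem withDensity_stdPotential :
    volume.withDensity (fun x => ENNReal.ofReal (Real.exp (-stdPotential N x))) =
      stdGaussianPi N := by
  have h1 : gaussianReal 0 1 =
      volume.withDensity fun x => ENNReal.ofReal (gaussianPDFReal 0 1 x) := by
    rw [gaussianReal_of_var_ne_zero _ one_ne_zero]; rfl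
  have : IsProbabilityMeasure
      (volume.withDensity fun x => ENNReal.ofReal (gaussianPDFReal 0 1 x)) := by
    rw [← h1]; infer_instance
  rw [stdGaussianPi, h1, pi_withDensity_ofReal (integrable_gaussianPDFReal 0 1)
    (gaussianPDFReal_nonneg 0 1)]
  congr 1
  ext x
  congr 1
  have hs : (0 : ℝ) < √(2 * Real.pi) := by positivity
  have h2 : ∀ y : ℝ, gaussianPDFReal 0 1 y =
      Real.exp (-(1 / 2 * (y * y) + Real.log (√(2 * Real.pi)))) := by
    intro y
    rw [gaussianPDFReal, neg_add, Real.exp_add, ← Real.log_inv, Real.exp_log (by positivity),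
      mul_comm]
    congr 2
    · simp; ring
    · simp
  simp_rw [h2]
  rw [← Real.exp_sum, stdPotential, dotProduct, Finset.sum_neg_distrib, Finset.sum_add_distrib,
    Finset.mul_sum]
  simp

instance : IsProbabilityMeasure
    (volume.withDensity (fun x => ENNReal.ofReal (Real.exp (-stdPotential N x)))) := by
  rw [withDensity_stdPotential]; infer_instance

theorem normalizedExpNeg_stdPotential :
    normalizedExpNeg (stdPotential N) = stdGaussianPi N := by
  rw [normalizedExpNeg_of_isProbabilityMeasure, withDensity_stdPotential]

theorem normalizedExpNeg_stdPotential_prod :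
    normalizedExpNeg (fun z : (Fin N → ℝ) × (Fin N → ℝ) =>
      stdPotential N z.1 + stdPotential N z.2) = (stdGaussianPi N).prod (stdGaussianPi N) := by
  have hm : Measurable (stdPotential N) := by
    unfold stdPotential dotProduct
    fun_prop
  rw [normalizedExpNeg_add_prod hm hm, normalizedExpNeg_stdPotential]

instance : IsGaussian (stdGaussianPi N) := by
  have h : stdGaussianPi N = (stdGaussian (EuclideanSpace ℝ (Fin N))).map
      (EuclideanSpace.equiv (Fin N) ℝ) := by
    rw [← map_pi_eq_stdGaussian, Measure.map_map (by fun_prop) (by fun_prop)]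
    exact Measure.map_id.symm
  rw [h]; infer_instance

variable {N}

theorem memLp_eval_stdGaussianPi (i : Fin N) :
    MemLp (fun x : Fin N → ℝ => x i) 2 (stdGaussianPi N) :=
  (IsGaussian.memLp_two_id (μ := gaussianReal 0 1)).comp_measurePreserving
    (measurePreserving_eval (fun _ : Fin N => gaussianReal 0 1) i)

theorem integral_eval_stdGaussianPi (i : Fin N) : ∫ x, x i ∂stdGaussianPi N = 0 :=
  (integral_comp_eval (μ := fun _ : Fin N => gaussianReal 0 1) (i := i)
    (f := id) aestronglyMeasurable_id).trans integral_id_gaussianReal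

theorem covariance_eval_stdGaussianPi (i j : Fin N) :
    cov[fun x => x i, fun x => x j; stdGaussianPi N] = (1 : Matrix (Fin N) (Fin N) ℝ) i j := by
  rcases eq_or_ne i j with rfl | h
  · rw [Matrix.one_apply_eq, covariance_self (measurable_pi_apply i).aemeasurable]
    have h := variance_map (X := id) (Y := Function.eval i) (μ := stdGaussianPi N)
      aemeasurable_id (measurable_pi_apply i).aemeasurable
    rw [(measurePreserving_eval _ i).map_eq, variance_id_gaussianReal] at h
    exact h.symm.trans NNReal.coe_one
  · rw [Matrix.one_apply_ne h]
    exact ((iIndepFun_pi (μ := fun _ : Fin N => gaussianReal 0 1) (X := fun _ x => x)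
      fun i => aemeasurable_id).indepFun h).covariance_eq_zero
      (memLp_eval_stdGaussianPi i) (memLp_eval_stdGaussianPi j)

end StandardGaussian

/-! ### Affine images of the standard Gaussian measure -/

section Affine

variable {N : ℕ} {S : Matrix (Fin N) (Fin N) ℝ} {b : Fin N → ℝ}

/-- The affine transformation `ξ ↦ b + S ξ` with invertible `S`. -/
noncomputable def affineMeasurableEquiv (hS : IsUnit S.det) (b : Fin N → ℝ) :
    (Fin N → ℝ) ≃ᵐ (Fin N → ℝ) where
  toFun ξ := b + S *ᵥ ξ
  invFun x := S⁻¹ *ᵥ (x - b)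
  left_inv ξ := by simp [Matrix.mulVec_mulVec, Matrix.nonsing_inv_mul S hS]
  right_inv x := by simp [Matrix.mulVec_mulVec, Matrix.mul_nonsing_inv S hS]
  measurable_toFun := by
    have : Continuous fun ξ : Fin N → ℝ => b + S *ᵥ ξ := by fun_prop
    exact this.measurable
  measurable_invFun := by
    have : Continuous fun x : Fin N → ℝ => S⁻¹ *ᵥ (x - b) := by fun_prop
    exact this.measurable

theorem affineMeasurableEquiv_apply (hS : IsUnit S.det) (b ξ : Fin N → ℝ) :
    affineMeasurableEquiv hS b ξ = b + S *ᵥ ξ := rfl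

theorem map_affineMeasurableEquiv_volume (hS : IsUnit S.det) (b : Fin N → ℝ) :
    (volume : Measure (Fin N → ℝ)).map (affineMeasurableEquiv hS b) =
      ENNReal.ofReal |(S.det)⁻¹| • volume := by
  have h : ⇑(affineMeasurableEquiv hS b) = (fun x => b + x) ∘ Matrix.toLin' S := by
    ext ξ : 1
    simp [affineMeasurableEquiv_apply]
  rw [h, ← Measure.map_map (measurable_const_add b) (LinearMap.continuous_on_pi _).measurable,
    Real.map_matrix_volume_pi_eq_smul_volume_pi hS.ne_zero, Measure.map_smul,
    map_add_left_eq_self]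

/-- The law of `b + S ξ` with `ξ` standard Gaussian. -/
noncomputable abbrev affineGaussian (b : Fin N → ℝ) (S : Matrix (Fin N) (Fin N) ℝ) :
    Measure (Fin N → ℝ) :=
  (stdGaussianPi N).map fun ξ => b + S *ᵥ ξ

theorem measurable_const_add_mulVec : Measurable fun ξ : Fin N → ℝ => b + S *ᵥ ξ := by
  have : Continuous fun ξ : Fin N → ℝ => b + S *ᵥ ξ := by fun_prop
  exact this.measurable

theorem ofReal_abs_inv_det_ne_zero (hS : IsUnit S.det) : ENNReal.ofReal |(S.det)⁻¹| ≠ 0 := by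
  have := hS.ne_zero
  simpa using this

/-- A potential that becomes the standard one, up to a constant, after an affine substitution
defines the image Gaussian: both the constant and the Jacobian disappear in the normalization. -/
theorem normalizedExpNeg_eq_affineGaussian (hS : IsUnit S.det) {V : (Fin N → ℝ) → ℝ} {a : ℝ}
    (hV : ∀ ξ, V (b + S *ᵥ ξ) = stdPotential N ξ + a) :
    normalizedExpNeg V = affineGaussian b S := by
  rw [← map_normalizedExpNeg_comp (affineMeasurableEquiv hS b) (ofReal_abs_inv_det_ne_zero hS)
    ENNReal.ofReal_ne_top (map_affineMeasurableEquiv_volume hS b)]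
  simp_rw [affineMeasurableEquiv_apply, hV]
  rw [normalizedExpNeg_add_const, normalizedExpNeg_stdPotential]
  rfl

theorem normalizedExpNeg_eq_prod_affineGaussian (hS : IsUnit S.det) {b' : Fin N → ℝ}
    {V : (Fin N → ℝ) × (Fin N → ℝ) → ℝ} {a : ℝ}
    (hV : ∀ ξ η, V (b + S *ᵥ ξ, b' + S *ᵥ η) = stdPotential N ξ + stdPotential N η + a) :
    normalizedExpNeg V = (affineGaussian b S).prod (affineGaussian b' S) := by
  have h : ⇑((affineMeasurableEquiv hS b).prodCongr (affineMeasurableEquiv hS b')) =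
      Prod.map (fun ξ => b + S *ᵥ ξ) (fun ξ => b' + S *ᵥ ξ) := rfl
  have hk := ofReal_abs_inv_det_ne_zero hS
  have hvol : (volume : Measure ((Fin N → ℝ) × (Fin N → ℝ))).map
      ((affineMeasurableEquiv hS b).prodCongr (affineMeasurableEquiv hS b')) =
      (ENNReal.ofReal |(S.det)⁻¹| * ENNReal.ofReal |(S.det)⁻¹|) • volume := by
    have h1 := map_affineMeasurableEquiv_volume hS b
    have h2 := map_affineMeasurableEquiv_volume hS b'
    rw [Measure.volume_eq_prod, h, ← Measure.map_prod_map _ _ measurable_const_add_mulVec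
      measurable_const_add_mulVec]
    rw [show (fun ξ => b + S *ᵥ ξ) = affineMeasurableEquiv hS b from rfl,
      show (fun ξ => b' + S *ᵥ ξ) = affineMeasurableEquiv hS b' from rfl, h1, h2,
      Measure.prod_smul_left, Measure.prod_smul_right, smul_smul]
  rw [← map_normalizedExpNeg_comp _ (mul_ne_zero hk hk)
    (ENNReal.mul_ne_top ENNReal.ofReal_ne_top ENNReal.ofReal_ne_top) hvol, h]
  simp_rw [Prod.map, hV]
  rw [normalizedExpNeg_add_const, normalizedExpNeg_stdPotential_prod,
    Measure.map_prod_map _ _ measurable_const_add_mulVec measurable_const_add_mulVec]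

instance : IsGaussian (affineGaussian b S) := by
  have h : affineGaussian b S =
      ((stdGaussianPi N).map (LinearMap.toContinuousLinearMap (Matrix.toLin' S))).map
        (fun x => b + x) := by
    rw [Measure.map_map (measurable_const_add b) (by fun_prop)]
    rfl
  rw [h]; infer_instance

theorem memLp_eval_affineGaussian (i : Fin N) :
    MemLp (fun x : Fin N → ℝ => x i) 2 (affineGaussian b S) := by
  have h := IsGaussian.memLp_two_id (μ := affineGaussian b S)
  exact memLp_pi_iff.1 h i

theorem integral_eval_affineGaussian (i : Fin N) : ∫ x, x i ∂affineGaussian b S = b i := by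
  have hi : ∀ j, Integrable (fun ξ : Fin N → ℝ => S i j * ξ j) (stdGaussianPi N) := fun j =>
    ((memLp_eval_stdGaussianPi j).integrable (by norm_num)).const_mul _
  rw [affineGaussian, integral_map measurable_const_add_mulVec.aemeasurable
    (measurable_pi_apply i).aestronglyMeasurable]
  simp only [Pi.add_apply, Matrix.mulVec, dotProduct]
  rw [integral_add (integrable_const _) (integrable_finsetSum _ fun j _ => hi j),
    integral_finsetSum _ fun j _ => hi j]
  simp [integral_const_mul, integral_eval_stdGaussianPi]

theorem covariance_eval_affineGaussian (i j : Fin N) :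
    cov[fun x => x i, fun x => x j; affineGaussian b S] = (S * Sᵀ) i j := by
  have hi : ∀ i j, MemLp (fun ξ : Fin N → ℝ => S i j * ξ j) 2 (stdGaussianPi N) := fun i j =>
    (memLp_eval_stdGaussianPi j).const_mul _
  have hI : ∀ i, Integrable (fun ξ : Fin N → ℝ => ∑ j, S i j * ξ j) (stdGaussianPi N) := fun i =>
    integrable_finsetSum _ fun j _ => (hi i j).integrable (by norm_num)
  rw [affineGaussian, covariance_map_fun (measurable_pi_apply i).aestronglyMeasurable
    (measurable_pi_apply j).aestronglyMeasurable measurable_const_add_mulVec.aemeasurable]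
  simp only [Pi.add_apply, Matrix.mulVec, dotProduct]
  rw [covariance_const_add_left (hI i), covariance_const_add_right (hI j),
    covariance_fun_sum_fun_sum (hi i) (hi j)]
  simp_rw [covariance_const_mul_left, covariance_const_mul_right, covariance_eval_stdGaussianPi,
    Matrix.one_apply]
  simp [Matrix.mul_apply]

theorem moments_prod_affineGaussian (b' : Fin N → ℝ) :
    moments ((affineGaussian b S).prod (affineGaussian b' S)) =
      (b, b', S * Sᵀ, S * Sᵀ, 0) := by
  have hf : ((affineGaussian b S).prod (affineGaussian b' S)).map Prod.fst =
    affineGaussian b S := by simp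
  have hs : ((affineGaussian b S).prod (affineGaussian b' S)).map Prod.snd =
    affineGaussian b' S := by simp
  have hm : ∀ (ν : Measure (Fin N → ℝ)) (i : Fin N), AEStronglyMeasurable (fun x => x i) ν :=
    fun ν i => (measurable_pi_apply i).aestronglyMeasurable
  refine Prod.ext ?_ (Prod.ext ?_ (Prod.ext ?_ (Prod.ext ?_ ?_)))
  · ext i
    refine Eq.trans ?_ (integral_eval_affineGaussian (b := b) (S := S) i)
    exact (integral_map measurable_fst.aemeasurable (hm _ _)).symm.trans (by rw [hf])
  · ext i
    refine Eq.trans ?_ (integral_eval_affineGaussian (b := b') (S := S) i)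
    exact (integral_map measurable_snd.aemeasurable (hm _ _)).symm.trans (by rw [hs])
  · ext i j
    refine Eq.trans ?_ (covariance_eval_affineGaussian (b := b) (S := S) i j)
    exact (covariance_map_fun (hm _ _) (hm _ _) measurable_fst.aemeasurable).symm.trans
      (by rw [hf])
  · ext i j
    refine Eq.trans ?_ (covariance_eval_affineGaussian (b := b') (S := S) i j)
    exact (covariance_map_fun (hm _ _) (hm _ _) measurable_snd.aemeasurable).symm.trans
      (by rw [hs])
  · ext i j
    exact covariance_fst_snd_prod (memLp_eval_affineGaussian i) (memLp_eval_affineGaussian j)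

end Affine

/-! ### The posterior and the Gibbs measure -/

namespace LinearInverseProblem

variable {N J : ℕ} (P : LinearInverseProblem N J)

/-- Completing the square: `B c` is the critical point of the potential, since `B⁻¹ (B c) = Aᵀ Γ⁻¹
y`, and the Hessian is `B⁻¹`. The critical point equation tested against `v` removes the linear
term. -/
theorem potential_equilibrium_add (v : Fin N → ℝ) :
    P.potential (P.B *ᵥ P.c + v) =
      1 / 2 * (v ⬝ᵥ (P.B⁻¹ *ᵥ v)) + P.potential (P.B *ᵥ P.c) := by
  have symm : ∀ {n : ℕ} {G : Matrix (Fin n) (Fin n) ℝ}, Gᵀ = G → ∀ u w : Fin n → ℝ,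
      u ⬝ᵥ (G *ᵥ w) = w ⬝ᵥ (G *ᵥ u) := by
    intro n G hG u w
    rw [Matrix.dotProduct_mulVec, ← Matrix.mulVec_transpose, hG, dotProduct_comm]
  have hG : P.Γ⁻¹ᵀ = P.Γ⁻¹ := by simpa using P.posDef_Γ.inv.isHermitian.eq
  have hG0 : P.Γ₀⁻¹ᵀ = P.Γ₀⁻¹ := by simpa using P.posDef_Γ₀.inv.isHermitian.eq
  have hB : P.B⁻¹ = P.Aᵀ * P.Γ⁻¹ * P.A + P.Γ₀⁻¹ := by
    refine Matrix.nonsing_inv_nonsing_inv _ (Matrix.isUnit_nonsing_inv_det_iff.1 ?_)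
    exact (Matrix.isUnit_iff_isUnit_det _).1 P.posDef_B.isUnit
  have hA : ∀ (u : Fin J → ℝ) (w : Fin N → ℝ), (P.A *ᵥ w) ⬝ᵥ u = w ⬝ᵥ (P.Aᵀ *ᵥ u) := by
    intro u w
    rw [dotProduct_comm, Matrix.dotProduct_mulVec, ← Matrix.mulVec_transpose, dotProduct_comm]
  set b := P.B *ᵥ P.c with hb
  have hc : P.B⁻¹ *ᵥ b = P.Aᵀ *ᵥ (P.Γ⁻¹ *ᵥ P.y) := by
    rw [hb, Matrix.mulVec_mulVec, Matrix.nonsing_inv_mul _ ((Matrix.isUnit_iff_isUnit_det _).1 P.posDef_B.isUnit),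
      Matrix.one_mulVec]
    rfl
  rw [hB] at hc ⊢
  have key := congrArg (fun w => v ⬝ᵥ w) hc
  simp only [Matrix.add_mulVec, ← Matrix.mulVec_mulVec, dotProduct_add] at key ⊢
  rw [← hA, ← hA] at key
  simp only [← hA]
  have e : P.y - P.A *ᵥ (b + v) = (P.y - P.A *ᵥ b) - P.A *ᵥ v := by
    rw [Matrix.mulVec_add]; abel
  rw [potential, potential, e]
  simp only [Matrix.mulVec_sub, Matrix.mulVec_add, sub_dotProduct, dotProduct_sub, add_dotProduct,
    dotProduct_add]
  rw [symm hG (P.A *ᵥ b) (P.A *ᵥ v), symm hG P.y (P.A *ᵥ v), symm hG0 b v]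
  linarith

theorem isUnit_det_sqrt {B : Matrix (Fin N) (Fin N) ℝ} (hB : B.PosDef) :
    IsUnit (CFC.sqrt B).det :=
  (Matrix.isUnit_iff_isUnit_det _).1 (isUnit_sqrt hB)

theorem sqrt_quadratic {B : Matrix (Fin N) (Fin N) ℝ} (hB : B.PosDef) (ξ : Fin N → ℝ) :
    (CFC.sqrt B *ᵥ ξ) ⬝ᵥ (B⁻¹ *ᵥ (CFC.sqrt B *ᵥ ξ)) = ξ ⬝ᵥ ξ := by
  have h : CFC.sqrt B * B⁻¹ * CFC.sqrt B = 1 := by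
    have hd := isUnit_det_sqrt hB
    have h1 : B⁻¹ = (CFC.sqrt B)⁻¹ * (CFC.sqrt B)⁻¹ := by
      rw [← Matrix.mul_inv_rev, sqrt_mul_self hB]
    rw [h1, ← Matrix.mul_assoc, Matrix.mul_nonsing_inv _ hd, Matrix.one_mul,
      Matrix.nonsing_inv_mul _ hd]
  rw [dotProduct_comm, Matrix.dotProduct_mulVec, ← Matrix.mulVec_transpose, isSymm_sqrt B,
    Matrix.mulVec_mulVec, Matrix.mulVec_mulVec, h, Matrix.one_mulVec]

theorem posterior_eq_affineGaussian :
    P.posterior = affineGaussian (P.B *ᵥ P.c) (CFC.sqrt P.B) := by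
  refine normalizedExpNeg_eq_affineGaussian (isUnit_det_sqrt P.posDef_B)
    (a := P.potential (P.B *ᵥ P.c) - N * Real.log (√(2 * Real.pi))) fun ξ => ?_
  rw [potential_equilibrium_add, sqrt_quadratic P.posDef_B, stdPotential]
  ring

theorem gibbs_eq_prod_affineGaussian :
    P.gibbs P.B = (affineGaussian (P.B *ᵥ P.c) (CFC.sqrt P.B)).prod
      (affineGaussian 0 (CFC.sqrt P.B)) := by
  refine normalizedExpNeg_eq_prod_affineGaussian (isUnit_det_sqrt P.posDef_B)
    (a := P.potential (P.B *ᵥ P.c) - 2 * (N * Real.log (√(2 * Real.pi)))) fun ξ η => ?_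
  rw [hamiltonian, potential_equilibrium_add, zero_add, sqrt_quadratic P.posDef_B,
    sqrt_quadratic P.posDef_B, stdPotential, stdPotential]
  ring

theorem gibbs_gaussian :
    IsGaussian (P.gibbs P.B) ∧ moments (P.gibbs P.B) = equilibrium P.B P.c ∧
      (P.gibbs P.B).map Prod.fst = P.posterior ∧ IsGaussian P.posterior := by
  rw [gibbs_eq_prod_affineGaussian, posterior_eq_affineGaussian]
  refine ⟨inferInstance, ?_, by simp, inferInstance⟩
  rw [moments_prod_affineGaussian, equilibrium, isSymm_sqrt P.B, sqrt_mul_self P.posDef_B]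

end LinearInverseProblem

end EnsembleLangevin
namespace EnsembleLangevin

/-! ### Calculus for the passage from noise to moments -/

/-- The difference between `f` and the primitive of `g` has zero right derivative, hence is
constant. This is needed because noise is orthogonal to the past only, so moments are first
differentiated from the right. -/
theorem hasDerivWithinAt_Ici_of_right_deriv {E : Type*} [NormedAddCommGroup E] [NormedSpace ℝ E]
    [CompleteSpace E] {f g : ℝ → E} (hf : Continuous f) (hg : Continuous g)
    (h : ∀ t, 0 ≤ t → HasDerivWithinAt f (g t) (Ici t) t) {t : ℝ} (ht : 0 ≤ t) :
    HasDerivWithinAt f (g t) (Ici 0) t := by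
  have hG : ∀ s, HasDerivAt (fun r => ∫ x in (0 : ℝ)..r, g x) (g s) s := fun s =>
    (hg.integral_hasStrictDerivAt 0 s).hasDerivAt
  have hc : ∀ s ∈ Ici (0 : ℝ), f s = f 0 + ∫ x in (0 : ℝ)..s, g x := by
    intro s hs
    have hs' := constant_of_has_deriv_right_zero
      (f := fun r => f r - ∫ x in (0 : ℝ)..r, g x) (a := 0) (b := s)
      (hf.sub (continuous_iff_continuousAt.2 fun r => (hG r).continuousAt)).continuousOn
      (fun r hr => ((h r hr.1).sub (hG r).hasDerivWithinAt).congr_deriv (sub_self _))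
      s (right_mem_Icc.2 hs)
    simp only [intervalIntegral.integral_same, sub_zero] at hs'
    rw [← hs', sub_add_cancel]
  exact ((hG t).const_add (f 0)).hasDerivWithinAt.congr hc (hc t ht)

/-- The square root accommodates stochastic integrals, whose increments in `L²` have size `√(t -
s)`. -/
theorem continuous_of_norm_sub_le {E : Type*} [NormedAddCommGroup E] {f : ℝ≥0 → E}
    (h : ∀ T : ℝ≥0, ∃ R : ℝ, ∀ s t : ℝ≥0, s ≤ t → t ≤ T →
      ‖f t - f s‖ ≤ R * (((t : ℝ) - s) + √((t : ℝ) - s))) : Continuous f := by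
  refine continuous_iff_continuousAt.2 fun t₀ => ?_
  obtain ⟨R, hR⟩ := h (t₀ + 1)
  refine tendsto_iff_norm_sub_tendsto_zero.2 ?_
  refine squeeze_zero' (g := fun t : ℝ≥0 => R * (|(t : ℝ) - t₀| + √|(t : ℝ) - t₀|))
    (Eventually.of_forall fun _ => norm_nonneg _) ?_ ?_
  · filter_upwards [eventually_lt_nhds (show t₀ < t₀ + 1 by simp)] with t ht
    rcases le_total t₀ t with hle | hle
    · rw [abs_of_nonneg (sub_nonneg.2 (NNReal.coe_le_coe.2 hle))]
      exact hR t₀ t hle ht.le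
    · rw [norm_sub_rev, abs_sub_comm, abs_of_nonneg (sub_nonneg.2 (NNReal.coe_le_coe.2 hle))]
      exact hR t t₀ hle (by simp)
  · have : Continuous fun t : ℝ≥0 => R * (|(t : ℝ) - t₀| + √|(t : ℝ) - t₀|) := by fun_prop
    simpa using this.tendsto t₀

theorem abs_sum_mul_sub_le {u G : ℕ → ℝ} (hu : Monotone u) {g ε : ℝ} (K : ℕ)
    (h : ∀ k < K, u k < u (k + 1) → |G k - g| ≤ ε) :
    |∑ k ∈ Finset.range K, G k * (u (k + 1) - u k) - g * (u K - u 0)| ≤ ε * (u K - u 0) := by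
  rw [← Finset.sum_range_sub u K, Finset.mul_sum, Finset.mul_sum, ← Finset.sum_sub_distrib]
  refine (Finset.abs_sum_le_sum_abs _ _).trans (Finset.sum_le_sum fun k hk => ?_)
  rw [← sub_mul, abs_mul, abs_of_nonneg (sub_nonneg.2 (hu k.le_succ))]
  rcases (hu k.le_succ).eq_or_lt with he | hlt
  · rw [Nat.succ_eq_add_one] at he
    simp [he]
  · exact mul_le_mul_of_nonneg_right (h k (Finset.mem_range.1 hk) hlt) (sub_nonneg.2 hlt.le)

section Hilbert

variable {H : Type*} [NormedAddCommGroup H] [InnerProductSpace ℝ H] {N : ℕ}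

local notation "⟪" x ", " y "⟫" => inner ℝ x y

/-! ### Wiener integrals in a Hilbert space -/

/-- The family `w` of curves in a Hilbert space has the covariance of a vector Brownian motion. -/
def IsBrownianCurve (w : Fin N → ℝ≥0 → H) : Prop :=
  ∀ i j s t, ⟪w i s, w j t⟫ = if i = j then (min (s : ℝ) t) else 0

/-- The approximation with step `1 / n` of the integral of `σ` against `w` up to time `t`. -/
noncomputable def itoSum (w : Fin N → ℝ≥0 → H) (σ : ℝ≥0 → Matrix (Fin N) (Fin N) ℝ) (n : ℕ) (t : ℝ≥0)
    (i : Fin N) : H :=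
  ∑ k ∈ Finset.range ⌈t * n⌉₊, ∑ j : Fin N, σ ((k : ℝ≥0) / n) i j •
    (w j (min (((k + 1 : ℕ) : ℝ≥0) / n) t) - w j (min ((k : ℝ≥0) / n) t))

theorem IsBrownianCurve.inner_increment {w : Fin N → ℝ≥0 → H} (hw : IsBrownianCurve w)
    {u : ℕ → ℝ≥0} (hu : Monotone u) (l m : Fin N) (k k' : ℕ) :
    ⟪w l (u (k + 1)) - w l (u k), w m (u (k' + 1)) - w m (u k')⟫ =
      if l = m then (if k = k' then ((u (k + 1) : ℝ) - u k) else 0) else 0 := by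
  have hu' : ∀ {a b : ℕ}, a ≤ b → (u a : ℝ) ≤ u b := fun h => NNReal.coe_le_coe.2 (hu h)
  rw [inner_sub_left, inner_sub_right, inner_sub_right, hw, hw, hw, hw]
  split_ifs with h1 h2
  · subst h2
    rw [min_self, min_eq_right (hu' k.le_succ), min_eq_left (hu' k.le_succ), min_self]
    ring
  · rcases Nat.lt_or_gt_of_ne h2 with h | h
    · rw [min_eq_left (hu' (by omega)), min_eq_left (hu' (by omega)),
        min_eq_left (hu' (by omega)), min_eq_left (hu' (by omega))]
      ring
    · rw [min_eq_right (hu' (by omega)), min_eq_right (hu' (by omega)),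
        min_eq_right (hu' (by omega)), min_eq_right (hu' (by omega))]
      ring
  · ring

/-- The Itô isometry for step functions: increments over different cells or of different components
are orthogonal. -/
theorem IsBrownianCurve.inner_sum_increments {w : Fin N → ℝ≥0 → H} (hw : IsBrownianCurve w)
    {u : ℕ → ℝ≥0} (hu : Monotone u) (a : ℕ → Matrix (Fin N) (Fin N) ℝ) (K : ℕ) (i j : Fin N) :
    ⟪∑ k ∈ Finset.range K, ∑ l, a k i l • (w l (u (k + 1)) - w l (u k)),
      ∑ k ∈ Finset.range K, ∑ l, a k j l • (w l (u (k + 1)) - w l (u k))⟫ =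
      ∑ k ∈ Finset.range K, (a k * (a k)ᵀ) i j * ((u (k + 1) : ℝ) - u k) := by
  simp_rw [sum_inner, inner_sum, real_inner_smul_left, real_inner_smul_right,
    hw.inner_increment hu]
  refine Finset.sum_congr rfl fun k hk => ?_
  rw [Matrix.mul_apply, Finset.sum_mul]
  refine Finset.sum_congr rfl fun l _ => ?_
  rw [Finset.sum_eq_single k]
  · simp [mul_assoc]
  · intro k' _ hk'
    simp [hk'.symm]
  · exact fun h => absurd hk h

/-- The difference is again a sum over one partition, the grid clipped to `[s, t]` by `max s (min ·
t)`. Cells outside `[s, t]` become degenerate and contribute nothing. -/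
theorem itoSum_sub (w : Fin N → ℝ≥0 → H) (σ : ℝ≥0 → Matrix (Fin N) (Fin N) ℝ) {n : ℕ}
    (hn : 0 < n) {s t : ℝ≥0} (hst : s ≤ t) (i : Fin N) :
    itoSum w σ n t i - itoSum w σ n s i =
      ∑ k ∈ Finset.range ⌈t * n⌉₊, ∑ l, σ ((k : ℝ≥0) / n) i l •
        (w l (max s (min (((k + 1 : ℕ) : ℝ≥0) / n) t)) - w l (max s (min ((k : ℝ≥0) / n) t))) := by
  have hn' : (0 : ℝ≥0) < n := by exact_mod_cast hn
  have hs : itoSum w σ n s i = ∑ k ∈ Finset.range ⌈t * n⌉₊, ∑ l, σ ((k : ℝ≥0) / n) i l •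
      (w l (min (((k + 1 : ℕ) : ℝ≥0) / n) s) - w l (min ((k : ℝ≥0) / n) s)) := by
    refine Finset.sum_subset (Finset.range_subset_range.2
      (Nat.ceil_mono (mul_le_mul_left hst _))) fun k _ hk => ?_
    have hk1 : s ≤ (k : ℝ≥0) / n := by
      rw [le_div_iff₀ hn']
      exact Nat.ceil_le.1 (not_lt.1 fun h => hk (Finset.mem_range.2 h))
    have hk2 : s ≤ ((k + 1 : ℕ) : ℝ≥0) / n := hk1.trans (by gcongr; simp)
    simp only [min_eq_right hk1, min_eq_right hk2, sub_self, smul_zero, Finset.sum_const_zero]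
  have key : ∀ l x, w l (min x t) - w l (min x s) = w l (max s (min x t)) - w l s := by
    intro l x
    rcases le_total x s with h | h
    · simp [min_eq_left h, min_eq_left (h.trans hst), max_eq_left h]
    · rw [min_eq_right h, max_eq_right (le_min h hst)]
  rw [hs, itoSum, ← Finset.sum_sub_distrib]
  refine Finset.sum_congr rfl fun k _ => ?_
  rw [← Finset.sum_sub_distrib]
  refine Finset.sum_congr rfl fun l _ => ?_
  rw [← smul_sub]
  congr 1
  have h1 := key l (((k + 1 : ℕ) : ℝ≥0) / n)
  have h2 := key l ((k : ℝ≥0) / n)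
  calc _ = (w l (min (((k + 1 : ℕ) : ℝ≥0) / n) t) - w l (min (((k + 1 : ℕ) : ℝ≥0) / n) s)) -
        (w l (min ((k : ℝ≥0) / n) t) - w l (min ((k : ℝ≥0) / n) s)) := by abel
    _ = _ := by rw [h1, h2]; abel

/-- The isometry turns the inner product into a Riemann sum of `D`. The left endpoint of a cell
meeting `[s, t]` may precede `s` by up to `1 / n`, whence the condition `s < r + 1 / n`. -/
theorem IsBrownianCurve.abs_inner_itoSum_sub_le {w : Fin N → ℝ≥0 → H} (hw : IsBrownianCurve w)
    {σ D : ℝ≥0 → Matrix (Fin N) (Fin N) ℝ} (hσ : ∀ r, σ r * (σ r)ᵀ = D r) {n : ℕ}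
    (hn : 0 < n) {s t : ℝ≥0} (hst : s ≤ t) {i j : Fin N} {g ε : ℝ}
    (h : ∀ r : ℝ≥0, s < r + 1 / n → r < t → |D r i j - g| ≤ ε) :
    |⟪itoSum w σ n t i - itoSum w σ n s i, itoSum w σ n t j - itoSum w σ n s j⟫ -
      g * (t - s)| ≤ ε * (t - s) := by
  have hn' : (0 : ℝ≥0) < n := by exact_mod_cast hn
  set u : ℕ → ℝ≥0 := fun k => max s (min ((k : ℝ≥0) / n) t) with hu
  have hmono : Monotone u := fun a b hab =>
    max_le_max le_rfl (min_le_min (by gcongr) le_rfl)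
  have h0 : u 0 = s := by simp [hu]
  have hK : u ⌈t * n⌉₊ = t := by
    have : t ≤ (⌈t * n⌉₊ : ℝ≥0) / n := by
      rw [le_div_iff₀ hn']
      exact Nat.le_ceil _
    simp [hu, min_eq_right this, hst]
  rw [itoSum_sub w σ hn hst, itoSum_sub w σ hn hst]
  have e := hw.inner_sum_increments hmono (fun k => σ ((k : ℝ≥0) / n)) ⌈t * n⌉₊ i j
  simp only [hu, hσ] at e
  rw [e]
  have := abs_sum_mul_sub_le (u := fun k => (u k : ℝ)) (G := fun k => D ((k : ℝ≥0) / n) i j)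
    (fun a b hab => NNReal.coe_le_coe.2 (hmono hab)) (g := g) (ε := ε) ⌈t * n⌉₊ ?_
  · simpa only [h0, hK] using this
  · intro k _ hk
    have hk : u k < u (k + 1) := NNReal.coe_lt_coe.1 hk
    refine h _ ?_ ?_
    · by_contra hcon
      have hle : ((k + 1 : ℕ) : ℝ≥0) / n ≤ s := by
        rw [Nat.cast_add, Nat.cast_one, add_div]
        exact not_lt.1 hcon
      have : u (k + 1) = s := max_eq_left ((min_le_left _ _).trans hle)
      exact absurd (le_max_left s _) (not_le.2 (this ▸ hk))
    · by_contra hcon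
      have : u k = t := by
        simp only [hu]
        rw [min_eq_right (not_lt.1 hcon), max_eq_right hst]
      exact absurd (max_le hst (min_le_right _ _)) (not_le.2 (this ▸ hk))

theorem IsBrownianCurve.abs_inner_integral_sub_le {w : Fin N → ℝ≥0 → H} (hw : IsBrownianCurve w)
    {σ D : ℝ≥0 → Matrix (Fin N) (Fin N) ℝ} (hσ : ∀ r, σ r * (σ r)ᵀ = D r)
    {M : ℝ≥0 → Fin N → H}
    (hM : ∀ t i, Tendsto (fun n : ℕ => itoSum w σ n t i) atTop (𝓝 (M t i)))
    {s t : ℝ≥0} (hst : s ≤ t) {i j : Fin N} {g ε δ : ℝ} (hδ : 0 < δ)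
    (h : ∀ r : ℝ≥0, (s : ℝ) < r + δ → r < t → |D r i j - g| ≤ ε) :
    |⟪M t i - M s i, M t j - M s j⟫ - g * (t - s)| ≤ ε * (t - s) := by
  have hlim := ((((hM t i).sub (hM s i)).inner (𝕜 := ℝ) ((hM t j).sub (hM s j))).sub_const
    (g * (t - s))).abs
  refine le_of_tendsto hlim ?_
  have h1 : ∀ᶠ n : ℕ in atTop, 1 / (n : ℝ) < δ :=
    (tendsto_const_div_atTop_nhds_zero_nat 1).eventually (gt_mem_nhds hδ)
  filter_upwards [h1, eventually_gt_atTop 0] with n hn hn0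
  refine hw.abs_inner_itoSum_sub_le hσ hn0 hst fun r hr hrt => h r ?_ hrt
  have : (s : ℝ) < r + 1 / n := by exact_mod_cast hr
  linarith

theorem inner_integral_sub_eq_zero {w : Fin N → ℝ≥0 → H} {σ : ℝ≥0 → Matrix (Fin N) (Fin N) ℝ}
    {M : ℝ≥0 → Fin N → H}
    (hM : ∀ t i, Tendsto (fun n : ℕ => itoSum w σ n t i) atTop (𝓝 (M t i)))
    {s t : ℝ≥0} (hst : s ≤ t) {X : H}
    (hX : ∀ l a b, s ≤ a → a ≤ b → ⟪w l b - w l a, X⟫ = 0) (i : Fin N) :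
    ⟪M t i - M s i, X⟫ = 0 := by
  have hlim := ((hM t i).sub (hM s i)).inner (𝕜 := ℝ) (tendsto_const_nhds (x := X))
  refine tendsto_nhds_unique hlim (tendsto_const_nhds.congr' ?_)
  filter_upwards [eventually_gt_atTop 0] with n hn
  rw [itoSum_sub w σ hn hst, sum_inner]
  refine (Finset.sum_eq_zero fun k _ => ?_).symm
  rw [sum_inner]
  refine Finset.sum_eq_zero fun l _ => ?_
  rw [real_inner_smul_left, hX l _ _ (le_max_left _ _), mul_zero]
  exact max_le_max le_rfl (min_le_min (by gcongr; simp) le_rfl)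

/-! ### First order expansions with a noise term -/

/-- The curve `X` satisfies `X(r) = X(t) + (r - t) x' + ξ(r) + o(r - t)` as `r ↓ t`, with a noise
term `ξ` that tends to zero. -/
structure HasNoisyRightDeriv (X : ℝ → H) (x' : H) (ξ : ℝ → H) (t : ℝ) : Prop where
  expansion : (fun r => X r - X t - (r - t) • x' - ξ r) =o[𝓝[≥] t] fun r => r - t
  noise : Tendsto ξ (𝓝[≥] t) (𝓝 0)

theorem hasNoisyRightDeriv_const (v : H) (t : ℝ) :
    HasNoisyRightDeriv (fun _ => v) 0 (fun _ => 0) t :=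
  ⟨by simp, tendsto_const_nhds⟩

/-- A product rule with Itô correction. Noise is orthogonal to the values at time `t`, the product
of the two noises contributes `κ`, and every other product is an `O(r - t)` term against one that
tends to zero. -/
theorem HasNoisyRightDeriv.inner {X Y ξ η : ℝ → H} {x' y' : H} {κ t : ℝ}
    (hX : HasNoisyRightDeriv X x' ξ t) (hY : HasNoisyRightDeriv Y y' η t)
    (hξ : ∀ r ≥ t, ⟪ξ r, Y t⟫ = 0) (hη : ∀ r ≥ t, ⟪η r, X t⟫ = 0)
    (hκ : (fun r => ⟪ξ r, η r⟫ - κ * (r - t)) =o[𝓝[≥] t] fun r => r - t) :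
    HasDerivWithinAt (fun r => ⟪X r, Y r⟫) (⟪x', Y t⟫ + ⟪X t, y'⟫ + κ) (Ici t) t := by
  have hid : Tendsto (fun r : ℝ => r - t) (𝓝[≥] t) (𝓝 0) := by
    have : Continuous fun r : ℝ => r - t := by fun_prop
    simpa using (this.tendsto t).mono_left nhdsWithin_le_nhds
  have hlin : ∀ v : H, (fun r : ℝ => (r - t) • v) =O[𝓝[≥] t] fun r => r - t := fun v =>
    Asymptotics.IsBigO.of_bound ‖v‖ (Eventually.of_forall fun r => by
      rw [norm_smul, mul_comm])
  set e := fun r => X r - X t - (r - t) • x' - ξ r with he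
  set f := fun r => Y r - Y t - (r - t) • y' - η r with hf
  have he0 : Tendsto e (𝓝[≥] t) (𝓝 0) := hX.expansion.trans_tendsto hid
  have hf0 : Tendsto f (𝓝[≥] t) (𝓝 0) := hY.expansion.trans_tendsto hid
  have hxO : (fun r => (r - t) • x' + e r) =O[𝓝[≥] t] fun r => r - t :=
    (hlin x').add hX.expansion.isBigO
  have hyO : (fun r => (r - t) • y' + f r) =O[𝓝[≥] t] fun r => r - t :=
    (hlin y').add hY.expansion.isBigO
  have hY0 : Tendsto (fun r => Y r - Y t) (𝓝[≥] t) (𝓝 0) := by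
    have h1 : (fun r => Y r - Y t) = fun r => (r - t) • y' + f r + η r := by
      ext r; simp only [hf]; abel
    rw [h1]
    simpa using (((hid.smul_const y').add hf0).add hY.noise)
  have prod : ∀ {a b : ℝ → H}, a =O[𝓝[≥] t] (fun r => r - t) → Tendsto b (𝓝[≥] t) (𝓝 0) →
      (fun r => ⟪a r, b r⟫) =o[𝓝[≥] t] fun r => r - t := by
    intro a b ha hb
    have h1 : (fun r => ‖a r‖ * ‖b r‖) =o[𝓝[≥] t] fun r => (r - t) * 1 :=
      ha.norm_left.mul_isLittleO ((Asymptotics.isLittleO_one_iff ℝ).2 hb).norm_left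
    simp only [mul_one] at h1
    refine Asymptotics.IsBigO.trans_isLittleO (Asymptotics.IsBigO.of_bound 1
      (Eventually.of_forall fun r => ?_)) h1
    rw [one_mul, norm_mul, norm_norm, norm_norm]
    exact norm_inner_le_norm _ _
  have lit : ∀ {a : ℝ → H} (v : H), a =o[𝓝[≥] t] (fun r => r - t) →
      (fun r => ⟪a r, v⟫) =o[𝓝[≥] t] fun r => r - t := by
    intro a v ha
    refine Asymptotics.IsBigO.trans_isLittleO (Asymptotics.IsBigO.of_bound ‖v‖
      (Eventually.of_forall fun r => ?_)) ha
    rw [mul_comm]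
    exact norm_inner_le_norm _ _
  rw [hasDerivWithinAt_iff_isLittleO]
  have total := ((((lit (Y t) hX.expansion).add (lit (X t) hY.expansion)).add
    (prod hxO hY0)).add (prod hyO hX.noise)).add hκ
  refine total.congr' ?_ EventuallyEq.rfl
  filter_upwards [self_mem_nhdsWithin] with r hr
  have hXr : X r = X t + (r - t) • x' + ξ r + e r := by simp only [he]; abel
  have hYr : Y r = Y t + (r - t) • y' + η r + f r := by simp only [hf]; abel
  have h1 := hξ r hr
  have h3 : ⟪X t, η r⟫ = 0 := by rw [real_inner_comm]; exact hη r hr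
  change ⟪e r, Y t⟫ + ⟪f r, X t⟫ + ⟪(r - t) • x' + e r, Y r - Y t⟫ +
    ⟪(r - t) • y' + f r, ξ r⟫ + (⟪ξ r, η r⟫ - κ * (r - t)) = _
  rw [hXr, hYr]
  simp only [inner_add_left, inner_add_right, inner_sub_right, real_inner_smul_left,
    real_inner_smul_right, h1, h3, smul_eq_mul, real_inner_comm (X t) (f r),
    real_inner_comm (ξ r) y', real_inner_comm (ξ r) (f r)]
  ring

end Hilbert

end EnsembleLangevin
namespace EnsembleLangevin

theorem continuous_of_norm_sub_le_mul {E : Type*} [NormedAddCommGroup E] {f : ℝ≥0 → E}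
    (h : ∀ T : ℝ≥0, ∃ R : ℝ, 0 ≤ R ∧ ∀ s t : ℝ≥0, s ≤ t → t ≤ T →
      ‖f t - f s‖ ≤ R * ((t : ℝ) - s)) : Continuous f := by
  refine continuous_of_norm_sub_le fun T => ?_
  obtain ⟨R, hR0, hR⟩ := h T
  exact ⟨R, fun s t hst ht => (hR s t hst ht).trans
    (mul_le_mul_of_nonneg_left (le_add_of_nonneg_right (Real.sqrt_nonneg _)) hR0)⟩

theorem exists_abs_le_of_continuous {g : ℝ≥0 → ℝ} (hg : Continuous g) (T : ℝ≥0) :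
    ∃ R, 0 ≤ R ∧ ∀ t ≤ T, |g t| ≤ R := by
  obtain ⟨R, hR⟩ := (isCompact_Icc (a := 0) (b := T)).exists_bound_of_continuousOn hg.continuousOn
  exact ⟨|R|, abs_nonneg _, fun t ht => (hR t ⟨zero_le, ht⟩).trans (le_abs_self _)⟩

/-! ### The moment equations for curves in a Hilbert space -/

section HilbertSolution

variable {H : Type*} [NormedAddCommGroup H] [InnerProductSpace ℝ H] {N : ℕ}

local notation "⟪" x ", " y "⟫" => inner ℝ x y

/-- The covariance of two vectors of a Hilbert space relative to a unit vector `e`, which plays the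
role of the constant function `1` of `L²`. -/
def innerCov (e x y : H) : ℝ := ⟪x, y⟫ - ⟪x, e⟫ * ⟪e, y⟫

/-- The matrix of covariances of two families of vectors. -/
def covMatrix (e : H) (x y : Fin N → H) : Matrix (Fin N) (Fin N) ℝ :=
  Matrix.of fun i j => innerCov e (x i) (y j)

theorem innerCov_comm (e x y : H) : innerCov e x y = innerCov e y x := by
  simp only [innerCov, real_inner_comm x y, real_inner_comm e x, real_inner_comm e y]
  ring

theorem innerCov_add_left (e x x' y : H) :
    innerCov e (x + x') y = innerCov e x y + innerCov e x' y := by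
  simp only [innerCov, inner_add_left]; ring

theorem innerCov_smul_left (e : H) (a : ℝ) (x y : H) :
    innerCov e (a • x) y = a * innerCov e x y := by
  simp only [innerCov, real_inner_smul_left]; ring

theorem innerCov_sum_left {ι : Type*} (s : Finset ι) (e : H) (x : ι → H) (y : H) :
    innerCov e (∑ k ∈ s, x k) y = ∑ k ∈ s, innerCov e (x k) y := by
  simp only [innerCov, sum_inner, Finset.sum_mul, Finset.sum_sub_distrib]

theorem innerCov_self_left {e : H} (he : ⟪e, e⟫ = 1) (y : H) : innerCov e e y = 0 := by
  rw [innerCov, he, one_mul, sub_self]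

theorem innerCov_eq_inner_sub {e : H} (he : ⟪e, e⟫ = 1) (x y : H) :
    innerCov e x y = ⟪x - ⟪x, e⟫ • e, y - ⟪y, e⟫ • e⟫ := by
  simp only [innerCov, inner_sub_left, inner_sub_right, real_inner_smul_left,
    real_inner_smul_right, he, real_inner_comm e y]
  ring

theorem covMatrix_posSemidef {e : H} (he : ⟪e, e⟫ = 1) (x : Fin N → H) :
    (covMatrix e x x).PosSemidef := by
  have : covMatrix e x x = Matrix.gram ℝ fun i => x i - ⟪x i, e⟫ • e := by
    ext i j
    exact innerCov_eq_inner_sub he _ _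
  rw [this]
  exact Matrix.posSemidef_gram ℝ _

theorem covMatrix_transpose (e : H) (x y : Fin N → H) : (covMatrix e x y)ᵀ = covMatrix e y x := by
  ext i j
  exact innerCov_comm _ _ _

theorem continuous_innerCov (e : H) {x y : ℝ≥0 → H} (hx : Continuous x)
    (hy : Continuous y) : Continuous fun t => innerCov e (x t) (y t) := by
  unfold innerCov
  fun_prop

/-- The family `v(s, t)` approximates `(t - s) g` with the error bound of the integral of `g` over
`[s, t]`. -/
def IsIntegralLike (v : ℝ≥0 → ℝ≥0 → H) (g : ℝ≥0 → H) : Prop :=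
  ∀ (s t : ℝ≥0) (x : H) (m : ℝ), s ≤ t → (∀ r, s ≤ r → r ≤ t → ‖g r - x‖ ≤ m) →
    ‖v s t - ((t : ℝ) - s) • x‖ ≤ m * ((t : ℝ) - s)

theorem continuous_of_isIntegralLike {f g : ℝ≥0 → H}
    (h : IsIntegralLike (fun s t => f t - f s) g)
    (hg : ∀ T : ℝ≥0, ∃ R, ∀ t ≤ T, ‖g t‖ ≤ R) : Continuous f := by
  refine continuous_of_norm_sub_le_mul fun T => ?_
  obtain ⟨R, hR⟩ := hg T
  refine ⟨|R|, abs_nonneg _, fun s t hst ht => ?_⟩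
  have := h s t 0 |R| hst fun r _ hr => by
    rw [sub_zero]; exact (hR r (hr.trans ht)).trans (le_abs_self _)
  simpa using this

theorem IsIntegralLike.isLittleO {v : ℝ≥0 → ℝ≥0 → H} {g : ℝ≥0 → H} (h : IsIntegralLike v g)
    (hg : Continuous g) (t : ℝ≥0) :
    (fun r : ℝ => v t r.toNNReal - (r - t) • g t) =o[𝓝[≥] (t : ℝ)] fun r => r - t := by
  refine Asymptotics.isLittleO_iff.2 fun c hc => ?_
  obtain ⟨δ, hδ, hb⟩ := Metric.continuousAt_iff.1 hg.continuousAt c hc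
  have h1 : ∀ᶠ r : ℝ in 𝓝[≥] (t : ℝ), r < t + δ :=
    nhdsWithin_le_nhds (eventually_lt_nhds (by linarith))
  filter_upwards [h1, self_mem_nhdsWithin] with r hr hrt
  have hr0 : 0 ≤ r := t.2.trans hrt
  lift r to ℝ≥0 using hr0
  have hrt' : t ≤ r := NNReal.coe_le_coe.1 hrt
  rw [Real.toNNReal_coe, Real.norm_eq_abs, abs_of_nonneg (sub_nonneg.2 hrt)]
  refine h t r (g t) c hrt' fun x hx hxr => ?_
  rw [← dist_eq_norm]
  refine (hb ?_).le
  rw [NNReal.dist_eq, abs_of_nonneg (sub_nonneg.2 (NNReal.coe_le_coe.2 hx))]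
  have : (x : ℝ) ≤ r := NNReal.coe_le_coe.2 hxr
  linarith

/-- The negative drift of the momentum. -/
noncomputable def driftCurve (γ : ℝ) (B : Matrix (Fin N) (Fin N) ℝ) (c : Fin N → ℝ) (e : H)
    (Q P : ℝ≥0 → Fin N → H) (t : ℝ≥0) (i : Fin N) : H :=
  ∑ k, (covMatrix e (Q t) (Q t) * B⁻¹) i k • Q t k - (covMatrix e (Q t) (Q t) *ᵥ c) i • e +
    γ • P t i

/-- A solution of the mean-field dynamics as a curve in `L²`. -/
structure IsHilbertSolution (γ : ℝ) (B : Matrix (Fin N) (Fin N) ℝ) (c : Fin N → ℝ) (e : H)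
    (w : Fin N → ℝ≥0 → H) (Q P M : ℝ≥0 → Fin N → H) : Prop where
  inner_unit : ⟪e, e⟫ = 1
  brownian : IsBrownianCurve w
  integral : ∀ t i, Tendsto (fun n : ℕ =>
    itoSum w (fun s => CFC.sqrt ((2 * γ) • covMatrix e (Q s) (Q s))) n t i) atTop (𝓝 (M t i))
  increments_unit : ∀ l a b, a ≤ b → ⟪w l b - w l a, e⟫ = 0
  increments_position : ∀ l a b s i, s ≤ a → a ≤ b → ⟪w l b - w l a, Q s i⟫ = 0
  increments_momentum : ∀ l a b s i, s ≤ a → a ≤ b → ⟪w l b - w l a, P s i⟫ = 0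
  bounded : ∀ T : ℝ≥0, ∃ R : ℝ, ∀ t ≤ T, ∀ i, ‖Q t i‖ ≤ R ∧ ‖P t i‖ ≤ R
  position : ∀ i, IsIntegralLike (fun s t => Q t i - Q s i) fun t => P t i
  momentum : ∀ i, IsIntegralLike (fun s t => (M t i - M s i) - (P t i - P s i)) fun t =>
    driftCurve γ B c e Q P t i

/-- The mean and covariance of a solution, as functions of real time. -/
def hilbertMoments (e : H) (Q P : ℝ≥0 → Fin N → H) (t : ℝ) :
    MomentState N :=
  (fun i => ⟪Q t.toNNReal i, e⟫, fun i => ⟪P t.toNNReal i, e⟫,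
    covMatrix e (Q t.toNNReal) (Q t.toNNReal), covMatrix e (P t.toNNReal) (P t.toNNReal),
    covMatrix e (Q t.toNNReal) (P t.toNNReal))

/-- The product rule is applied to `⟪X, Y⟫`, `⟪X, e⟫` and `⟪e, Y⟫`; noise is orthogonal to `e`, so
only the first receives a correction. -/
theorem HasNoisyRightDeriv.innerCov {e : H} {X Y ξ η : ℝ → H}
    {x' y' : H} {κ t : ℝ} (hX : HasNoisyRightDeriv X x' ξ t) (hY : HasNoisyRightDeriv Y y' η t)
    (hξe : ∀ r ≥ t, ⟪ξ r, e⟫ = 0) (hηe : ∀ r ≥ t, ⟪η r, e⟫ = 0)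
    (hξ : ∀ r ≥ t, ⟪ξ r, Y t⟫ = 0) (hη : ∀ r ≥ t, ⟪η r, X t⟫ = 0)
    (hκ : (fun r => ⟪ξ r, η r⟫ - κ * (r - t)) =o[𝓝[≥] t] fun r => r - t) :
    HasDerivWithinAt (fun r => innerCov e (X r) (Y r))
      (innerCov e x' (Y t) + innerCov e (X t) y' + κ) (Ici t) t := by
  have h1 := hX.inner hY hξ hη hκ
  have h2 := hX.inner (hasNoisyRightDeriv_const e t) hξe (by simp) (κ := 0) (by simp)
  have h3 := (hasNoisyRightDeriv_const e t).inner hY (by simp) hηe (κ := 0) (by simp)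
  refine (h1.sub (h2.mul h3)).congr_deriv ?_
  simp only [EnsembleLangevin.innerCov, inner_zero_left, inner_zero_right]
  ring

namespace IsHilbertSolution

variable {γ : ℝ} {B : Matrix (Fin N) (Fin N) ℝ} {c : Fin N → ℝ} {e : H}
  {w : Fin N → ℝ≥0 → H} {Q P M : ℝ≥0 → Fin N → H}

/-- Start of a bootstrap: bounded momentum makes the position continuous, hence `C_q`, hence the
noise by the isometry; then the bounded drift makes the momentum continuous, and finally the drift
itself. -/
theorem continuous_position (h : IsHilbertSolution γ B c e w Q P M) (i : Fin N) :
    Continuous fun t => Q t i :=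
  continuous_of_isIntegralLike (h.position i) fun T => by
    obtain ⟨R, hR⟩ := h.bounded T
    exact ⟨R, fun t ht => (hR t ht i).2⟩

theorem continuous_cov_position (h : IsHilbertSolution γ B c e w Q P M) (i j : Fin N) :
    Continuous fun t => covMatrix e (Q t) (Q t) i j :=
  continuous_innerCov e (h.continuous_position i) (h.continuous_position j)

theorem sqrt_mul_transpose (h : IsHilbertSolution γ B c e w Q P M) (hγ : 0 ≤ γ) (r : ℝ≥0) :
    CFC.sqrt ((2 * γ) • covMatrix e (Q r) (Q r)) *
      (CFC.sqrt ((2 * γ) • covMatrix e (Q r) (Q r)))ᵀ = (2 * γ) • covMatrix e (Q r) (Q r) := by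
  have hps : ((2 * γ) • covMatrix e (Q r) (Q r)).PosSemidef :=
    (covMatrix_posSemidef h.inner_unit _).smul (by positivity)
  rw [isSymm_sqrt, CFC.sqrt_mul_sqrt_self _ (Matrix.nonneg_iff_posSemidef.2 hps)]

theorem continuous_integral (h : IsHilbertSolution γ B c e w Q P M) (hγ : 0 ≤ γ) (i : Fin N) :
    Continuous fun t => M t i := by
  refine continuous_of_norm_sub_le fun T => ?_
  obtain ⟨R, hR0, hR⟩ := exists_abs_le_of_continuous ((h.continuous_cov_position i i).const_mul (2 * γ)) T
  refine ⟨√R, fun s t hst ht => ?_⟩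
  have hst' : (0 : ℝ) ≤ t - s := sub_nonneg.2 (NNReal.coe_le_coe.2 hst)
  have h1 := h.brownian.abs_inner_integral_sub_le (h.sqrt_mul_transpose hγ) h.integral hst
    (i := i) (j := i) (g := 0) (ε := R) one_pos
    (fun r _ hr => by simpa using hR r (hr.le.trans ht))
  rw [zero_mul, sub_zero, real_inner_self_eq_norm_sq, abs_of_nonneg (sq_nonneg _)] at h1
  calc ‖M t i - M s i‖ = √(‖M t i - M s i‖ ^ 2) := (Real.sqrt_sq (norm_nonneg _)).symm
    _ ≤ √(R * (t - s)) := Real.sqrt_le_sqrt h1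
    _ = √R * √((t : ℝ) - s) := Real.sqrt_mul hR0 _
    _ ≤ _ := mul_le_mul_of_nonneg_left (le_add_of_nonneg_left hst') (Real.sqrt_nonneg _)

/-- At this stage the momentum is only known to be bounded, so its part of the drift is estimated
separately from the continuous rest. -/
theorem exists_norm_drift_le (h : IsHilbertSolution γ B c e w Q P M) (i : Fin N) (T : ℝ≥0) :
    ∃ R, ∀ t ≤ T, ‖driftCurve γ B c e Q P t i‖ ≤ R := by
  obtain ⟨R, hR⟩ := h.bounded T
  have hc : Continuous fun t =>
      ∑ k, (covMatrix e (Q t) (Q t) * B⁻¹) i k • Q t k - (covMatrix e (Q t) (Q t) *ᵥ c) i • e := by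
    have h1 := h.continuous_cov_position
    have h2 := h.continuous_position
    simp only [Matrix.mul_apply, Matrix.mulVec, dotProduct]
    fun_prop
  obtain ⟨R', -, hR'⟩ := exists_abs_le_of_continuous hc.norm T
  refine ⟨R' + |γ| * |R|, fun t ht => ?_⟩
  refine (norm_add_le _ _).trans (add_le_add (by simpa using hR' t ht) ?_)
  rw [norm_smul, Real.norm_eq_abs]
  exact mul_le_mul_of_nonneg_left ((hR t ht i).2.trans (le_abs_self _)) (abs_nonneg _)

theorem continuous_momentum (h : IsHilbertSolution γ B c e w Q P M) (hγ : 0 ≤ γ) (i : Fin N) :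
    Continuous fun t => P t i := by
  have hd : Continuous fun t => M t i - P t i := by
    refine continuous_of_isIntegralLike (g := fun t => driftCurve γ B c e Q P t i) ?_
      (h.exists_norm_drift_le i)
    simpa only [sub_sub_sub_comm] using h.momentum i
  refine ((h.continuous_integral hγ i).sub hd).congr fun t => ?_
  simp

theorem continuous_drift (h : IsHilbertSolution γ B c e w Q P M) (hγ : 0 ≤ γ) (i : Fin N) :
    Continuous fun t => driftCurve γ B c e Q P t i := by
  have h1 := h.continuous_cov_position
  have h2 := h.continuous_position
  have h3 := h.continuous_momentum hγ
  simp only [driftCurve, Matrix.mul_apply, Matrix.mulVec, dotProduct]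
  fun_prop

theorem hasNoisyRightDeriv_position (h : IsHilbertSolution γ B c e w Q P M) (hγ : 0 ≤ γ)
    (i : Fin N) (t : ℝ≥0) :
    HasNoisyRightDeriv (fun r => Q r.toNNReal i) (P t i) (fun _ => 0) t where
  expansion := by simpa using (h.position i).isLittleO (h.continuous_momentum hγ i) t
  noise := tendsto_const_nhds

theorem hasNoisyRightDeriv_momentum (h : IsHilbertSolution γ B c e w Q P M) (hγ : 0 ≤ γ)
    (i : Fin N) (t : ℝ≥0) :
    HasNoisyRightDeriv (fun r => P r.toNNReal i) (-driftCurve γ B c e Q P t i)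
      (fun r => M r.toNNReal i - M t i) t where
  expansion := by
    refine ((h.momentum i).isLittleO (h.continuous_drift hγ i) t).neg_left.congr_left fun r => ?_
    simp only [Real.toNNReal_coe, smul_neg]
    abel
  noise := by
    have : Continuous fun r : ℝ => M r.toNNReal i - M t i :=
      ((h.continuous_integral hγ i).comp continuous_real_toNNReal).sub continuous_const
    simpa using (this.tendsto (t : ℝ)).mono_left nhdsWithin_le_nhds

/-- The isometry with the diffusion matrix `σ σᵀ = 2γ C_q`, frozen at time `t` by continuity. This
is the term that becomes `2γ C_q` in the equation for `C_p`. -/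
theorem noise_isLittleO (h : IsHilbertSolution γ B c e w Q P M) (hγ : 0 ≤ γ) (i j : Fin N)
    (t : ℝ≥0) :
    (fun r : ℝ => ⟪M r.toNNReal i - M t i, M r.toNNReal j - M t j⟫ -
      2 * γ * covMatrix e (Q t) (Q t) i j * (r - t)) =o[𝓝[≥] (t : ℝ)] fun r => r - t := by
  refine Asymptotics.isLittleO_iff.2 fun ε hε => ?_
  obtain ⟨δ, hδ, hb⟩ := Metric.continuousAt_iff.1
    (((h.continuous_cov_position i j).const_mul (2 * γ)).continuousAt (x := t)) ε hε
  have h1 : ∀ᶠ r : ℝ in 𝓝[≥] (t : ℝ), r < t + δ :=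
    nhdsWithin_le_nhds (eventually_lt_nhds (by linarith))
  filter_upwards [h1, self_mem_nhdsWithin] with r hr hrt
  have hr0 : 0 ≤ r := t.2.trans hrt
  lift r to ℝ≥0 using hr0
  have hrt' : t ≤ r := NNReal.coe_le_coe.1 hrt
  rw [Real.toNNReal_coe, Real.norm_eq_abs, Real.norm_eq_abs, abs_of_nonneg (sub_nonneg.2 hrt : (0 : ℝ) ≤ r - t)]
  refine h.brownian.abs_inner_integral_sub_le (h.sqrt_mul_transpose hγ) h.integral hrt' hδ
    fun x hx hxr => ?_
  have hxr' : (x : ℝ) < r := NNReal.coe_lt_coe.2 hxr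
  refine (hb (x := x) ?_).le
  rw [NNReal.dist_eq, abs_lt]
  constructor <;> linarith

theorem inner_noise_eq_zero (h : IsHilbertSolution γ B c e w Q P M) {t : ℝ≥0} {X : H}
    (hX : ∀ l a b, t ≤ a → a ≤ b → ⟪w l b - w l a, X⟫ = 0) (i : Fin N) :
    ∀ r ≥ (t : ℝ), ⟪M r.toNNReal i - M t i, X⟫ = 0 := fun _ hr =>
  inner_integral_sub_eq_zero h.integral (NNReal.le_toNNReal_of_coe_le hr) hX i

theorem inner_drift (h : IsHilbertSolution γ B c e w Q P M) (i : Fin N) (t : ℝ≥0) :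
    ⟪-driftCurve γ B c e Q P t i, e⟫ =
      (-(covMatrix e (Q t) (Q t) *ᵥ (B⁻¹ *ᵥ (fun k => ⟪Q t k, e⟫) - c)) -
        γ • fun k => ⟪P t k, e⟫) i := by
  rw [driftCurve, Matrix.mulVec_sub, Matrix.mulVec_mulVec]
  simp only [inner_neg_left, inner_add_left, inner_sub_left, sum_inner, real_inner_smul_left,
    h.inner_unit, Pi.sub_apply, Pi.neg_apply, Pi.smul_apply, smul_eq_mul]
  simp only [Matrix.mulVec, dotProduct]
  ring

theorem innerCov_drift (h : IsHilbertSolution γ B c e w Q P M) (i : Fin N) (t : ℝ≥0)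
    (Y : Fin N → H) (j : Fin N) :
    innerCov e (-driftCurve γ B c e Q P t i) (Y j) =
      (-(covMatrix e (Q t) (Q t) * B⁻¹ * covMatrix e (Q t) Y) - γ • covMatrix e (P t) Y) i j := by
  rw [driftCurve, ← neg_one_smul ℝ, sub_eq_add_neg, ← neg_smul]
  simp only [innerCov_smul_left, innerCov_add_left, innerCov_sum_left,
    innerCov_self_left h.inner_unit, Matrix.sub_apply, Matrix.neg_apply, Matrix.smul_apply,
    smul_eq_mul]
  rw [Matrix.mul_apply]
  simp only [covMatrix, Matrix.of_apply]
  ring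

theorem continuous_hilbertMoments (h : IsHilbertSolution γ B c e w Q P M) (hγ : 0 ≤ γ) :
    Continuous (hilbertMoments e Q P) := by
  have hr := continuous_real_toNNReal
  have hQ := fun i => (h.continuous_position i).comp hr
  have hP := fun i => (h.continuous_momentum hγ i).comp hr
  refine .prodMk (continuous_pi fun i => (hQ i).inner continuous_const) <|
    .prodMk (continuous_pi fun i => (hP i).inner continuous_const) <|
    .prodMk (continuous_matrix fun i j => ?_) <| .prodMk (continuous_matrix fun i j => ?_) <|
    continuous_matrix fun i j => ?_
  · exact (continuous_innerCov e (h.continuous_position i) (h.continuous_position j)).comp hr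
  · exact (continuous_innerCov e (h.continuous_momentum hγ i) (h.continuous_momentum hγ j)).comp hr
  · exact (continuous_innerCov e (h.continuous_position i) (h.continuous_momentum hγ j)).comp hr

theorem hasDerivWithinAt_hilbertMoments (h : IsHilbertSolution γ B c e w Q P M) (hγ : 0 ≤ γ)
    (hB : B.IsSymm) (t : ℝ≥0) :
    HasDerivWithinAt (hilbertMoments e Q P) (momentField γ B c (hilbertMoments e Q P t))
      (Ici (t : ℝ)) t := by
  have hq := fun i => h.hasNoisyRightDeriv_position hγ i t
  have hp := fun i => h.hasNoisyRightDeriv_momentum hγ i t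
  have he := fun i => h.inner_noise_eq_zero (t := t) (fun l a b _ => h.increments_unit l a b) i
  have hQ := fun j i => h.inner_noise_eq_zero (t := t)
    (fun l a b => h.increments_position l a b t j) i
  have hP := fun j i => h.inner_noise_eq_zero (t := t)
    (fun l a b => h.increments_momentum l a b t j) i
  have z : ∀ x : H, ∀ r ≥ (t : ℝ), ⟪(0 : H), x⟫ = 0 := fun x r _ => inner_zero_left _
  have hC : ∀ x y : Fin N → H, ∀ i j, innerCov e (x i) (y j) = covMatrix e x y i j :=
    fun _ _ _ _ => rfl
  have hu := hasNoisyRightDeriv_const e (t : ℝ)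
  simp only [hilbertMoments, momentField, Real.toNNReal_coe, MomentState.mq, MomentState.mp,
    MomentState.Cq, MomentState.Cp, MomentState.Cqp]
  refine .prodMk (hasDerivWithinAt_pi.2 fun i => ?_) <|
    .prodMk (hasDerivWithinAt_pi.2 fun i => ?_) <|
    .prodMk (hasDerivWithinAt_pi.2 fun i => hasDerivWithinAt_pi.2 fun j => ?_) <|
    .prodMk (hasDerivWithinAt_pi.2 fun i => hasDerivWithinAt_pi.2 fun j => ?_) <|
    hasDerivWithinAt_pi.2 fun i => hasDerivWithinAt_pi.2 fun j => ?_
  · refine ((hq i).inner hu (z _) (z _) (κ := 0) (by simp)).congr_deriv ?_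
    simp
  · refine ((hp i).inner hu (he i) (z _) (κ := 0) (by simp)).congr_deriv ?_
    rw [h.inner_drift]
    simp
  · refine ((hq i).innerCov (hq j) (z _) (z _) (z _) (z _) (κ := 0) (by simp)).congr_deriv ?_
    simp only [Real.toNNReal_coe]
    rw [innerCov_comm e (P t i) (Q t j), hC, hC, Matrix.add_apply, Matrix.transpose_apply]
    ring
  · refine ((hp i).innerCov (hp j) (he i) (he j) (by simpa using hP j i) (by simpa using hP i j)
      (h.noise_isLittleO hγ i j t)).congr_deriv ?_
    simp only [Real.toNNReal_coe]
    rw [innerCov_comm e (P t i), h.innerCov_drift, h.innerCov_drift]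
    simp only [Matrix.sub_apply, Matrix.neg_apply, Matrix.smul_apply, Matrix.add_apply,
      Matrix.transpose_apply, smul_eq_mul]
    rw [show covMatrix e (P t) (P t) j i = covMatrix e (P t) (P t) i j from innerCov_comm _ _ _]
    ring
  · refine ((hq i).innerCov (hp j) (z _) (he j) (z _) (by simpa using hQ i j) (κ := 0)
      (by simp)).congr_deriv ?_
    simp only [Real.toNNReal_coe]
    rw [innerCov_comm e (Q t i), h.innerCov_drift, hC]
    simp only [Matrix.sub_apply, Matrix.neg_apply, Matrix.smul_apply, Matrix.add_apply,
      smul_eq_mul]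
    -- The drift acts on the second argument, which produces the transpose of `C_q B⁻¹ C_q`;
    -- symmetry of `B` removes it.
    have hsymm : (covMatrix e (Q t) (Q t) * B⁻¹ * covMatrix e (Q t) (Q t))ᵀ =
        covMatrix e (Q t) (Q t) * B⁻¹ * covMatrix e (Q t) (Q t) := by
      rw [Matrix.transpose_mul, Matrix.transpose_mul, covMatrix_transpose,
        Matrix.transpose_nonsing_inv, hB.eq, Matrix.mul_assoc]
    rw [← congrFun (congrFun hsymm i) j, Matrix.transpose_apply,
      show covMatrix e (P t) (Q t) j i = covMatrix e (Q t) (P t) i j from innerCov_comm _ _ _]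
    ring

theorem isIntegralCurveOn_hilbertMoments (h : IsHilbertSolution γ B c e w Q P M) (hγ : 0 ≤ γ)
    (hB : B.IsSymm) :
    IsIntegralCurveOn (hilbertMoments e Q P) (fun _ => momentField γ B c) (Ici 0) := by
  have hc := h.continuous_hilbertMoments hγ
  have hF : Continuous (momentField γ B c) := by
    unfold momentField
    fun_prop
  intro t ht
  refine hasDerivWithinAt_Ici_of_right_deriv hc (hF.comp hc) (fun s hs => ?_) ht
  lift s to ℝ≥0 using hs
  exact h.hasDerivWithinAt_hilbertMoments hγ hB s

end IsHilbertSolution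

end HilbertSolution

end EnsembleLangevin
namespace EnsembleLangevin

/-! ### Time integrals of processes as integrals in `L²` -/

section TimeIntegral

variable {Ω : Type*} {mΩ : MeasurableSpace Ω} {μ : Measure Ω}

theorem sq_lintegral_le {α : Type*} [MeasurableSpace α] (ν : Measure α) {h : α → ℝ≥0∞}
    (hh : AEMeasurable h ν) : (∫⁻ x, h x ∂ν) ^ 2 ≤ ν univ * ∫⁻ x, h x ^ 2 ∂ν := by
  have h1 := ENNReal.lintegral_mul_le_Lp_mul_Lq ν Real.HolderConjugate.two_two hh
    (aemeasurable_const (b := (1 : ℝ≥0∞)))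
  simp only [Pi.mul_apply, mul_one, ENNReal.rpow_two, one_pow, lintegral_const, one_mul] at h1
  calc (∫⁻ x, h x ∂ν) ^ 2
      ≤ ((∫⁻ x, h x ^ 2 ∂ν) ^ (1 / 2 : ℝ) * ν univ ^ (1 / 2 : ℝ)) ^ 2 := by gcongr
    _ = _ := by
      rw [mul_pow, ← ENNReal.rpow_two, ← ENNReal.rpow_two, ← ENNReal.rpow_mul, ← ENNReal.rpow_mul]
      norm_num
      rw [mul_comm]

theorem eLpNorm_two_sq (f : Ω → ℝ) : eLpNorm f 2 μ ^ 2 = ∫⁻ ω, ‖f ω‖ₑ ^ 2 ∂μ := by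
  have h := eLpNorm_nnreal_pow_eq_lintegral (f := f) (μ := μ) (p := 2) two_ne_zero
  simpa using h

/-- A process with almost surely continuous paths is indistinguishable from a jointly measurable
one. -/
theorem exists_jointly_measurable {g : ℝ≥0 → Ω → ℝ} (hm : ∀ t, Measurable (g t))
    (hc : ∀ᵐ ω ∂μ, Continuous fun t => g t ω) :
    ∃ g' : ℝ → Ω → ℝ, Measurable (Function.uncurry g') ∧
      ∀ᵐ ω ∂μ, ∀ r : ℝ, g' r ω = g r.toNNReal ω := by
  obtain ⟨s, hs, hsm, hs0⟩ := exists_measurable_superset_of_null (ae_iff.1 hc)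
  refine ⟨fun r => sᶜ.indicator (g r.toNNReal), ?_, ?_⟩
  · refine measurable_uncurry_of_continuous_of_measurable (fun ω => ?_)
      fun r => (hm _).indicator hsm.compl
    by_cases hω : ω ∈ s
    · simpa [hω] using continuous_const
    · have : Continuous fun t => g t ω := by
        by_contra h
        exact hω (hs h)
      simp only [Set.mem_compl_iff, hω, not_false_eq_true, Set.indicator_of_mem]
      exact this.comp continuous_real_toNNReal
  · filter_upwards [compl_mem_ae_iff.2 hs0] with ω hω r
    rw [Set.indicator_of_mem hω]

theorem aestronglyMeasurable_timeIntegral {g : ℝ≥0 → Ω → ℝ} (hm : ∀ t, Measurable (g t))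
    (hc : ∀ᵐ ω ∂μ, Continuous fun t => g t ω) (a b : ℝ) :
    AEStronglyMeasurable (fun ω => ∫ r in a..b, g r.toNNReal ω) μ := by
  obtain ⟨g', hg', he⟩ := exists_jointly_measurable hm hc
  have h1 : ∀ s : Set ℝ, StronglyMeasurable fun ω => ∫ r in s, g' r ω := fun s =>
    (hg'.comp measurable_swap).stronglyMeasurable.integral_prod_right'
  refine ⟨fun ω => ∫ r in a..b, g' r ω, ?_, ?_⟩
  · simp only [intervalIntegral]
    exact (h1 _).sub (h1 _)
  · filter_upwards [he] with ω hω
    simp only [hω]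

/-- Cauchy-Schwarz in time and Tonelli bound the squared norm by `(t - s)` times the time integral
of `m²`. -/
theorem eLpNorm_timeIntegral_le [SFinite μ] {g : ℝ≥0 → Ω → ℝ} (hm : ∀ t, Measurable (g t))
    (hc : ∀ᵐ ω ∂μ, Continuous fun t => g t ω) {s t : ℝ≥0} (hst : s ≤ t) {m : ℝ} (hm0 : 0 ≤ m)
    (hb : ∀ r, s ≤ r → r ≤ t → eLpNorm (g r) 2 μ ≤ ENNReal.ofReal m) :
    eLpNorm (fun ω => ∫ r in (s : ℝ)..t, g r.toNNReal ω) 2 μ ≤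
      ENNReal.ofReal (m * ((t : ℝ) - s)) := by
  obtain ⟨g', hg', he⟩ := exists_jointly_measurable hm hc
  have hst' : (s : ℝ) ≤ t := NNReal.coe_le_coe.2 hst
  have hae : (fun ω => ∫ r in (s : ℝ)..t, g r.toNNReal ω) =ᵐ[μ]
      fun ω => ∫ r in Ioc (s : ℝ) t, g' r ω := by
    filter_upwards [he] with ω hω
    simp only [hω]
    exact intervalIntegral.integral_of_le hst'
  have hmeas : Measurable fun z : ℝ × Ω => ‖g' z.1 z.2‖ₑ ^ 2 := (hg'.enorm.pow_const 2)
  have hb' : ∀ r ∈ Ioc (s : ℝ) t, ∫⁻ ω, ‖g' r ω‖ₑ ^ 2 ∂μ ≤ ENNReal.ofReal m ^ 2 := by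
    intro r hr
    rw [← eLpNorm_two_sq, eLpNorm_congr_ae (he.mono fun ω h => h r)]
    gcongr
    refine hb _ (NNReal.le_toNNReal_of_coe_le hr.1.le) (Real.toNNReal_le_iff_le_coe.2 hr.2)
  have key : eLpNorm (fun ω => ∫ r in Ioc (s : ℝ) t, g' r ω) 2 μ ^ 2 ≤
      (ENNReal.ofReal (m * ((t : ℝ) - s))) ^ 2 := by
    rw [eLpNorm_two_sq]
    calc ∫⁻ ω, ‖∫ r in Ioc (s : ℝ) t, g' r ω‖ₑ ^ 2 ∂μ
        ≤ ∫⁻ ω, ENNReal.ofReal (t - s) * ∫⁻ r in Ioc (s : ℝ) t, ‖g' r ω‖ₑ ^ 2 ∂volume ∂μ := by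
          refine lintegral_mono fun ω => ?_
          have hgω : Measurable fun r => g' r ω := hg'.comp measurable_prodMk_right
          calc ‖∫ r in Ioc (s : ℝ) t, g' r ω‖ₑ ^ 2
              ≤ (∫⁻ r in Ioc (s : ℝ) t, ‖g' r ω‖ₑ) ^ 2 := by
                gcongr
                exact enorm_integral_le_lintegral_enorm _
            _ ≤ _ := by
                have := sq_lintegral_le (volume.restrict (Ioc (s : ℝ) t))
                  hgω.enorm.aemeasurable
                simpa using this
      _ = ENNReal.ofReal (t - s) * ∫⁻ r in Ioc (s : ℝ) t, ∫⁻ ω, ‖g' r ω‖ₑ ^ 2 ∂μ := by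
          rw [lintegral_const_mul' _ _ ENNReal.ofReal_ne_top, lintegral_lintegral_swap]
          exact (hmeas.comp measurable_swap).aemeasurable
      _ ≤ ENNReal.ofReal (t - s) * ∫⁻ r in Ioc (s : ℝ) t, ENNReal.ofReal m ^ 2 := by
          gcongr 1
          exact setLIntegral_mono measurable_const hb'
      _ = _ := by
          rw [setLIntegral_const, Real.volume_Ioc, ENNReal.ofReal_mul hm0]
          ring
  rw [eLpNorm_congr_ae hae]
  exact (ENNReal.pow_le_pow_left_iff two_ne_zero).1 key

theorem isIntegralLike_toLp [IsFiniteMeasure μ] {g : ℝ≥0 → Ω → ℝ} (hm : ∀ t, Measurable (g t))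
    (hc : ∀ᵐ ω ∂μ, Continuous fun t => g t ω) (hL : ∀ t, MemLp (g t) 2 μ)
    {v : ℝ≥0 → ℝ≥0 → Lp ℝ 2 μ}
    (hv : ∀ s t, s ≤ t → v s t =ᵐ[μ] fun ω => ∫ r in (s : ℝ)..t, g r.toNNReal ω) :
    IsIntegralLike v fun t => (hL t).toLp := by
  intro s t x m hst hb
  have hm0 : 0 ≤ m := (norm_nonneg _).trans (hb s le_rfl hst)
  have hst' : (s : ℝ) ≤ t := NNReal.coe_le_coe.2 hst
  have hx : Measurable x := (Lp.stronglyMeasurable x).measurable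
  have h1 := eLpNorm_timeIntegral_le (g := fun r ω => g r ω - x ω) (μ := μ)
    (fun r => (hm r).sub hx) (hc.mono fun ω h => h.sub continuous_const) hst hm0 ?_
  · have h2 : ⇑(v s t - ((t : ℝ) - s) • x) =ᵐ[μ]
        fun ω => ∫ r in (s : ℝ)..t, (g r.toNNReal ω - x ω) := by
      filter_upwards [Lp.coeFn_sub (v s t) (((t : ℝ) - s) • x), Lp.coeFn_smul ((t : ℝ) - s) x,
        hv s t hst, hc] with ω a1 a2 a3 a4
      have hi : IntervalIntegrable (fun r : ℝ => g r.toNNReal ω) volume s t :=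
        (a4.comp continuous_real_toNNReal).intervalIntegrable _ _
      rw [a1, Pi.sub_apply, a2, a3, intervalIntegral.integral_sub hi (by simp)]
      simp
    rw [Lp.norm_def, eLpNorm_congr_ae h2]
    exact ENNReal.toReal_le_of_le_ofReal (mul_nonneg hm0 (sub_nonneg.2 hst')) h1
  · intro r hsr hrt
    have h3 := hb r hsr hrt
    rw [Lp.norm_def] at h3
    have h4 : ⇑((hL r).toLp - x) =ᵐ[μ] fun ω => g r ω - x ω := by
      filter_upwards [Lp.coeFn_sub ((hL r).toLp) x, (hL r).coeFn_toLp] with ω a1 a2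
      rw [a1, Pi.sub_apply, a2]
    rw [eLpNorm_congr_ae h4] at h3
    refine (ENNReal.le_ofReal_iff_toReal_le ?_ hm0).2 h3
    exact ((hL r).sub (Lp.memLp x)).2.ne

theorem inner_toLp {X Y : Ω → ℝ} (hX : MemLp X 2 μ) (hY : MemLp Y 2 μ) :
    inner ℝ hX.toLp hY.toLp = ∫ ω, X ω * Y ω ∂μ := by
  rw [L2.inner_def]
  refine integral_congr_ae ?_
  filter_upwards [hX.coeFn_toLp, hY.coeFn_toLp] with ω h1 h2
  rw [h1, h2]
  exact mul_comm _ _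

theorem norm_toLp_sq {X : Ω → ℝ} (hX : MemLp X 2 μ) : ‖hX.toLp‖ ^ 2 = ∫ ω, X ω ^ 2 ∂μ := by
  rw [← real_inner_self_eq_norm_sq, inner_toLp]
  simp_rw [sq]

variable [IsProbabilityMeasure μ]

variable (μ) in
/-- The constant function `1` as an element of `L²`. -/
noncomputable abbrev oneL2 : Lp ℝ 2 μ := (memLp_const (1 : ℝ)).toLp

theorem inner_toLp_one {X : Ω → ℝ} (hX : MemLp X 2 μ) :
    inner ℝ hX.toLp (oneL2 μ) = ∫ ω, X ω ∂μ := by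
  rw [inner_toLp]
  simp

theorem innerCov_toLp {X Y : Ω → ℝ} (hX : MemLp X 2 μ) (hY : MemLp Y 2 μ) :
    innerCov (oneL2 μ) hX.toLp hY.toLp = cov[X, Y; μ] := by
  rw [innerCov, covariance_eq_sub hX hY, inner_toLp, inner_toLp_one, real_inner_comm,
    inner_toLp_one]
  rfl

theorem inner_toLp_eq_covariance {X Y : Ω → ℝ} (hX : MemLp X 2 μ) (hY : MemLp Y 2 μ)
    (h0 : ∫ ω, X ω ∂μ = 0) : inner ℝ hX.toLp hY.toLp = cov[X, Y; μ] := by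
  rw [covariance_eq_sub hX hY, h0, zero_mul, sub_zero, inner_toLp]
  rfl

theorem inner_toLp_eq_zero_of_indepFun {X Y : Ω → ℝ} (h : IndepFun X Y μ) (hX : MemLp X 2 μ)
    (hY : MemLp Y 2 μ) (h0 : ∫ ω, X ω ∂μ = 0) : inner ℝ hX.toLp hY.toLp = 0 := by
  rw [inner_toLp_eq_covariance hX hY h0, h.covariance_eq_zero hX hY]

end TimeIntegral

end EnsembleLangevin
namespace EnsembleLangevin

/-! ### Mean-field solutions as Hilbert space solutions -/

namespace IsMeanFieldSolution

variable {N : ℕ} {Ω : Type*} {mΩ : MeasurableSpace Ω} {μ : Measure Ω}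
  {γ : ℝ} {B : Matrix (Fin N) (Fin N) ℝ} {c : Fin N → ℝ} {ℱ : Filtration ℝ≥0 mΩ}
  {W : Fin N → ℝ≥0 → Ω → ℝ} {q p : ℝ≥0 → Ω → Fin N → ℝ}

local notation "⟪" x ", " y "⟫" => inner ℝ x y

theorem memLp_brownian (h : IsMeanFieldSolution μ γ B c ℱ W q p) (i : Fin N) (t : ℝ≥0) :
    MemLp (W i t) 2 μ :=
  ((h.brownian i).hasLaw_eval t).hasGaussianLaw.memLp_two

theorem measurable_position (h : IsMeanFieldSolution μ γ B c ℱ W q p) (t : ℝ≥0) :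
    Measurable (q t) :=
  (h.q_adapted t).mono (ℱ.le t) le_rfl

theorem measurable_momentum (h : IsMeanFieldSolution μ γ B c ℱ W q p) (t : ℝ≥0) :
    Measurable (p t) :=
  (h.p_adapted t).mono (ℱ.le t) le_rfl

/-- The position, as a curve in `L²`. -/
noncomputable def positionCurve (h : IsMeanFieldSolution μ γ B c ℱ W q p) (t : ℝ≥0) (i : Fin N) :
    Lp ℝ 2 μ :=
  (h.q_memLp t i).toLp

/-- The momentum, as a curve in `L²`. -/
noncomputable def momentumCurve (h : IsMeanFieldSolution μ γ B c ℱ W q p) (t : ℝ≥0) (i : Fin N) :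
    Lp ℝ 2 μ :=
  (h.p_memLp t i).toLp

theorem curves_bounded (h : IsMeanFieldSolution μ γ B c ℱ W q p) (T : ℝ≥0) :
    ∃ R : ℝ, ∀ t ≤ T, ∀ i, ‖h.positionCurve t i‖ ≤ R ∧ ‖h.momentumCurve t i‖ ≤ R := by
  obtain ⟨R, hR⟩ := h.moment_bound T
  refine ⟨√R, fun t ht i => ⟨?_, ?_⟩⟩
  · exact Real.le_sqrt_of_sq_le ((norm_toLp_sq _).trans_le (hR t ht i).1)
  · exact Real.le_sqrt_of_sq_le ((norm_toLp_sq _).trans_le (hR t ht i).2)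

/-- The approximation with step `1 / n` of the Itô integral of `σ` up to time `t`, as a random
variable. -/
noncomputable def itoSumFun (W : Fin N → ℝ≥0 → Ω → ℝ)
    (σ : ℝ≥0 → Matrix (Fin N) (Fin N) ℝ) (n : ℕ) (t : ℝ≥0) (i : Fin N) (ω : Ω) : ℝ :=
  ∑ k ∈ Finset.range ⌈t * n⌉₊, ∑ j : Fin N, σ ((k : ℝ≥0) / n) i j *
    (W j (min (((k + 1 : ℕ) : ℝ≥0) / n) t) ω - W j (min ((k : ℝ≥0) / n) t) ω)

theorem itoSum_ae_eq (h : IsMeanFieldSolution μ γ B c ℱ W q p)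
    (σ : ℝ≥0 → Matrix (Fin N) (Fin N) ℝ) (n : ℕ) (t : ℝ≥0) (i : Fin N) :
    ((itoSum (fun i t => (h.memLp_brownian i t).toLp) σ n t i : Lp ℝ 2 μ) : Ω → ℝ) =ᵐ[μ]
      itoSumFun W σ n t i := by
  have h1 : ∀ (a : ℝ) (j : Fin N) (x y : ℝ≥0),
      ((a • ((h.memLp_brownian j x).toLp - (h.memLp_brownian j y).toLp) : Lp ℝ 2 μ) : Ω → ℝ)
        =ᵐ[μ] fun ω => a * (W j x ω - W j y ω) := by
    intro a j x y
    filter_upwards [Lp.coeFn_smul a ((h.memLp_brownian j x).toLp - (h.memLp_brownian j y).toLp),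
      Lp.coeFn_sub (h.memLp_brownian j x).toLp (h.memLp_brownian j y).toLp,
      (h.memLp_brownian j x).coeFn_toLp, (h.memLp_brownian j y).coeFn_toLp] with ω a1 a2 a3 a4
    rw [a1, Pi.smul_apply, a2, Pi.sub_apply, a3, a4, smul_eq_mul]
  have h2 : ∀ k : ℕ, ((∑ j : Fin N, σ ((k : ℝ≥0) / n) i j •
      ((h.memLp_brownian j (min (((k + 1 : ℕ) : ℝ≥0) / n) t)).toLp -
        (h.memLp_brownian j (min ((k : ℝ≥0) / n) t)).toLp) : Lp ℝ 2 μ) : Ω → ℝ) =ᵐ[μ]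
      fun ω => ∑ j : Fin N, σ ((k : ℝ≥0) / n) i j *
        (W j (min (((k + 1 : ℕ) : ℝ≥0) / n) t) ω - W j (min ((k : ℝ≥0) / n) t) ω) := by
    intro k
    refine (Lp.coeFn_fun_finsetSum _ _).trans ?_
    filter_upwards [ae_all_iff.2 fun j => h1 (σ ((k : ℝ≥0) / n) i j) j
      (min (((k + 1 : ℕ) : ℝ≥0) / n) t) (min ((k : ℝ≥0) / n) t)] with ω hω
    simp only [hω]
  refine (Lp.coeFn_fun_finsetSum _ _).trans ?_
  filter_upwards [ae_all_iff.2 h2] with ω hω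
  simp only [hω, itoSumFun]

/-- The negative drift of the momentum, as a process. -/
noncomputable def driftField (μ : Measure Ω) (γ : ℝ) (B : Matrix (Fin N) (Fin N) ℝ)
    (c : Fin N → ℝ) (q p : ℝ≥0 → Ω → Fin N → ℝ) (t : ℝ≥0) (ω : Ω) : Fin N → ℝ :=
  (moments (law μ q p t)).Cq *ᵥ (B⁻¹ *ᵥ q t ω - c) + γ • p t ω

theorem measurable_driftField (h : IsMeanFieldSolution μ γ B c ℱ W q p) (t : ℝ≥0) :
    Measurable (driftField μ γ B c q p t) := by
  have hc : Continuous fun z : (Fin N → ℝ) × (Fin N → ℝ) =>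
      (moments (law μ q p t)).Cq *ᵥ (B⁻¹ *ᵥ z.1 - c) + γ • z.2 := by fun_prop
  have hm := hc.measurable.comp ((h.measurable_position t).prodMk (h.measurable_momentum t))
  simp only [Function.comp_def] at hm
  exact hm

variable [IsProbabilityMeasure μ]

theorem isBrownianCurve (h : IsMeanFieldSolution μ γ B c ℱ W q p) :
    IsBrownianCurve fun i t => (h.memLp_brownian i t).toLp := by
  intro i j s t
  have h0 := (h.brownian i).integral_eval s
  split_ifs with hij
  · subst hij
    rw [inner_toLp_eq_covariance _ _ h0, (h.brownian i).covariance_eval, NNReal.coe_min]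
  · have hind : IndepFun (W i s) (W j t) μ :=
      (h.brownian_indep.indepFun hij).comp (measurable_pi_apply s) (measurable_pi_apply t)
    exact inner_toLp_eq_zero_of_indepFun hind _ _ h0

/-- The increment is centered and independent of `ℱ a`, which contains `ℱ s`. -/
theorem inner_increment_eq_zero (h : IsMeanFieldSolution μ γ B c ℱ W q p) (l : Fin N)
    {s a b : ℝ≥0} (hsa : s ≤ a) (hab : a ≤ b) {X : Ω → ℝ} (hX : MemLp X 2 μ)
    (hXm : Measurable[ℱ s] X) :
    ⟪(h.memLp_brownian l b).toLp - (h.memLp_brownian l a).toLp, hX.toLp⟫ = 0 := by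
  rw [← MemLp.toLp_sub]
  refine inner_toLp_eq_zero_of_indepFun ?_ _ _ ?_
  · rw [IndepFun_iff_Indep]
    refine indep_of_indep_of_le (h.brownian_increments a b hab) ?_
      ((measurable_iff_comap_le.1 hXm).trans (ℱ.mono hsa))
    rw [show W l b - W l a = (fun x : Fin N → ℝ => x l) ∘ fun ω i => W i b ω - W i a ω from rfl,
      ← MeasurableSpace.comap_comp]
    exact MeasurableSpace.comap_mono (measurable_pi_apply l).comap_le
  · have e := integral_sub ((h.memLp_brownian l b).integrable (by norm_num))
      ((h.memLp_brownian l a).integrable (by norm_num))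
    exact e.trans (by rw [(h.brownian l).integral_eval, (h.brownian l).integral_eval, sub_zero])

theorem moments_law (h : IsMeanFieldSolution μ γ B c ℱ W q p) (t : ℝ≥0) :
    moments (law μ q p t) =
      hilbertMoments (oneL2 μ) h.positionCurve h.momentumCurve t := by
  have hm : AEMeasurable (fun ω => (q t ω, p t ω)) μ :=
    ((h.measurable_position t).prodMk (h.measurable_momentum t)).aemeasurable
  have h1 : ∀ (ν : Measure ((Fin N → ℝ) × (Fin N → ℝ))) (i : Fin N),
      AEStronglyMeasurable (fun z => z.1 i) ν := fun ν i =>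
    ((measurable_pi_apply i).comp measurable_fst).aestronglyMeasurable
  have h2 : ∀ (ν : Measure ((Fin N → ℝ) × (Fin N → ℝ))) (i : Fin N),
      AEStronglyMeasurable (fun z => z.2 i) ν := fun ν i =>
    ((measurable_pi_apply i).comp measurable_snd).aestronglyMeasurable
  rw [hilbertMoments, Real.toNNReal_coe]
  refine Prod.ext ?_ (Prod.ext ?_ (Prod.ext ?_ (Prod.ext ?_ ?_)))
  · ext i
    exact (integral_map hm (h1 _ i)).trans (inner_toLp_one (h.q_memLp t i)).symm
  · ext i
    exact (integral_map hm (h2 _ i)).trans (inner_toLp_one (h.p_memLp t i)).symm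
  · ext i j
    exact (covariance_map_fun (h1 _ i) (h1 _ j) hm).trans
      (innerCov_toLp (h.q_memLp t i) (h.q_memLp t j)).symm
  · ext i j
    exact (covariance_map_fun (h2 _ i) (h2 _ j) hm).trans
      (innerCov_toLp (h.p_memLp t i) (h.p_memLp t j)).symm
  · ext i j
    exact (covariance_map_fun (h1 _ i) (h2 _ j) hm).trans
      (innerCov_toLp (h.q_memLp t i) (h.p_memLp t j)).symm

theorem Cq_law (h : IsMeanFieldSolution μ γ B c ℱ W q p) (t : ℝ≥0) :
    (moments (law μ q p t)).Cq =
      covMatrix (oneL2 μ) (h.positionCurve t) (h.positionCurve t) := by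
  rw [h.moments_law, hilbertMoments, Real.toNNReal_coe]

theorem position_isIntegralLike (h : IsMeanFieldSolution μ γ B c ℱ W q p) (i : Fin N) :
    IsIntegralLike (fun s t => h.positionCurve t i - h.positionCurve s i)
      fun t => h.momentumCurve t i := by
  refine isIntegralLike_toLp (g := fun t ω => p t ω i)
    (fun t => (measurable_pi_apply i).comp (h.measurable_momentum t))
    (h.p_continuous.mono fun ω hω => (continuous_apply i).comp hω) (fun t => h.p_memLp t i)
    fun s t hst => ?_
  filter_upwards [Lp.coeFn_sub (h.positionCurve t i) (h.positionCurve s i),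
    (h.q_memLp t i).coeFn_toLp, (h.q_memLp s i).coeFn_toLp, h.position_eq t, h.position_eq s,
    h.p_continuous] with ω a1 a2 a3 a4 a5 a6
  have hc : Continuous fun r : ℝ => p r.toNNReal ω := a6.comp continuous_real_toNNReal
  rw [a1, Pi.sub_apply, positionCurve, positionCurve, a2, a3, a4, a5]
  have e : (∫ r in (s : ℝ)..t, p r.toNNReal ω) i = ∫ r in (s : ℝ)..t, p r.toNNReal ω i :=
    ((ContinuousLinearMap.proj (R := ℝ) (φ := fun _ : Fin N => ℝ) i).intervalIntegral_comp_comm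
      (hc.intervalIntegrable s t)).symm
  have e2 := intervalIntegral.integral_interval_sub_left (μ := volume)
    (hc.intervalIntegrable 0 t) (hc.intervalIntegrable 0 s)
  rw [← e, ← e2]
  simp

theorem continuous_Cq_law (h : IsMeanFieldSolution μ γ B c ℱ W q p) :
    Continuous fun t => (moments (law μ q p t)).Cq := by
  have hc : ∀ i, Continuous fun t => h.positionCurve t i := fun i =>
    continuous_of_isIntegralLike (h.position_isIntegralLike i) fun T => by
      obtain ⟨R, hR⟩ := h.curves_bounded T
      exact ⟨R, fun t ht => (hR t ht i).2⟩
  simp_rw [h.Cq_law]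
  exact continuous_matrix fun i j => continuous_innerCov _ (hc i) (hc j)

theorem continuous_driftField (h : IsMeanFieldSolution μ γ B c ℱ W q p) :
    ∀ᵐ ω ∂μ, Continuous fun t => driftField μ γ B c q p t ω := by
  filter_upwards [h.q_continuous, h.p_continuous] with ω h1 h2
  have h3 := h.continuous_Cq_law
  unfold driftField
  fun_prop

theorem driftCurve_ae_eq (h : IsMeanFieldSolution μ γ B c ℱ W q p) (t : ℝ≥0) (i : Fin N) :
    ((driftCurve γ B c (oneL2 μ) h.positionCurve h.momentumCurve t i : Lp ℝ 2 μ) : Ω → ℝ) =ᵐ[μ]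
      fun ω => driftField μ γ B c q p t ω i := by
  rw [driftCurve, ← h.Cq_law t]
  set C := (moments (law μ q p t)).Cq
  have hk : ∀ᵐ ω ∂μ, ∀ k, (((C * B⁻¹) i k • h.positionCurve t k : Lp ℝ 2 μ) : Ω → ℝ) ω =
      (C * B⁻¹) i k * q t ω k := by
    refine ae_all_iff.2 fun k => ?_
    filter_upwards [Lp.coeFn_smul ((C * B⁻¹) i k) (h.positionCurve t k),
      (h.q_memLp t k).coeFn_toLp] with ω a1 a2
    rw [a1, Pi.smul_apply, positionCurve, a2, smul_eq_mul]
  filter_upwards [hk, Lp.coeFn_add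
      (∑ k, (C * B⁻¹) i k • h.positionCurve t k - (C *ᵥ c) i • (oneL2 μ))
      (γ • h.momentumCurve t i),
    Lp.coeFn_sub (∑ k, (C * B⁻¹) i k • h.positionCurve t k)
      ((C *ᵥ c) i • (oneL2 μ)),
    Lp.coeFn_fun_finsetSum Finset.univ fun k => (C * B⁻¹) i k • h.positionCurve t k,
    Lp.coeFn_smul ((C *ᵥ c) i) (oneL2 μ),
    Lp.coeFn_smul γ (h.momentumCurve t i), (h.p_memLp t i).coeFn_toLp,
    (memLp_const (1 : ℝ) : MemLp (fun _ : Ω => (1 : ℝ)) 2 μ).coeFn_toLp]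
    with ω a0 a1 a2 a3 a4 a5 a6 a7
  rw [a1, Pi.add_apply, a2, Pi.sub_apply, a3, a4, a5, Pi.smul_apply, Pi.smul_apply, a7,
    momentumCurve, a6, driftField, Matrix.mulVec_sub, Matrix.mulVec_mulVec]
  simp only [a0]
  simp [C, Matrix.mulVec, dotProduct]

theorem exists_isHilbertSolution (h : IsMeanFieldSolution μ γ B c ℱ W q p) :
    ∃ M : ℝ≥0 → Fin N → Lp ℝ 2 μ, IsHilbertSolution γ B c (oneL2 μ)
      (fun i t => (h.memLp_brownian i t).toLp) h.positionCurve h.momentumCurve M := by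
  set σ := fun s => CFC.sqrt ((2 * γ) • (moments (law μ q p s)).Cq) with hσ
  set I : ℝ≥0 → Fin N → Ω → ℝ := fun t i ω =>
    p t ω i - p 0 ω i + ∫ r in (0 : ℝ)..t, driftField μ γ B c q p r.toNNReal ω i with hI
  have hdm : ∀ i t, Measurable fun ω => driftField μ γ B c q p t ω i := fun i t =>
    (measurable_pi_apply i).comp (h.measurable_driftField t)
  have hdc : ∀ i, ∀ᵐ ω ∂μ, Continuous fun t => driftField μ γ B c q p t ω i := fun i =>
    h.continuous_driftField.mono fun ω hω => (continuous_apply i).comp hω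
  have hito : ∀ t i, Tendsto (fun n : ℕ => eLpNorm (itoSumFun W σ n t i - I t i) 2 μ)
      atTop (𝓝 0) := by
    intro t i
    refine (h.momentum_eq t i).congr fun n => eLpNorm_congr_ae ?_
    filter_upwards [h.continuous_driftField] with ω hω
    have hc : Continuous fun r : ℝ => driftField μ γ B c q p r.toNNReal ω :=
      hω.comp continuous_real_toNNReal
    have e : (∫ r in (0 : ℝ)..t, driftField μ γ B c q p r.toNNReal ω) i =
        ∫ r in (0 : ℝ)..t, driftField μ γ B c q p r.toNNReal ω i :=
      ((ContinuousLinearMap.proj (R := ℝ) (φ := fun _ : Fin N => ℝ) i).intervalIntegral_comp_comm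
        (hc.intervalIntegrable _ _)).symm
    simp only [Pi.sub_apply, hI, ← e]
    rfl
  have hSm : ∀ n t i, MemLp (itoSumFun W σ n t i) 2 μ := fun n t i =>
    (memLp_congr_ae (h.itoSum_ae_eq σ n t i)).1 (Lp.memLp _)
  have hIm : ∀ t i, MemLp (I t i) 2 μ := by
    intro t i
    -- Square integrability of the limit is not assumed: it follows since one step sum lies in `L²`
    -- and is at finite `L²` distance from it.
    obtain ⟨n, hn⟩ := ((hito t i).eventually (gt_mem_nhds ENNReal.zero_lt_top)).exists
    have hIa : AEStronglyMeasurable (I t i) μ :=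
      ((h.p_memLp t i).1.sub (h.p_memLp 0 i).1).add
        (aestronglyMeasurable_timeIntegral (hdm i) (hdc i) 0 t)
    have hd : MemLp (itoSumFun W σ n t i - I t i) 2 μ := ⟨(hSm n t i).1.sub hIa, hn⟩
    simpa using (hSm n t i).sub hd
  refine ⟨fun t i => (hIm t i).toLp, ?_⟩
  have he1 := inner_toLp_one (μ := μ) (memLp_const (1 : ℝ))
  have hunit : ∀ s, Measurable[ℱ s] fun _ : Ω => (1 : ℝ) := fun s => measurable_const
  refine ⟨by simpa using he1, h.isBrownianCurve, fun t i => ?_,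
    fun l a b hab => h.inner_increment_eq_zero l le_rfl hab _ (hunit a),
    fun l a b s i hs hab => h.inner_increment_eq_zero l hs hab _
      ((measurable_pi_apply i).comp (h.q_adapted s)),
    fun l a b s i hs hab => h.inner_increment_eq_zero l hs hab _
      ((measurable_pi_apply i).comp (h.p_adapted s)),
    h.curves_bounded, h.position_isIntegralLike, fun i => ?_⟩
  · refine (Lp.tendsto_Lp_iff_tendsto_eLpNorm _ _ _).2 ((hito t i).congr fun n => ?_)
    simp_rw [← h.Cq_law]
    exact eLpNorm_congr_ae ((h.itoSum_ae_eq σ n t i).symm.sub EventuallyEq.rfl)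
  · have hL : ∀ t, MemLp (fun ω => driftField μ γ B c q p t ω i) 2 μ := fun t =>
      (memLp_congr_ae (h.driftCurve_ae_eq t i)).1 (Lp.memLp _)
    have hcurve : (fun t => driftCurve γ B c (oneL2 μ) h.positionCurve
        h.momentumCurve t i) = fun t => (hL t).toLp := by
      ext1 t
      exact Lp.ext ((h.driftCurve_ae_eq t i).trans (hL t).coeFn_toLp.symm)
    rw [hcurve]
    refine isIntegralLike_toLp (hdm i) (hdc i) hL fun s t hst => ?_
    filter_upwards [Lp.coeFn_sub ((hIm t i).toLp - (hIm s i).toLp)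
        (h.momentumCurve t i - h.momentumCurve s i),
      Lp.coeFn_sub (hIm t i).toLp (hIm s i).toLp,
      Lp.coeFn_sub (h.momentumCurve t i) (h.momentumCurve s i),
      (hIm t i).coeFn_toLp, (hIm s i).coeFn_toLp, (h.p_memLp t i).coeFn_toLp,
      (h.p_memLp s i).coeFn_toLp, hdc i] with ω a1 a2 a3 a4 a5 a6 a7 a8
    have hc : Continuous fun r : ℝ => driftField μ γ B c q p r.toNNReal ω i :=
      a8.comp continuous_real_toNNReal
    rw [a1, Pi.sub_apply, a2, a3, Pi.sub_apply, Pi.sub_apply, a4, a5, momentumCurve,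
      momentumCurve, a6, a7, ← intervalIntegral.integral_interval_sub_left
      (hc.intervalIntegrable 0 _) (hc.intervalIntegrable _ _)]
    simp only [hI]
    ring

theorem isIntegralCurveOn_moments (h : IsMeanFieldSolution μ γ B c ℱ W q p) (hγ : 0 ≤ γ)
    (hB : B.IsSymm) :
    IsIntegralCurveOn (fun t : ℝ => moments (law μ q p t.toNNReal)) (fun _ => momentField γ B c)
      (Ici 0) := by
  obtain ⟨M, hM⟩ := h.exists_isHilbertSolution
  have e : (fun t : ℝ => moments (law μ q p t.toNNReal)) =
      hilbertMoments (oneL2 μ) h.positionCurve h.momentumCurve := by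
    ext1 t
    rw [h.moments_law, hilbertMoments, hilbertMoments, Real.toNNReal_coe]
  rw [e]
  exact hM.isIntegralCurveOn_hilbertMoments hγ hB

end IsMeanFieldSolution

end EnsembleLangevin

theorem proposition5p1 (γ : ℝ) (hγ : 0 < γ) :
    (∀ (N J : ℕ) (P : LinearInverseProblem N J),
      -- the mean and covariance of the law of any solution of the mean-field dynamics
      -- satisfy the system of ordinary differential equations
      (∀ {Ω : Type*} [mΩ : MeasurableSpace Ω] (μ : Measure Ω) [IsProbabilityMeasure μ]
        (ℱ : Filtration ℝ≥0 mΩ) (W : Fin N → ℝ≥0 → Ω → ℝ) (q p : ℝ≥0 → Ω → Fin N → ℝ),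
        IsMeanFieldSolution μ γ P.B P.c ℱ W q p →
        IsIntegralCurveOn (fun t : ℝ => moments (law μ q p t.toNNReal))
          (fun _ => momentField γ P.B P.c) (Ici 0)) ∧
      -- the unique steady state with positive definite covariance
      (equilibrium P.B P.c ∈ nondegenerateStates N ∧
        ∀ x ∈ nondegenerateStates N,
          momentField γ P.B P.c x = 0 ↔ x = equilibrium P.B P.c) ∧
      -- it is the Gibbs measure, whose marginal on `q` is the posterior
      (IsGaussian (P.gibbs P.B) ∧
        moments (P.gibbs P.B) = equilibrium P.B P.c ∧
        (P.gibbs P.B).map Prod.fst = P.posterior ∧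
        IsGaussian P.posterior) ∧
      -- the form of all other steady states
      (∀ x ∈ symmetricStates N, x ≠ equilibrium P.B P.c →
        (momentField γ P.B P.c x = 0 ↔
          ∃ (X : Matrix (Fin N) (Fin N) ℝ) (m : Fin N → ℝ),
            X * X = X ∧ X.IsSymm ∧ X ≠ 1 ∧ x.Cq *ᵥ m = 0 ∧
            x = (P.B *ᵥ (P.c + m), 0, CFC.sqrt P.B * X * CFC.sqrt P.B,
              CFC.sqrt P.B * X * CFC.sqrt P.B, 0))) ∧
      -- all other steady states are degenerate and unstable
      (∀ x ∈ symmetricStates N, momentField γ P.B P.c x = 0 → x ≠ equilibrium P.B P.c →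
        x ∈ covarianceStates N ∧ x.cov.det = 0 ∧
        IsLinearlyUnstableAt (momentField γ P.B P.c) (symmetricStates N) x ∧
        ¬ IsLyapunovStableAt (momentField γ P.B P.c) (covarianceStates N) x) ∧
      -- the nondegenerate equilibrium is hyperbolic and linearly stable
      IsHyperbolicAt (momentField γ P.B P.c) (symmetricStates N) (equilibrium P.B P.c) ∧
      IsLinearlyStableAt (momentField γ P.B P.c) (symmetricStates N) (equilibrium P.B P.c) ∧
      -- its basin of attraction is open in the set of means and positive definite covariances,
      -- and contains the equilibrium
      (∃ U : Set (MomentState N), IsOpen U ∧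
        basin (momentField γ P.B P.c) (nondegenerateStates N) (equilibrium P.B P.c)
          = U ∩ nondegenerateStates N) ∧
      equilibrium P.B P.c ∈
        basin (momentField γ P.B P.c) (nondegenerateStates N) (equilibrium P.B P.c)) ∧
    -- convergence in the basin takes place at a speed independent of `B` and `c`: the exponential
    -- rate `κ` depends on `γ` only, and the trajectory in affine-invariant coordinates, as well as
    -- the prefactor `K` in these coordinates, depends only on the initial value in them
    (∃ κ : ℝ, 0 < κ ∧ ∀ N : ℕ,
      (∃ K : MomentState N → ℝ, ∀ (J : ℕ) (P : LinearInverseProblem N J)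
        (z : ℝ → MomentState N),
        IsIntegralCurveOn z (fun _ => momentField γ P.B P.c) (Ici 0) →
        z 0 ∈ basin (momentField γ P.B P.c) (nondegenerateStates N) (equilibrium P.B P.c) →
        (∀ t ≥ 0, ‖normalizedCoords P.B P.c (z t) - (0, 0, 1, 1, 0)‖ ≤
          K (normalizedCoords P.B P.c (z 0)) * Real.exp (-κ * t)) ∧
        (∃ K' : ℝ, ∀ t ≥ 0, ‖z t - equilibrium P.B P.c‖ ≤ K' * Real.exp (-κ * t))) ∧
      (∀ (J J' : ℕ) (P : LinearInverseProblem N J) (P' : LinearInverseProblem N J')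
        (z z' : ℝ → MomentState N),
        IsIntegralCurveOn z (fun _ => momentField γ P.B P.c) (Ici 0) →
        IsIntegralCurveOn z' (fun _ => momentField γ P'.B P'.c) (Ici 0) →
        normalizedCoords P.B P.c (z 0) = normalizedCoords P'.B P'.c (z' 0) →
        ∀ t ≥ 0, normalizedCoords P.B P.c (z t) = normalizedCoords P'.B P'.c (z' t))) := by
  refine ⟨fun N J P => ⟨?_, ?_, ?_, ?_, ?_, ?_, ?_, ?_, ?_⟩, exists_uniform_rate hγ⟩
  · exact fun μ _ ℱ W q p h => h.isIntegralCurveOn_moments hγ.le P.posDef_B.isHermitian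
  · exact ⟨equilibrium_mem_nondegenerateStates P.posDef_B,
      fun x hx => steady_nondegenerate_iff hγ P.posDef_B hx⟩
  · exact P.gibbs_gaussian
  · exact fun x hx hne => steady_degenerate_iff hγ P.posDef_B hx hne
  · exact fun x hx h0 hne => degenerate_steady_states hγ P.posDef_B hx h0 hne
  · exact fun z hz => (isLinearlyStableAt_equilibrium hγ P.posDef_B z hz).ne
  · exact isLinearlyStableAt_equilibrium hγ P.posDef_B
  · exact exists_isOpen_basin_equilibrium hγ P.posDef_B
  · exact equilibrium_mem_basin P.posDef_B
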